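/- **Model.** A CONGEST network is a finite simple graph $G$ (not necessarily connected) with $n$ nodes, where each node has a distinct identifier of $O(\log n)$ bits and an arbitrary local numbering of its incident edges (ports). Computation is deterministic and proceeds in synchronous rounds; in each round every node sends one message of $O(\log n)$ bits to each neighbor. Initially a node knows only its identifier, its degree, the global parameters ($n$, $k$, and in part 1 also $c$, $d$) and its local input. Distances are hop distances in $G$. A family of rooted trees of $G$ is stored distributedly: every node knows the labels of the trees that contain it and, for each of them, whether it is the root or else the port leading to its parent. **Weak-diameter decomposition.** A $(c,d)$ weak-diameter decomposition of $G^{2k}$ is a partition of $V$ into clusters, each with one of $c$ colors and with a distinct $O(\log n)$-bit label, such that any two nodes in different clusters of the same color are at distance more than $2k$ in $G$; and each cluster $C$ comes with a tree $T_C\subseteq G$ of diameter at most $d$ which is rooted at a node of $C$, contains all of $C$ (and possibly nodes outside $C$), and in which every path between two nodes of $C$ without internal nodes in $C$ has length at most $2k$. It is given to the nodes in that each node knows the color and label of its cluster and its pointers in the trees $T_C$. **Neighborhood cover.** An $s$-sparse $k$-neighborhood cover of diameter $D$ is a family of clusters $C\subseteq V$ such that (A) each cluster has a rooted spanning tree of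 $G[C]$ of diameter at most $D$, (B) for every node $v$ some cluster contains all nodes at distance at most $k$ from $v$, and (C) every node is in at most $s$ clusters. To compute it means that the rooted spanning trees, and hence the clusters, are stored at the nodes as above. **Statement.** 1. For every $k\ge 1$ and all $c,d$: given a $(c,d)$ weak-diameter decomposition of $G^{2k}$, a deterministic CONGEST algorithm computes in $O(c(d+k))$ rounds a $c$-sparse $k$-neighborhood cover all of whose rooted spanning trees have depth at most $d+k$ (distance from the root) and diameter at most $d+2k$. Moreover, if all trees $T_C$ of the decomposition have depth at most $r$, then the trees of the cover have depth at most $r+k$. The constant in the $O(c(d+k))$ is absolute. 2. There is a deterministic CONGEST algorithm that, for every $k\ge 1$ and every $n$-node graph $G$, computes a $2^{O(\sqrt{\log n})}$-sparse $k$-neighborhood cover of diameter $k\cdot 2^{O(\sqrt{\log n})}$ in $k\cdot 2^{O(\sqrt{\log n})}$ rounds. Here the constants (including the one in the message size) depend only on the constant in the $O(\log n)$ bound on the identifier length. -/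

import Mathlib

/-! ### The CONGEST model -/

/-- A communication network: a graph, distinct numerical identifiers of the nodes, and at every
node `v` an arbitrary numbering of the incident edges by ports `0, …, deg v - 1`. -/
structure Network (V : Type) where
  graph : SimpleGraph V
  id : V → ℕ
  id_injective : Function.Injective id
  deg : V → ℕ
  port : (v : V) → Fin (deg v) ≃ graph.neighborSet v

/-- A deterministic synchronous message-passing algorithm with local inputs in `I` and local
outputs in `O`. A node starts from its own identifier, its number of ports and its local input.
In each round it sends one message through each port, then updates its state from the messages
that arrived (`none` at a port number that does not exist). After `rounds` rounds every node
produces its output. Local computation and memory are unrestricted. -/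
structure DistAlgorithm (I O : Type) where
  State : Type
  Msg : Type
  init : (id : ℕ) → (deg : ℕ) → I → State
  send : State → (port : ℕ) → Msg
  step : State → (received : ℕ → Option Msg) → State
  rounds : ℕ
  output : State → O

namespace DistAlgorithm

variable {I O V : Type}

/-- The state of every node after `t` rounds. -/
def exec (A : DistAlgorithm I O) (N : Network V) (input : V → I) : ℕ → V → A.State
  | 0, v => A.init (N.id v) (N.deg v) (input v)
  | t + 1, v => A.step (A.exec N input t v) fun p =>
      if h : p < N.deg v then
        let u := N.port v ⟨p, h⟩
        some (A.send (A.exec N input t u) ((N.port u).symm ⟨v, u.2.symm⟩))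
      else none

/-- The outputs of the nodes when the algorithm stops. -/
def result (A : DistAlgorithm I O) (N : Network V) (input : V → I) (v : V) : O :=
  A.output (A.exec N input A.rounds v)

/-- Every message can be encoded by `b` bits: there are at most `2 ^ b` different messages
(sending nothing counts as a message). -/
def UsesBits (A : DistAlgorithm I O) (b : ℕ) : Prop :=
  Finite A.Msg ∧ Nat.card A.Msg ≤ 2 ^ b

end DistAlgorithm

/-- The unit of length for "`O(log n)` bits": the length of the binary expansion of `n`. -/
def logBits (n : ℕ) : ℕ := Nat.log 2 n + 1

/-! ### Families of rooted trees, decompositions and covers -/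

/-- A rooted tree in `G`. It is a spanning tree of `G[C]` for `C = tree.verts`. -/
structure RootedSubtree {V : Type} (G : SimpleGraph V) where
  tree : G.Subgraph
  isTree : tree.coe.IsTree
  root : tree.verts

namespace RootedSubtree

variable {V : Type} {G : SimpleGraph V}

/-- The diameter of the tree. -/
noncomputable def diameter (T : RootedSubtree G) : ℕ∞ := T.tree.coe.ediam

/-- The depth of the tree: the largest distance in the tree from the root. -/
noncomputable def depth (T : RootedSubtree G) : ℕ∞ := T.tree.coe.eccent T.root

/-- `w` is the parent of `v`: the neighbour of `v` in the tree that is closer to the root. -/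
def IsParent (T : RootedSubtree G) (v w : T.tree.verts) : Prop :=
  T.tree.coe.Adj v w ∧ T.tree.coe.dist w T.root < T.tree.coe.dist v T.root

end RootedSubtree

/-- A family of rooted trees in `G` indexed by a set of numerical labels. -/
structure TreeFamily {V : Type} (G : SimpleGraph V) where
  labels : Set ℕ
  tree : labels → RootedSubtree G

/-- What a single node knows about a family of rooted trees: at a label, the value is `none` if
the node is not in the tree with that label, `some none` if it is the root of that tree, and
`some (some p)` if it is in that tree and its parent is the neighbour behind port `p`. -/
abbrev TreePointers : Type := ℕ → Option (Option ℕ)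

/-- The pointers stored at the nodes describe the family `F`. -/
structure Represents {V : Type} (N : Network V) (ptr : V → TreePointers)
    (F : TreeFamily N.graph) : Prop where
  mem : ∀ v l, ptr v l ≠ none ↔ ∃ h : l ∈ F.labels, v ∈ (F.tree ⟨l, h⟩).tree.verts
  root : ∀ l : F.labels, ptr ((F.tree l).root : V) l = some none
  parent : ∀ (l : F.labels) (v : (F.tree l).tree.verts), v ≠ (F.tree l).root →
    ∃ (w : (F.tree l).tree.verts) (p : Fin (N.deg v)),
      (F.tree l).IsParent v w ∧ (N.port v p : V) = w ∧ ptr v l = some (some (p : ℕ))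

/-- A `(c, d)` weak-diameter decomposition of the power `G^r`. The clusters are the fibres of
`cluster`. Each cluster has a tree in `G` that contains it, may pass through vertices outside it,
and has diameter at most `d`, with distances measured in `G`. -/
structure IsWeakDecomposition {V : Type} (G : SimpleGraph V) (c d r : ℕ)
    (color cluster : V → ℕ) (F : TreeFamily G) : Prop where
  labels_eq : F.labels = Set.range cluster
  color_lt : ∀ v, color v < c
  color_eq : ∀ u v, cluster u = cluster v → color u = color v
  /-- Different clusters of the same color have distance more than `r`. -/
  separated : ∀ u v, color u = color v → cluster u ≠ cluster v → (r : ℕ∞) < G.edist u v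
  spans : ∀ (l : F.labels) (v : V), cluster v = l → v ∈ (F.tree l).tree.verts
  root_mem : ∀ l : F.labels, cluster ((F.tree l).root : V) = l
  /-- Consecutive vertices of the cluster on the tree are adjacent in `G^r`: a path in the tree
  between two vertices of the cluster without internal vertices in the cluster has length at
  most `r`. -/
  hop : ∀ (l : F.labels) (u v : (F.tree l).tree.verts), cluster u = l → cluster v = l →
    ∀ p : (F.tree l).tree.coe.Walk u v, p.IsPath →
      (∀ w ∈ p.support, cluster w = l → w = u ∨ w = v) → p.length ≤ r
  diameter_le : ∀ l : F.labels, (F.tree l).diameter ≤ d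

/-- An `s`-sparse `k`-neighborhood cover of diameter `D`. The clusters are the vertex sets of the
trees of the family, each tree being a rooted spanning tree of the subgraph induced by its
cluster. -/
structure IsNeighborhoodCover {V : Type} (G : SimpleGraph V) (s k D : ℕ)
    (F : TreeFamily G) : Prop where
  diameter_le : ∀ l : F.labels, (F.tree l).diameter ≤ D
  covers : ∀ v : V, ∃ l : F.labels, ∀ u : V, G.edist v u ≤ k → u ∈ (F.tree l).tree.verts
  sparse : ∀ v : V, {l : F.labels | v ∈ (F.tree l).tree.verts}.encard ≤ s

/-- The local input of a node that is given a decomposition: color and label of its own cluster,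
and its pointers in the trees of the clusters. -/
structure DecompositionInput where
  color : ℕ
  cluster : ℕ
  pointers : TreePointers

/-!
*From a decomposition to a cover.* The colors are processed one after another. The clusters of one
color are more than `2k` apart, so the waves of `k` hops that start from them do not collide, and
every node within distance `k` of a cluster learns a port towards it. Then the vertices of a
cluster `C` and their ancestors in `T_C` are marked, and the marked nodes keep their pointers in
`T_C`. On the way to the root, two consecutive vertices of `C` are at most `2k` edges apart, so
every marked node is within distance `k` of `C`. Hence a node is in at most one cluster per color,
while the pruned tree keeps the diameter `d` and each of its ends is extended by at most `k`.

*From scratch.* The clusters are grown by the deterministic method of Rozhoň and Ghaffari, with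
distance `2k` in place of adjacency. A class of clusters starts from single nodes, labelled by their
identifiers of `B` bits. For every bit, the labels with this bit set are the sources, and the nodes
of the other clusters within distance `2k` of a source propose to join it. A source accepts if the
proposals are at least a `1/(2B)` fraction of its size; otherwise the proposers lose their labels
and the source cluster stops growing. As a growing cluster grows by the factor `1 + 1/(2B)`, this
stabilizes after `O(B log n)` steps, when no two clusters that differ in this bit are near each
other. Per bit at most a `1/(2B)` fraction of the nodes loses its label to a rejecting source, so
every class covers at least half of the uncovered nodes, and `O(log n)` classes suffice. The
decisions are made by counting over trees that are extended by every wave. A wave adds a node to at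
most one tree, so the sparsity of the trees is bounded by the number of waves, which is
polylogarithmic, and so is the depth in units of `k`. A last wave of `2k` hops extends the cluster
trees; the waves of a class cannot collide as the clusters are far apart.
-/

/-! ### Programs -/

/-- One communication round of every node, for nodes with local state in `σ` and messages in `μ`:
the message sent through each port, and the update of the state from the messages received. -/
structure Instr (σ μ : Type) where
  send : σ → ℕ → μ
  step : σ → (ℕ → Option μ) → σ

/-- A purely local computation. It still costs a round, in which all messages are `0`. -/
def Instr.localStep {σ μ : Type} [Zero μ] (f : σ → σ) : Instr σ μ where
  send _ _ := 0
  step s _ := f s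

namespace Network

variable {V σ μ ν : Type} (N : Network V)

/-- The port of `u` that leads to its neighbor `v`. -/
def portTo {u v : V} (h : N.graph.Adj u v) : Fin (N.deg u) := (N.port u).symm ⟨v, h⟩

theorem adj_port (v : V) (p : Fin (N.deg v)) : N.graph.Adj v (N.port v p) := (N.port v p).2

theorem port_portTo {u v : V} (h : N.graph.Adj u v) : (N.port u (N.portTo h) : V) = v := by
  simp [portTo]

theorem portTo_eq_iff {u v : V} (h : N.graph.Adj u v) {q : Fin (N.deg u)} :
    N.portTo h = q ↔ (N.port u q : V) = v := by
  rw [portTo, Equiv.symm_apply_eq, Subtype.ext_iff, eq_comm]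

/-- The messages that arrive at `v`, by port number. -/
def inbox (snd : V → ℕ → μ) (v : V) (p : ℕ) : Option μ :=
  if h : p < N.deg v then
    some (snd (N.port v ⟨p, h⟩) (N.portTo (N.adj_port v ⟨p, h⟩).symm))
  else none

theorem inbox_fin (snd : V → ℕ → μ) (v : V) (p : Fin (N.deg v)) :
    N.inbox snd v p = some (snd (N.port v p) (N.portTo (N.adj_port v p).symm)) :=
  dif_pos p.2

theorem inbox_eq_some {snd : V → ℕ → μ} {v : V} {p : ℕ} {m : μ} (h : N.inbox snd v p = some m) :
    ∃ hp : p < N.deg v,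
      snd (N.port v ⟨p, hp⟩) (N.portTo (N.adj_port v ⟨p, hp⟩).symm) = m := by
  unfold inbox at h
  split_ifs at h with hp
  exact ⟨hp, Option.some_injective _ h⟩

theorem inbox_portTo (snd : V → ℕ → μ) {u v : V} (h : N.graph.Adj v u) :
    N.inbox snd v (N.portTo h) = some (snd u (N.portTo h.symm)) := by
  obtain ⟨p, rfl⟩ : ∃ p, u = N.port v p := ⟨_, (N.port_portTo h).symm⟩
  rw [(N.portTo_eq_iff h).2 rfl, inbox_fin]

theorem map_inbox (f : μ → ν) (snd : V → ℕ → μ) (v : V) (p : ℕ) :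
    (N.inbox snd v p).map f = N.inbox (fun u q => f (snd u q)) v p := by
  unfold inbox
  split_ifs <;> rfl

open Classical in
theorem sum_inbox [Fintype V] [AddCommMonoid μ] (snd : V → ℕ → μ) (v : V) :
    ∑ p ∈ Finset.range (N.deg v), (N.inbox snd v p).getD 0 =
      ∑ u : V, if h : N.graph.Adj u v then snd u (N.portTo h) else 0 := by
  let received (u : V) : μ := if h : N.graph.Adj u v then snd u (N.portTo h) else 0
  calc ∑ p ∈ Finset.range (N.deg v), (N.inbox snd v p).getD 0
      = ∑ u : N.graph.neighborSet v, received u := by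
        rw [Finset.sum_range]
        refine Fintype.sum_equiv (N.port v) _ _ fun p => ?_
        rw [inbox_fin, Option.getD_some]
        simp only [received, dif_pos (N.adj_port v p).symm]
    _ = ∑ u ∈ Finset.univ.filter (· ∈ N.graph.neighborSet v), received u := by
        rw [← Finset.sum_subtype_eq_sum_filter, Finset.subtype_univ]
    _ = ∑ u : V, received u := by
        refine Finset.sum_subset (Finset.subset_univ _) fun u _ hu => dif_neg fun h => hu ?_
        simpa using h.symm

theorem exec_succ {I O : Type} (A : DistAlgorithm I O) (input : V → I) (t : ℕ) (v : V) :
    A.exec N input (t + 1) v =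
      A.step (A.exec N input t v) (N.inbox (fun u => A.send (A.exec N input t u)) v) :=
  rfl

/-- The effect of one instruction on the configuration of the network. -/
def runInstr (i : Instr σ μ) (c : V → σ) (v : V) : σ :=
  i.step (c v) (N.inbox (fun u => i.send (c u)) v)

/-- The effect of a program on the configuration of the network. -/
def run : List (Instr σ μ) → (V → σ) → V → σ
  | [], c => c
  | i :: l, c => run l (N.runInstr i c)

/-- All messages sent by a program that is started in a given configuration are in `M`. -/
def Safe (M : Set μ) : List (Instr σ μ) → (V → σ) → Prop
  | [], _ => True
  | i :: l, c => (∀ v p, i.send (c v) p ∈ M) ∧ Safe M l (N.runInstr i c)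

theorem run_append (l₁ l₂ : List (Instr σ μ)) (c : V → σ) :
    N.run (l₁ ++ l₂) c = N.run l₂ (N.run l₁ c) := by
  induction l₁ generalizing c with
  | nil => rfl
  | cons _ _ ih => exact ih _

theorem safe_append (M : Set μ) (l₁ l₂ : List (Instr σ μ)) (c : V → σ) :
    N.Safe M (l₁ ++ l₂) c ↔ N.Safe M l₁ c ∧ N.Safe M l₂ (N.run l₁ c) := by
  induction l₁ generalizing c with
  | nil => simp [Safe, run]
  | cons _ _ ih => simp only [List.cons_append, Safe, run, ih, and_assoc]

/-- A Hoare triple: started in a configuration that satisfies `P`, the program sends only messages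
in `M` and ends in a configuration that satisfies `Q`. -/
def Triple (M : Set μ) (P : (V → σ) → Prop) (l : List (Instr σ μ)) (Q : (V → σ) → Prop) : Prop :=
  ∀ c, P c → N.Safe M l c ∧ Q (N.run l c)

namespace Triple

variable {N} {M : Set μ} {P Q R : (V → σ) → Prop}

theorem append {l₁ l₂ : List (Instr σ μ)} (h₁ : N.Triple M P l₁ Q) (h₂ : N.Triple M Q l₂ R) :
    N.Triple M P (l₁ ++ l₂) R := by
  intro c hc
  obtain ⟨hs, hq⟩ := h₁ c hc
  obtain ⟨hs', hr⟩ := h₂ _ hq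
  exact ⟨(N.safe_append ..).2 ⟨hs, hs'⟩, by rwa [run_append]⟩

theorem single {i : Instr σ μ} (h : ∀ c, P c → ∀ v p, i.send (c v) p ∈ M)
    (h' : ∀ c, P c → Q (N.runInstr i c)) : N.Triple M P [i] Q :=
  fun c hc => ⟨⟨h c hc, trivial⟩, h' c hc⟩

theorem localStep [Zero μ] (h0 : (0 : μ) ∈ M) {f : σ → σ} (h' : ∀ c, P c → Q fun v => f (c v)) :
    N.Triple M P [Instr.localStep f] Q :=
  single (fun _ _ _ _ => h0) h'

theorem range {Inv : ℕ → (V → σ) → Prop} {f : ℕ → List (Instr σ μ)} (n : ℕ)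
    (h : ∀ i < n, N.Triple M (Inv i) (f i) (Inv (i + 1))) :
    N.Triple M (Inv 0) ((List.range n).flatMap f) (Inv n) := by
  induction n with
  | zero => exact fun c hc => ⟨trivial, hc⟩
  | succ n ih =>
    rw [List.range_succ, List.flatMap_append]
    refine (ih fun i hi => h i (by omega)).append ?_
    simpa using h n (by omega)

theorem mono {P' Q' : (V → σ) → Prop} {l : List (Instr σ μ)} (h : N.Triple M P l Q)
    (hP : ∀ c, P' c → P c) (hQ : ∀ c, Q c → Q' c) : N.Triple M P' l Q' :=
  fun c hc => ⟨(h c (hP c hc)).1, hQ _ (h c (hP c hc)).2⟩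

theorem of_forall {l : List (Instr σ μ)} (h : ∀ c, P c → N.Triple M (· = c) l Q) :
    N.Triple M P l Q :=
  fun c hc => h c hc c rfl

end Triple

end Network

namespace Instr

variable {V σ μ I O : Type} {N : Network V} {M : Finset μ} {m₀ : M} {init : ℕ → ℕ → I → σ}
  {l : List (Instr σ μ)} {out : σ → O}

open Classical in
/-- A program as a distributed algorithm whose messages are the elements of a finite set. The
default message `m₀` replaces messages outside the set. -/
noncomputable def toAlgorithm (M : Finset μ) (m₀ : M) (init : ℕ → ℕ → I → σ)
    (l : List (Instr σ μ)) (out : σ → O) : DistAlgorithm I O where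
  State := List (Instr σ μ) × σ
  Msg := M
  init i d x := (l, init i d x)
  send s p := match s.1 with
    | [] => m₀
    | i :: _ => if h : i.send s.2 p ∈ M then ⟨_, h⟩ else m₀
  step s r := match s.1 with
    | [] => s
    | i :: l => (l, i.step s.2 fun p => (r p).map (↑))
  rounds := l.length
  output s := out s.2

theorem toAlgorithm_usesBits {b : ℕ} (h : M.card ≤ 2 ^ b) :
    (toAlgorithm M m₀ init l out).UsesBits b := by
  refine ⟨inferInstanceAs (Finite M), ?_⟩
  change Nat.card M ≤ _
  simpa using h

theorem toAlgorithm_exec (input : V → I)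
    (hs : N.Safe (M : Set μ) l fun v => init (N.id v) (N.deg v) (input v))
    (l₁ l₂ : List (Instr σ μ)) (hl : l = l₁ ++ l₂) (v : V) :
    (toAlgorithm M m₀ init l out).exec N input l₁.length v =
      (l₂, N.run l₁ (fun v => init (N.id v) (N.deg v) (input v)) v) := by
  induction l₁ using List.reverseRecOn generalizing l₂ v with
  | nil => subst hl; rfl
  | append_singleton l₁ i ih =>
    have hl' : l = l₁ ++ (i :: l₂) := by simpa using hl
    rw [hl', N.safe_append] at hs
    rw [List.length_append, List.length_singleton, N.exec_succ, N.run_append]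
    simp only [ih _ hl']
    simp only [toAlgorithm, N.map_inbox, Network.run, Network.runInstr, Prod.mk.injEq, true_and]
    refine congrArg (i.step _) (funext fun p => congrArg (N.inbox · v p) ?_)
    funext u q
    rw [dif_pos (Finset.mem_coe.1 (hs.2.1 u q))]

theorem toAlgorithm_result (input : V → I)
    (hs : N.Safe (M : Set μ) l fun v => init (N.id v) (N.deg v) (input v)) :
    (toAlgorithm M m₀ init l out).result N input =
      fun v => out (N.run l (fun v => init (N.id v) (N.deg v) (input v)) v) :=
  funext fun v =>
    congrArg (fun s : List (Instr σ μ) × σ => out s.2)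
      (toAlgorithm_exec (m₀ := m₀) input hs l [] l.append_nil.symm v)

end Instr

theorem length_flatMap_range_le {α : Type*} {f : ℕ → List α} {n b : ℕ}
    (h : ∀ i < n, (f i).length ≤ b) : ((List.range n).flatMap f).length ≤ n * b := by
  rw [List.length_flatMap]
  refine (List.sum_le_card_nsmul _ b ?_).trans (by simp)
  simpa using h

/-! ### Waves -/

/-- `u` and `v` are at distance at most `j` in `G`. -/
def Near {V : Type*} (G : SimpleGraph V) (j : ℕ) (u v : V) : Prop := G.edist u v ≤ j

namespace Near

variable {V : Type*} {G : SimpleGraph V} {i j : ℕ} {u v w : V}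

theorem of_walk (p : G.Walk u v) (hp : p.length ≤ j) : Near G j u v :=
  p.edist_le.trans (mod_cast hp)

theorem refl (v : V) : Near G j v v := of_walk .nil (Nat.zero_le _)

theorem of_adj (h : G.Adj u v) : Near G 1 u v := of_walk h.toWalk le_rfl

theorem symm (h : Near G j u v) : Near G j v u := by
  rwa [Near, SimpleGraph.edist_comm]

theorem trans (h : Near G i u v) (h' : Near G j v w) : Near G (i + j) u w :=
  SimpleGraph.edist_triangle.trans ((add_le_add h h').trans_eq (Nat.cast_add i j).symm)

theorem mono (h : Near G i u v) (hij : i ≤ j) : Near G j u v :=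
  le_trans h (Nat.cast_le.2 hij)

theorem exists_walk (h : Near G j u v) : ∃ p : G.Walk u v, p.length ≤ j := by
  obtain ⟨p, hp⟩ := SimpleGraph.exists_walk_of_edist_ne_top
    (ne_top_of_le_ne_top (ENat.natCast_ne_top j) h)
  exact ⟨p, by rw [Near, ← hp] at h; exact_mod_cast h⟩

theorem eq (h : Near G 0 u v) : u = v := by
  simpa [Near] using h

theorem eq_or_exists_adj (h : Near G (j + 1) u v) : u = v ∨ ∃ w, G.Adj v w ∧ Near G j u w := by
  obtain ⟨p, hp⟩ := h.symm.exists_walk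
  cases p with
  | nil => exact .inl rfl
  | cons h q => exact .inr ⟨_, h, .symm (.of_walk q (by simpa using hp))⟩

end Near

/-- One hop of a wave: every node without a label adopts the label of some neighbor, if there is
one. -/
structure WaveHop {V : Type*} (G : SimpleGraph V) (w w' : V → Option ℕ) : Prop where
  keep : ∀ v x, w v = some x → w' v = some x
  adopt : ∀ v x, w v = none → w' v = some x → ∃ u, G.Adj v u ∧ w u = some x
  spread : ∀ u v, G.Adj v u → w u ≠ none → w' v ≠ none

/-- The labels after `j` hops of a wave from the sources `src`: every node within distance `j` of
the sources has the label of a nearest source. -/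
structure WaveSpec {V : Type*} (G : SimpleGraph V) (src : V → ℕ → Prop) (j : ℕ)
    (w : V → Option ℕ) : Prop where
  sound : ∀ v x, w v = some x → ∃ u, src u x ∧ Near G j u v
  nearest : ∀ i ≤ j, ∀ u v x, src u x → Near G i u v →
    ∃ u' y, w v = some y ∧ src u' y ∧ Near G i u' v

theorem WaveSpec.hop {V : Type*} {G : SimpleGraph V} {src : V → ℕ → Prop} {j : ℕ}
    {w w' : V → Option ℕ} (h : WaveSpec G src j w) (hw : WaveHop G w w') :
    WaveSpec G src (j + 1) w' := by
  have sound v x (hx : w' v = some x) : ∃ u, src u x ∧ Near G (j + 1) u v := by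
    rcases hv : w v with _ | y
    · obtain ⟨u, hu, hux⟩ := hw.adopt v x hv hx
      obtain ⟨s, hs, hsu⟩ := h.sound u x hux
      exact ⟨s, hs, hsu.trans (.of_adj hu.symm)⟩
    · obtain rfl : y = x := by simpa [hw.keep v y hv] using hx
      obtain ⟨s, hs, hsu⟩ := h.sound v y hv
      exact ⟨s, hs, hsu.mono (Nat.le_succ j)⟩
  have reached u v x (hu : src u x) (huv : Near G (j + 1) u v) : w' v ≠ none := by
    rcases huv.eq_or_exists_adj with rfl | ⟨t, ht, hut⟩
    · obtain ⟨-, y, hy, -⟩ := h.nearest 0 (Nat.zero_le j) u u x hu (.refl u)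
      simp [hw.keep u y hy]
    · obtain ⟨-, y, hy, -⟩ := h.nearest j le_rfl u t x hu hut
      exact hw.spread t v ht (by simp [hy])
  refine ⟨sound, fun i hi u v x hu huv => ?_⟩
  rcases Nat.le_succ_iff.1 hi with hij | rfl
  · obtain ⟨u', y, hy, hu', hn⟩ := h.nearest i hij u v x hu huv
    exact ⟨u', y, hw.keep v y hy, hu', hn⟩
  · obtain ⟨y, hy⟩ := Option.ne_none_iff_exists'.1 (reached u v x hu huv)
    obtain ⟨u', hu', hn⟩ := sound v y hy
    exact ⟨u', y, hy, hu', hn⟩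

open Classical in
/-- A port at which a label arrives, with this label. The message `0` is no label and `x + 1` is
the label `x`. -/
noncomputable def arrivingLabel (r : ℕ → Option ℕ) : Option (ℕ × ℕ) :=
  if h : ∃ q : ℕ × ℕ, r q.1 = some (q.2 + 1) then some h.choose else none

theorem eq_some_of_arrivingLabel_eq_some {r : ℕ → Option ℕ} {p x : ℕ}
    (h : arrivingLabel r = some (p, x)) : r p = some (x + 1) := by
  unfold arrivingLabel at h
  split_ifs at h with h'
  simpa [Option.some_injective _ h] using h'.choose_spec

theorem arrivingLabel_ne_none {r : ℕ → Option ℕ} {p x : ℕ} (h : r p = some (x + 1)) :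
    arrivingLabel r ≠ none := by
  rw [arrivingLabel, dif_pos ⟨(p, x), h⟩]
  exact Option.some_ne_none _

/-- The message that stands for an optional label, see `arrivingLabel`. -/
def labelMsg : Option ℕ → ℕ
  | none => 0
  | some x => x + 1

theorem labelMsg_eq_succ {o : Option ℕ} {x : ℕ} : labelMsg o = x + 1 ↔ o = some x := by
  cases o <;> simp [labelMsg]

/-- The label that a node with optional label `w` adopts after receiving `r`, with the port it came
from. -/
noncomputable def adopt (w : Option ℕ) (r : ℕ → Option ℕ) : Option (ℕ × ℕ) :=
  if w = none then arrivingLabel r else none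

section Adopt

variable {V : Type} {N : Network V} {w : V → Option ℕ}

theorem adopt_eq_some {v : V} {p x : ℕ}
    (h : adopt (w v) (N.inbox (fun u _ => labelMsg (w u)) v) = some (p, x)) :
    w v = none ∧ ∃ hp : p < N.deg v, w (N.port v ⟨p, hp⟩) = some x := by
  unfold adopt at h
  split_ifs at h with hw
  obtain ⟨hp, hm⟩ := N.inbox_eq_some (eq_some_of_arrivingLabel_eq_some h)
  exact ⟨hw, hp, labelMsg_eq_succ.1 hm⟩

theorem waveHop_adopt :
    WaveHop N.graph w fun v =>
      (w v).or ((adopt (w v) (N.inbox (fun u _ => labelMsg (w u)) v)).map Prod.snd) where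
  keep v x h := by simp [h]
  adopt v x h h' := by
    simp only [h, Option.none_or, Option.map_eq_some_iff] at h'
    obtain ⟨⟨p, y⟩, hp, rfl⟩ := h'
    rw [← h] at hp
    obtain ⟨-, hp, hy⟩ := adopt_eq_some hp
    exact ⟨_, N.adj_port v ⟨p, hp⟩, hy⟩
  spread u v hvu hu := by
    rcases w v with _ | y
    · obtain ⟨y, hy⟩ := Option.ne_none_iff_exists'.1 hu
      have hin := N.inbox_portTo (fun u _ => labelMsg (w u)) hvu
      rw [labelMsg_eq_succ.2 hy] at hin
      simpa [_root_.adopt] using arrivingLabel_ne_none hin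
    · simp

end Adopt

/-! ### Trees from parent pointers -/

/-- `par` maps every vertex of `S` other than `r` to an adjacent vertex of `S` of smaller rank. The
edges from the vertices to their images form a tree with vertex set `S` and root `r`. -/
structure IsParentMap {V : Type} (G : SimpleGraph V) (S : Set V) (r : V) (par : V → V)
    (rank : V → ℕ) : Prop where
  root_mem : r ∈ S
  par_mem : ∀ v ∈ S, v ≠ r → par v ∈ S
  adj : ∀ v ∈ S, v ≠ r → G.Adj v (par v)
  rank_lt : ∀ v ∈ S, v ≠ r → rank (par v) < rank v

namespace IsParentMap

variable {V : Type} {G : SimpleGraph V} {S : Set V} {r : V} {par : V → V} {rank : V → ℕ}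

/-- The subgraph formed by the edges between the vertices and their parents. -/
def subgraph (h : IsParentMap G S r par rank) : G.Subgraph where
  verts := S
  Adj u v := (u ∈ S ∧ u ≠ r ∧ par u = v) ∨ (v ∈ S ∧ v ≠ r ∧ par v = u)
  adj_sub := by
    rintro u v (⟨hu, hur, rfl⟩ | ⟨hv, hvr, rfl⟩)
    · exact h.adj u hu hur
    · exact (h.adj v hv hvr).symm
  edge_vert := by
    rintro u v (⟨hu, -, -⟩ | ⟨hv, hvr, rfl⟩)
    · exact hu
    · exact h.par_mem v hv hvr
  symm := ⟨fun _ _ => Or.symm⟩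

theorem adj_par (h : IsParentMap G S r par rank) (v : h.subgraph.verts) (hv : (v : V) ≠ r) :
    h.subgraph.coe.Adj v ⟨par v, h.par_mem v v.2 hv⟩ :=
  Or.inl ⟨v.2, hv, rfl⟩

theorem eq_par_of_adj_of_rank_le (h : IsParentMap G S r par rank) {u v : h.subgraph.verts}
    (huv : h.subgraph.coe.Adj v u) (hrank : rank u ≤ rank v) : (u : V) = par v := by
  rcases huv with ⟨-, -, hp⟩ | ⟨hu, hur, hp⟩
  · exact hp.symm
  · exact absurd (hp ▸ h.rank_lt u hu hur) hrank.not_gt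

theorem exists_walk_root (h : IsParentMap G S r par rank) (v : h.subgraph.verts) :
    ∃ p : h.subgraph.coe.Walk v ⟨r, h.root_mem⟩, p.length ≤ rank v := by
  induction hn : rank v using Nat.strong_induction_on generalizing v with
  | _ n ih =>
    by_cases hv : (v : V) = r
    · obtain rfl : v = ⟨r, h.root_mem⟩ := Subtype.ext hv
      exact ⟨.nil, Nat.zero_le _⟩
    · have hlt := h.rank_lt v v.2 hv
      obtain ⟨p, hp : p.length ≤ rank (par v)⟩ :=
        ih _ (hn ▸ hlt) ⟨par v, h.par_mem v v.2 hv⟩ rfl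
      exact ⟨.cons (h.adj_par v hv) p, by rw [SimpleGraph.Walk.length_cons]; omega⟩

theorem connected (h : IsParentMap G S r par rank) : h.subgraph.coe.Connected := by
  have : Nonempty h.subgraph.verts := ⟨⟨r, h.root_mem⟩⟩
  refine ⟨fun u v => ?_⟩
  obtain ⟨p, -⟩ := h.exists_walk_root u
  obtain ⟨q, -⟩ := h.exists_walk_root v
  exact ⟨p.append q.reverse⟩

theorem isTree (h : IsParentMap G S r par rank) : h.subgraph.coe.IsTree := by
  classical
  refine ⟨h.connected, fun u c hc => ?_⟩
  -- Both neighbors on the cycle of a vertex of maximal rank would be its parent.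
  obtain ⟨v, hv, hmax⟩ := c.support.toFinset.exists_max_image (fun v => rank v) ⟨u, by simp⟩
  rw [List.mem_toFinset] at hv
  have hc' := hc.rotate hv
  have hle {w : h.subgraph.verts} (hw : w ∈ (c.rotate v hv).support) : rank w ≤ rank v :=
    hmax w (by simpa [SimpleGraph.Walk.mem_support_rotate_iff] using hw)
  refine hc'.snd_ne_penultimate (Subtype.ext ?_)
  rw [h.eq_par_of_adj_of_rank_le ((c.rotate v hv).adj_snd hc'.not_nil)
      (hle (SimpleGraph.Walk.getVert_mem_support _ 1)),
    h.eq_par_of_adj_of_rank_le ((c.rotate v hv).adj_penultimate hc'.not_nil).symm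
      (hle (SimpleGraph.Walk.getVert_mem_support _ _))]

/-- The rooted tree described by a parent map. -/
def toTree (h : IsParentMap G S r par rank) : RootedSubtree G where
  tree := h.subgraph
  isTree := h.isTree
  root := ⟨r, h.root_mem⟩

theorem isParent_par (h : IsParentMap G S r par rank) (v : h.toTree.tree.verts) (hv : (v : V) ≠ r) :
    h.toTree.IsParent v ⟨par v, h.par_mem v v.2 hv⟩ := by
  refine ⟨h.adj_par v hv, ?_⟩
  induction hn : h.toTree.tree.coe.dist v h.toTree.root using Nat.strong_induction_on
    generalizing v with
  | _ n ih =>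
    obtain ⟨p, hp⟩ := h.connected.exists_walk_length_eq_dist v h.toTree.root
    cases p with
    | nil => exact absurd rfl hv
    | @cons _ w _ hvw q =>
      have hw : h.toTree.tree.coe.dist w h.toTree.root < n := by
        rw [← hn]
        exact (SimpleGraph.dist_le q).trans_lt (hp ▸ Nat.lt_succ_self _)
      rcases hvw with ⟨-, -, hpar⟩ | ⟨-, hwr, hpar⟩
      · obtain rfl : ⟨par v, h.par_mem v v.2 hv⟩ = w := Subtype.ext hpar
        exact hw
      · have hback := ih _ hw w hwr rfl
        obtain rfl : ⟨par w, h.par_mem w w.2 hwr⟩ = v := Subtype.ext hpar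
        omega

theorem depth_le (h : IsParentMap G S r par rank) {rank' : V → ℕ} {m : ℕ}
    (h' : IsParentMap G S r par rank') (hm : ∀ v ∈ S, rank' v ≤ m) : h.toTree.depth ≤ m := by
  rw [RootedSubtree.depth, SimpleGraph.eccent_le_iff]
  intro v
  obtain ⟨p, hp⟩ := h'.exists_walk_root v
  rw [SimpleGraph.edist_comm]
  exact p.edist_le.trans (mod_cast hp.trans (hm v v.2))

theorem diameter_le (h : IsParentMap G S r par rank) {m : ℕ} (hm : ∀ v ∈ S, rank v ≤ m) :
    h.toTree.diameter ≤ (2 * m : ℕ) := by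
  refine (SimpleGraph.ediam_le_two_mul_eccent h.toTree.root).trans ?_
  push_cast
  gcongr
  exact h.depth_le h hm

end IsParentMap

namespace Network

variable {V : Type} (N : Network V)

/-- The neighbor to which the pointer of `v` for the label `l` leads, or `v` itself if there is no
such pointer. -/
def parentOf (out : V → TreePointers) (l : ℕ) (v : V) : V :=
  match out v l with
  | some (some p) => if h : p < N.deg v then N.port v ⟨p, h⟩ else v
  | _ => v

theorem parentOf_eq {out : V → TreePointers} {l p : ℕ} {v : V} (h : out v l = some (some p))
    (hp : p < N.deg v) : N.parentOf out l v = N.port v ⟨p, hp⟩ := by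
  simp [parentOf, h, hp]

/-- For every label in `Λ` the pointers lead to the root, and every step decreases the rank. -/
structure PointersTo (out : V → TreePointers) (Λ : Set ℕ) (root : Λ → V) (rank : Λ → V → ℕ) :
    Prop where
  root_eq : ∀ l : Λ, out (root l) l = some none
  label_mem : ∀ v l, out v l ≠ none → l ∈ Λ
  eq_root : ∀ (v : V) (l : Λ), out v l = some none → v = root l
  parent : ∀ (v : V) (l : Λ) (p : ℕ), out v l = some (some p) →
    ∃ hp : p < N.deg v, out (N.port v ⟨p, hp⟩) l ≠ none ∧
      rank l (N.port v ⟨p, hp⟩) < rank l v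

namespace PointersTo

variable {N} {out : V → TreePointers} {Λ : Set ℕ} {root : Λ → V} {rank : Λ → V → ℕ}

theorem exists_port (h : N.PointersTo out Λ root rank) (l : Λ) (v : V) (hv : out v l ≠ none)
    (hr : v ≠ root l) : ∃ p : Fin (N.deg v), out v l = some (some (p : ℕ)) ∧
      N.parentOf out l v = N.port v p ∧ out (N.port v p) l ≠ none ∧
        rank l (N.port v p) < rank l v := by
  obtain ⟨_ | p, ho⟩ := Option.ne_none_iff_exists'.1 hv
  · exact absurd (h.eq_root v l ho) hr
  · obtain ⟨hp, hmem, hlt⟩ := h.parent v l p ho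
    exact ⟨⟨p, hp⟩, ho, N.parentOf_eq ho hp, hmem, hlt⟩

theorem isParentMap (h : N.PointersTo out Λ root rank) (l : Λ) :
    IsParentMap N.graph {v | out v l ≠ none} (root l) (N.parentOf out l) (rank l) where
  root_mem := by simp [h.root_eq l]
  par_mem v hv hr := by
    obtain ⟨p, -, he, hmem, -⟩ := h.exists_port l v hv hr
    rwa [he]
  adj v hv hr := by
    obtain ⟨p, -, he, -, -⟩ := h.exists_port l v hv hr
    rw [he]
    exact N.adj_port v p
  rank_lt v hv hr := by
    obtain ⟨p, -, he, -, hlt⟩ := h.exists_port l v hv hr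
    rwa [he]

/-- The family of trees described by the pointers. -/
def family (h : N.PointersTo out Λ root rank) : TreeFamily N.graph where
  labels := Λ
  tree l := (h.isParentMap l).toTree

theorem represents (h : N.PointersTo out Λ root rank) : Represents N out h.family where
  mem v l := ⟨fun hv => ⟨h.label_mem v l hv, hv⟩, fun ⟨_, hv⟩ => hv⟩
  root l := h.root_eq l
  parent l v hv := by
    have hr : (v : V) ≠ root l := fun e => hv (Subtype.ext e)
    obtain ⟨p, ho, he, -, -⟩ := h.exists_port l v v.2 hr
    exact ⟨_, p, (h.isParentMap l).isParent_par v hr, he.symm, ho⟩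

end PointersTo

end Network

/-! ### Growing clusters -/

/-- The new label of a node with label `lab` that was reached by the wave with label `w`. Nodes
whose label is a source keep it. The other nodes that were reached change to the label
of the wave if it accepts them and lose their label otherwise. -/
def relabel (src acc : ℕ → Bool) (lab w : Option ℕ) : Option ℕ :=
  match lab with
  | none => none
  | some x => if src x then some x else
    match w with
    | none => some x
    | some y => if acc y then some y else none

section Growth

variable {V : Type} [Fintype V]

open Classical in
/-- The nodes with label `y`. -/
noncomputable def members (ℓ : V → Option ℕ) (y : ℕ) : Finset V := {v | ℓ v = some y}

open Classical in
/-- The nodes with a label that is not a source and to which the wave `y` arrived. -/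
noncomputable def proposers (src : ℕ → Bool) (ℓ w : V → Option ℕ) (y : ℕ) : Finset V :=
  {v | w v = some y ∧ ∃ x, ℓ v = some x ∧ src x = false}

open Classical in
/-- The nodes that still have a label. -/
noncomputable def labelled (ℓ : V → Option ℕ) : Finset V := {v | ℓ v ≠ none}

/-- Some node with a label that is not a source is near the cluster `y`. -/
def Threatened (near : V → V → Prop) (src : ℕ → Bool) (ℓ : V → Option ℕ) (y : ℕ) : Prop :=
  ∃ u v x, ℓ u = some y ∧ ℓ v = some x ∧ src x = false ∧ near u v

open Classical in
/-- The nodes in source clusters that cannot grow any more. -/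
noncomputable def settled (near : V → V → Prop) (src : ℕ → Bool) (ℓ : V → Option ℕ) : Finset V :=
  {v | ∃ y, ℓ v = some y ∧ src y = true ∧ ¬ Threatened near src ℓ y}

/-- One step of cluster growing. The nodes near a source propose to join a source near them, and a
source accepts if the number of proposals is at least a `1 / D` fraction of its size. -/
structure GrowStep (near : V → V → Prop) (D : ℕ) (src : ℕ → Bool) (ℓ ℓ' w : V → Option ℕ)
    (acc : ℕ → Bool) : Prop where
  sound : ∀ v y, w v = some y → ∃ u, ℓ u = some y ∧ src y = true ∧ near u v
  complete : ∀ u v x, ℓ u = some x → src x = true → near u v → w v ≠ none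
  acc_iff : ∀ v y, w v = some y →
    (acc y = true ↔ (members ℓ y).card ≤ D * (proposers src ℓ w y).card)
  relabel_eq : ∀ v, ℓ' v = relabel src acc (ℓ v) (w v)

variable {near : V → V → Prop} {D : ℕ} {src acc : ℕ → Bool} {ℓ₀ ℓ ℓ' w : V → Option ℕ}

theorem mem_members {v : V} {y : ℕ} : v ∈ members ℓ y ↔ ℓ v = some y := by simp [members]

theorem mem_proposers {v : V} {y : ℕ} :
    v ∈ proposers src ℓ w y ↔ w v = some y ∧ ∃ x, ℓ v = some x ∧ src x = false := by
  simp [proposers]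

theorem mem_labelled {v : V} : v ∈ labelled ℓ ↔ ℓ v ≠ none := by simp [labelled]

theorem mem_settled {v : V} : v ∈ settled near src ℓ ↔
    ∃ y, ℓ v = some y ∧ src y = true ∧ ¬ Threatened near src ℓ y := by
  simp [settled]

theorem disjoint_members {x y : ℕ} (hxy : x ≠ y) : Disjoint (members ℓ x) (members ℓ y) := by
  refine Finset.disjoint_left.2 fun v hx hy => hxy ?_
  exact Option.some_injective _ ((mem_members.1 hx).symm.trans (mem_members.1 hy))

theorem settled_subset_labelled : settled near src ℓ ⊆ labelled ℓ := by
  intro v hv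
  obtain ⟨y, hy, -⟩ := mem_settled.1 hv
  simp [mem_labelled, hy]

open Classical in
/-- The labels that reject some proposal. -/
noncomputable def rejecters (src acc : ℕ → Bool) (ℓ w : V → Option ℕ) : Finset ℕ :=
  {y ∈ (Finset.univ.image w).eraseNone | acc y = false ∧ (proposers src ℓ w y).Nonempty}

theorem mem_rejecters {y : ℕ} :
    y ∈ rejecters src acc ℓ w ↔ acc y = false ∧ (proposers src ℓ w y).Nonempty := by
  simp only [rejecters, Finset.mem_filter, Finset.mem_eraseNone, Finset.mem_image, Finset.mem_univ,
    true_and, and_iff_right_iff_imp]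
  rintro ⟨-, v, hv⟩
  exact ⟨v, (mem_proposers.1 hv).1⟩

namespace GrowStep

theorem eq_of_src (h : GrowStep near D src ℓ ℓ' w acc) {v : V} {y : ℕ} (hv : ℓ v = some y)
    (hy : src y = true) : ℓ' v = some y := by
  simp [h.relabel_eq, relabel, hv, hy]

theorem eq_of_forall_src (h : GrowStep near D src ℓ ℓ' w acc) (hsrc : ∀ x, src x = true) :
    ℓ' = ℓ := by
  funext v
  rcases hv : ℓ v with _ | x
  · simp [h.relabel_eq, relabel, hv]
  · exact h.eq_of_src hv (hsrc x)

theorem labelled_subset (h : GrowStep near D src ℓ ℓ' w acc) : labelled ℓ' ⊆ labelled ℓ := by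
  intro v
  simp only [mem_labelled]
  contrapose!
  intro hv
  simp [h.relabel_eq, relabel, hv]

theorem src_of_wave (h : GrowStep near D src ℓ ℓ' w acc) {v : V} {y : ℕ} (hv : w v = some y) :
    src y = true := by
  obtain ⟨-, -, hy, -⟩ := h.sound v y hv
  exact hy

theorem kept_or_joined (h : GrowStep near D src ℓ ℓ' w acc) {v : V} {y : ℕ}
    (hv : ℓ' v = some y) :
    (ℓ v = some y ∧ (src y = true ∨ w v = none)) ∨ (acc y = true ∧ v ∈ proposers src ℓ w y) := by
  rw [h.relabel_eq] at hv
  rcases hx : ℓ v with _ | x <;> rcases hw : w v with _ | z <;>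
    simp only [relabel, hx, hw] at hv <;> grind [mem_proposers]

theorem exists_rejecter (h : GrowStep near D src ℓ ℓ' w acc) {v : V} (hv : ℓ v ≠ none)
    (hv' : ℓ' v = none) : ∃ y ∈ rejecters src acc ℓ w, v ∈ proposers src ℓ w y := by
  suffices ∃ y, acc y = false ∧ v ∈ proposers src ℓ w y by
    obtain ⟨y, hy, hvy⟩ := this
    exact ⟨y, mem_rejecters.2 ⟨hy, v, hvy⟩, hvy⟩
  rw [h.relabel_eq] at hv'
  rcases hx : ℓ v with _ | x <;> rcases hw : w v with _ | z <;>
    simp only [relabel, hx, hw] at hv' <;> grind [mem_proposers]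

theorem unreached_of_not_src (h : GrowStep near D src ℓ ℓ' w acc) {v : V} {x : ℕ}
    (hv : ℓ' v = some x) (hx : src x = false) : ℓ v = some x ∧ w v = none := by
  rcases h.kept_or_joined hv with ⟨hold, hor⟩ | ⟨-, hprop⟩
  · exact ⟨hold, hor.resolve_left (by simp [hx])⟩
  · simp [h.src_of_wave (mem_proposers.1 hprop).1] at hx

theorem exists_old_label (h : GrowStep near D src ℓ ℓ' w acc) {v : V} {y : ℕ}
    (hv : ℓ' v = some y) : ∃ u, ℓ u = some y := by
  rcases h.kept_or_joined hv with ⟨hold, -⟩ | ⟨-, hprop⟩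
  · exact ⟨v, hold⟩
  · obtain ⟨u, hu, -⟩ := h.sound v y (mem_proposers.1 hprop).1
    exact ⟨u, hu⟩

theorem threatened_of_mem_proposers (h : GrowStep near D src ℓ ℓ' w acc) {v : V} {y : ℕ}
    (hv : v ∈ proposers src ℓ w y) : Threatened near src ℓ y := by
  obtain ⟨hw, x, hvx, hx⟩ := mem_proposers.1 hv
  obtain ⟨u, hu, -, huv⟩ := h.sound v y hw
  exact ⟨u, v, x, hu, hvx, hx, huv⟩

theorem exists_accepted_of_threatened (h : GrowStep near D src ℓ ℓ' w acc) {y : ℕ}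
    (hy : src y = true) (ht : Threatened near src ℓ' y) :
    acc y = true ∧ ∃ u, u ∈ proposers src ℓ w y := by
  obtain ⟨u, v, x, hu, hv, hx, huv⟩ := ht
  rcases h.kept_or_joined hu with ⟨hold, -⟩ | ⟨hacc, hprop⟩
  · exact absurd (h.unreached_of_not_src hv hx).2 (h.complete u v y hold hy huv)
  · exact ⟨hacc, u, hprop⟩

theorem threatened_of_threatened (h : GrowStep near D src ℓ ℓ' w acc) {y : ℕ} (hy : src y = true)
    (ht : Threatened near src ℓ' y) : Threatened near src ℓ y := by
  obtain ⟨-, u, hu⟩ := h.exists_accepted_of_threatened hy ht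
  exact h.threatened_of_mem_proposers hu

theorem card_growth (h : GrowStep near D src ℓ ℓ' w acc) {y : ℕ} (hy : src y = true)
    (ht : Threatened near src ℓ' y) :
    (D + 1) * (members ℓ y).card ≤ D * (members ℓ' y).card := by
  classical
  obtain ⟨hacc, v, hv⟩ := h.exists_accepted_of_threatened hy ht
  have hmany := (h.acc_iff v y (mem_proposers.1 hv).1).1 hacc
  have hdisj : Disjoint (members ℓ y) (proposers src ℓ w y) := by
    refine Finset.disjoint_left.2 fun u hu hu' => ?_
    obtain ⟨-, x, hx, hsrc⟩ := mem_proposers.1 hu'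
    obtain rfl : y = x := Option.some_injective _ ((mem_members.1 hu).symm.trans hx)
    simp [hy] at hsrc
  have hsub : members ℓ y ∪ proposers src ℓ w y ⊆ members ℓ' y := by
    refine Finset.union_subset (fun u hu => ?_) fun u hu => ?_
    · exact mem_members.2 (h.eq_of_src (mem_members.1 hu) hy)
    · obtain ⟨hw, x, hx, hsrc⟩ := mem_proposers.1 hu
      simp [mem_members, h.relabel_eq, relabel, hx, hsrc, hw, hacc]
  have hcard := Finset.card_le_card hsub
  rw [Finset.card_union_of_disjoint hdisj] at hcard
  nlinarith

open Classical in
theorem card_lost_le (h : GrowStep near D src ℓ ℓ' w acc) :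
    D * (labelled ℓ \ labelled ℓ').card ≤
      ∑ y ∈ rejecters src acc ℓ w, (members ℓ y).card := by
  calc D * (labelled ℓ \ labelled ℓ').card
      ≤ D * ((rejecters src acc ℓ w).biUnion (proposers src ℓ w)).card := by
        gcongr
        intro v hv
        simp only [Finset.mem_sdiff, mem_labelled, not_not] at hv
        exact Finset.mem_biUnion.2 (h.exists_rejecter hv.1 hv.2)
    _ ≤ ∑ y ∈ rejecters src acc ℓ w, D * (proposers src ℓ w y).card := by
        rw [← Finset.mul_sum]
        gcongr
        exact Finset.card_biUnion_le
    _ ≤ ∑ y ∈ rejecters src acc ℓ w, (members ℓ y).card := by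
        refine Finset.sum_le_sum fun y hy => ?_
        obtain ⟨hrej, v, hv⟩ := mem_rejecters.1 hy
        exact (not_le.1 fun hle => by
          simpa [hrej] using (h.acc_iff v y (mem_proposers.1 hv).1).2 hle).le

theorem card_settled_le (h : GrowStep near D src ℓ ℓ' w acc) :
    (settled near src ℓ).card + ∑ y ∈ rejecters src acc ℓ w, (members ℓ y).card ≤
      (settled near src ℓ').card := by
  classical
  have hdisj : Disjoint (settled near src ℓ) ((rejecters src acc ℓ w).biUnion (members ℓ)) := by
    refine Finset.disjoint_left.2 fun v hv hv' => ?_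
    obtain ⟨y, hy, -, hnt⟩ := mem_settled.1 hv
    obtain ⟨z, hz, hvz⟩ := Finset.mem_biUnion.1 hv'
    obtain rfl : y = z := Option.some_injective _ (hy.symm.trans (mem_members.1 hvz))
    obtain ⟨-, u, hu⟩ := mem_rejecters.1 hz
    exact hnt (h.threatened_of_mem_proposers hu)
  rw [← Finset.card_biUnion fun x _ y _ hxy => disjoint_members hxy,
    ← Finset.card_union_of_disjoint hdisj]
  refine Finset.card_le_card (Finset.union_subset (fun v hv => ?_) fun v hv => ?_)
  · obtain ⟨y, hvy, hy, hnt⟩ := mem_settled.1 hv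
    exact mem_settled.2 ⟨y, h.eq_of_src hvy hy, hy, mt (h.threatened_of_threatened hy) hnt⟩
  · obtain ⟨y, hrej, hvy⟩ := Finset.mem_biUnion.1 hv
    obtain ⟨hacc, u, hu⟩ := mem_rejecters.1 hrej
    have hy := h.src_of_wave (mem_proposers.1 hu).1
    refine mem_settled.2 ⟨y, h.eq_of_src (mem_members.1 hvy) hy, hy, fun ht => ?_⟩
    simp [(h.exists_accepted_of_threatened hy ht).1] at hacc

theorem potential_le (h : GrowStep near D src ℓ ℓ' w acc) :
    D * (labelled ℓ).card + (settled near src ℓ).card ≤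
      D * (labelled ℓ').card + (settled near src ℓ').card := by
  classical
  have hlost := h.card_lost_le
  have hsettled := h.card_settled_le
  rw [← Finset.card_sdiff_add_card_eq_card h.labelled_subset, mul_add]
  omega

end GrowStep

/-- Labels of nodes near each other have the same last `i` bits. -/
def AgreeBits (near : V → V → Prop) (i : ℕ) (ℓ : V → Option ℕ) : Prop :=
  ∀ u v x y, ℓ u = some x → ℓ v = some y → near u v → ∀ j < i, x.testBit j = y.testBit j

theorem AgreeBits.growStep {i : ℕ} (ha : AgreeBits near i ℓ)
    (h : GrowStep near D src ℓ ℓ' w acc) : AgreeBits near i ℓ' := by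
  have bits_unchanged v y (hv : ℓ' v = some y) :
      ∃ x, ℓ v = some x ∧ ∀ j < i, x.testBit j = y.testBit j := by
    rcases h.kept_or_joined hv with ⟨hold, -⟩ | ⟨-, hprop⟩
    · exact ⟨y, hold, fun _ _ => rfl⟩
    · obtain ⟨hw, x, hx, -⟩ := mem_proposers.1 hprop
      obtain ⟨u, hu, -, huv⟩ := h.sound v y hw
      exact ⟨x, hx, fun j hj => (ha u v y x hu hx huv j hj).symm⟩
  intro u v x y hu hv huv j hj
  obtain ⟨x', hx', hxx⟩ := bits_unchanged u x hu
  obtain ⟨y', hy', hyy⟩ := bits_unchanged v y hv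
  rw [← hxx j hj, ← hyy j hj]
  exact ha u v x' y' hx' hy' huv j hj

/-- The invariant after `t` steps of growing the clusters whose label has bit `i`, from the
labels `ℓ₀`. -/
structure GrowInv (near : V → V → Prop) (D i : ℕ) (ℓ₀ : V → Option ℕ) (t : ℕ)
    (ℓ : V → Option ℕ) : Prop where
  agree : AgreeBits near i ℓ
  labels : ∀ v x, ℓ v = some x → ∃ u, ℓ₀ u = some x
  potential : D * (labelled ℓ₀).card ≤ D * (labelled ℓ).card + (settled near (·.testBit i) ℓ).card
  subset : labelled ℓ ⊆ labelled ℓ₀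
  growth : ∀ y, y.testBit i = true → Threatened near (·.testBit i) ℓ y →
    (D + 1) ^ t ≤ D ^ t * (members ℓ y).card

namespace GrowInv

variable {i t : ℕ}

theorem zero (h : AgreeBits near i ℓ₀) : GrowInv near D i ℓ₀ 0 ℓ₀ where
  agree := h
  labels v _ hv := ⟨v, hv⟩
  potential := Nat.le_add_right _ _
  subset := subset_rfl
  growth y _ ht := by
    obtain ⟨u, -, -, hu, -⟩ := ht
    simpa using Finset.card_pos.2 ⟨u, mem_members.2 hu⟩

theorem succ (h : GrowInv near D i ℓ₀ t ℓ) (hs : GrowStep near D (·.testBit i) ℓ ℓ' w acc) :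
    GrowInv near D i ℓ₀ (t + 1) ℓ' where
  agree := h.agree.growStep hs
  labels v x hv := by
    obtain ⟨u, hu⟩ := hs.exists_old_label hv
    exact h.labels u x hu
  potential := h.potential.trans hs.potential_le
  subset := hs.labelled_subset.trans h.subset
  growth y hy ht := by
    have hgrow := h.growth y hy (hs.threatened_of_threatened hy ht)
    calc (D + 1) ^ (t + 1) = (D + 1) * (D + 1) ^ t := by ring
      _ ≤ (D + 1) * (D ^ t * (members ℓ y).card) := by gcongr
      _ = D ^ t * ((D + 1) * (members ℓ y).card) := by ring
      _ ≤ D ^ t * (D * (members ℓ' y).card) := by gcongr D ^ t * ?_; exact hs.card_growth hy ht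
      _ = D ^ (t + 1) * (members ℓ' y).card := by ring

theorem not_threatened (h : GrowInv near D i ℓ₀ t ℓ)
    (hD : D ^ t * Fintype.card V < (D + 1) ^ t) {y : ℕ} (hy : y.testBit i = true) :
    ¬ Threatened near (·.testBit i) ℓ y := by
  intro ht
  refine (h.growth y hy ht).not_gt (lt_of_le_of_lt ?_ hD)
  gcongr
  exact Finset.card_le_univ _

theorem agree_succ (hsymm : ∀ u v, near u v → near v u) (h : GrowInv near D i ℓ₀ t ℓ)
    (hD : D ^ t * Fintype.card V < (D + 1) ^ t) : AgreeBits near (i + 1) ℓ := by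
  intro u v x y hu hv huv j hj
  rcases Nat.lt_succ_iff_lt_or_eq.1 hj with hj | rfl
  · exact h.agree u v x y hu hv huv j hj
  · rcases hx : x.testBit j with _ | _ <;> rcases hy : y.testBit j with _ | _
    · rfl
    · exact absurd ⟨v, u, x, hv, hu, hx, hsymm _ _ huv⟩ (h.not_threatened hD hy)
    · exact absurd ⟨u, v, y, hu, hv, hy, huv⟩ (h.not_threatened hD hx)
    · rfl

end GrowInv

/-- The invariant after the bits below `i` have been processed, from the labels `ℓ₀`. -/
structure PhaseInv (near : V → V → Prop) (D : ℕ) (ℓ₀ : V → Option ℕ) (i : ℕ)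
    (ℓ : V → Option ℕ) : Prop where
  agree : AgreeBits near i ℓ
  labels : ∀ v x, ℓ v = some x → ∃ u, ℓ₀ u = some x
  subset : labelled ℓ ⊆ labelled ℓ₀
  card_le : D * (labelled ℓ₀).card ≤ D * (labelled ℓ).card + i * (labelled ℓ₀).card

namespace PhaseInv

theorem zero (ℓ₀ : V → Option ℕ) : PhaseInv near D ℓ₀ 0 ℓ₀ where
  agree _ _ _ _ _ _ _ _ hj := absurd hj (Nat.not_lt_zero _)
  labels v _ hv := ⟨v, hv⟩
  subset := subset_rfl
  card_le := Nat.le_add_right _ _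

theorem succ (hsymm : ∀ u v, near u v → near v u) {i t : ℕ} (h : PhaseInv near D ℓ₀ i ℓ)
    (hg : GrowInv near D i ℓ t ℓ') (hD : D ^ t * Fintype.card V < (D + 1) ^ t) :
    PhaseInv near D ℓ₀ (i + 1) ℓ' where
  agree := hg.agree_succ hsymm hD
  labels v x hv := by
    obtain ⟨u, hu⟩ := hg.labels v x hv
    exact h.labels u x hu
  subset := hg.subset.trans h.subset
  card_le := by
    have hsettled : (settled near (·.testBit i) ℓ').card ≤ (labelled ℓ₀).card :=
      Finset.card_le_card (settled_subset_labelled.trans (hg.subset.trans h.subset))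
    linarith [h.card_le, hg.potential]

theorem eq_of_near {B : ℕ} (h : PhaseInv near D ℓ₀ B ℓ) (hB : ∀ v x, ℓ₀ v = some x → x < 2 ^ B)
    {u v : V} {x y : ℕ} (hu : ℓ u = some x) (hv : ℓ v = some y) (huv : near u v) : x = y := by
  obtain ⟨u', hu'⟩ := h.labels u x hu
  obtain ⟨v', hv'⟩ := h.labels v y hv
  refine Nat.eq_of_testBit_eq fun j => ?_
  rcases lt_or_ge j B with hj | hj
  · exact h.agree u v x y hu hv huv j hj
  · have hpow : 2 ^ B ≤ 2 ^ j := Nat.pow_le_pow_right two_pos hj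
    rw [Nat.testBit_lt_two_pow ((hB u' x hu').trans_le hpow),
      Nat.testBit_lt_two_pow ((hB v' y hv').trans_le hpow)]

theorem half_le {B : ℕ} (hB : 0 < B) (h : PhaseInv near (2 * B) ℓ₀ B ℓ) :
    (labelled ℓ₀).card ≤ 2 * (labelled ℓ).card := by
  refine Nat.le_of_mul_le_mul_left ?_ hB
  linarith [h.card_le]

end PhaseInv

end Growth

theorem pow_mul_two_pow_le {D : ℕ} (hD : 0 < D) (L : ℕ) :
    D ^ (D * L) * 2 ^ L ≤ (D + 1) ^ (D * L) := by
  have bernoulli : 2 * D ^ D ≤ (D + 1) ^ D := by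
    calc 2 * D ^ D = D ^ D + D * D ^ (D - 1) * 1 := by
          rw [← pow_succ', Nat.sub_add_cancel hD]; ring
      _ ≤ (D + 1) ^ D := pow_add_mul_le_add_pow (Nat.zero_le D) (by omega) D
  calc D ^ (D * L) * 2 ^ L = (2 * D ^ D) ^ L := by rw [mul_pow, pow_mul]; ring
    _ ≤ ((D + 1) ^ D) ^ L := Nat.pow_le_pow_left bernoulli L
    _ = (D + 1) ^ (D * L) := by rw [pow_mul]

/-! ### The growing algorithm: waves -/

/-- The local state of the cover algorithm. For every label `x`, `tree x` is `none` outside the tree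
of `x`, and otherwise the time at which the node was added to the tree and its parent port. In the
hop of a wave at time `t` the node sent `sent t` and adopted `got t`. The numbers of proposals to
`x` and of nodes with label `x`, as far as they have been reported to the node, are `acc x`, and
`dec x` is the decision of `x` on the proposals. -/
structure CoverState where
  id : ℕ
  deg : ℕ
  uncovered : Bool
  label : Option ℕ
  wave : Option ℕ
  tree : ℕ → Option (ℕ × Option ℕ)
  got : ℕ → Option ℕ
  sent : ℕ → Option ℕ
  acc : ℕ → ℕ × ℕ
  dec : ℕ → Bool

namespace CoverState

/-- Start a wave from the nodes whose label is a source. -/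
def startWave (src : ℕ → Bool) (s : CoverState) : CoverState :=
  { s with wave := s.label.filter src }

/-- The update of a node in a hop at time `t` in which it adopts `a`. -/
def afterHop (t : ℕ) (s : CoverState) (a : Option (ℕ × ℕ)) : CoverState :=
  { s with
    wave := s.wave.or (a.map Prod.snd)
    got := Function.update s.got t (a.map Prod.snd)
    sent := Function.update s.sent t s.wave
    tree := fun x => (s.tree x).or ((a.filter fun q => q.2 == x).map fun q => (t + 1, some q.1)) }

/-- The hop of a wave at time `t`. -/
noncomputable def hop (t : ℕ) : Instr CoverState (ℕ × ℕ) where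
  send s _ := (labelMsg s.wave, 0)
  step s r := s.afterHop t (adopt s.wave fun p => (r p).map Prod.fst)

/-- Prepare counting the proposals to a label and the nodes with this label. -/
def startCount (src : ℕ → Bool) (s : CoverState) : CoverState :=
  { s with acc := fun x =>
      (if s.wave = some x ∧ s.label.any (fun y => !src y) then 1 else 0,
        if s.label = some x then 1 else 0) }

/-- The message through port `q` when the nodes added at time `t + 1` report to their parents. -/
def report (t : ℕ) (s : CoverState) (q : ℕ) : ℕ × ℕ :=
  match s.got t with
  | some x => if s.tree x = some (t + 1, some q) then s.acc x else 0
  | none => 0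

/-- The nodes added at time `t + 1` report to their parents. -/
def collect (t : ℕ) : Instr CoverState (ℕ × ℕ) where
  send s q := s.report t q
  step s r :=
    { s with acc := fun x =>
        if s.sent t = some x then s.acc x + ∑ p ∈ Finset.range s.deg, (r p).getD 0
        else s.acc x }

/-- A label accepts if the proposals are at least a `1 / D` fraction of its size. -/
def judge (D : ℕ) (s : CoverState) : CoverState :=
  { s with dec := fun x => decide ((s.acc x).2 ≤ D * (s.acc x).1) }

/-- The nodes added at time `t + 1` learn the decision from their parents. -/
def spread (t : ℕ) : Instr CoverState (ℕ × ℕ) where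
  send s _ := (if s.sent t |>.any s.dec then 1 else 0, 0)
  step s r :=
    { s with dec := fun x =>
        match s.tree x with
        | some (b, some p) => if b = t + 1 then decide (r p = some (1, 0)) else s.dec x
        | _ => s.dec x }

/-- Change the labels according to the decisions. -/
def update (src : ℕ → Bool) (s : CoverState) : CoverState :=
  { s with label := relabel src s.dec s.label s.wave }

/-- One step of cluster growing with waves of `h` hops, from time `τ` on. -/
noncomputable def grow (D h : ℕ) (src : ℕ → Bool) (τ : ℕ) : List (Instr CoverState (ℕ × ℕ)) :=
  [Instr.localStep (startWave src)] ++ ((List.range h).flatMap fun j => [hop (τ + j)]) ++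
  [Instr.localStep (startCount src)] ++
  ((List.range (τ + h)).flatMap fun i => [collect (τ + h - 1 - i)]) ++
  [Instr.localStep (judge D)] ++ ((List.range (τ + h)).flatMap fun t => [spread t]) ++
  [Instr.localStep (update src)]

theorem length_grow (D h : ℕ) (src : ℕ → Bool) (τ : ℕ) :
    (grow D h src τ).length = 3 * h + 2 * τ + 4 := by
  simp [grow]; ring

theorem afterHop_tree_of_ne_none {s : CoverState} {t x : ℕ} {a : Option (ℕ × ℕ)}
    (h : s.tree x ≠ none) : (s.afterHop t a).tree x = s.tree x := by
  obtain ⟨y, hy⟩ := Option.ne_none_iff_exists'.1 h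
  simp [afterHop, hy]

theorem afterHop_tree_ne_none {s : CoverState} {t x : ℕ} {a : Option (ℕ × ℕ)}
    (h : s.tree x ≠ none) : (s.afterHop t a).tree x ≠ none := by
  rwa [afterHop_tree_of_ne_none h]

theorem afterHop_tree_eq_some {s : CoverState} {t x b : ℕ} {q : Option ℕ} {a : Option (ℕ × ℕ)}
    (h : (s.afterHop t a).tree x = some (b, q)) :
    s.tree x = some (b, q) ∨ ∃ p, a = some (p, x) ∧ b = t + 1 ∧ q = some p := by
  rcases hx : s.tree x with _ | y
  · simp only [afterHop, hx, Option.none_or, Option.map_eq_some_iff, Option.filter_eq_some_iff,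
      beq_iff_eq, Prod.mk.injEq] at h
    obtain ⟨⟨p, z⟩, ⟨ha, rfl⟩, hb, hq⟩ := h
    exact .inr ⟨p, ha, hb.symm, hq.symm⟩
  · left
    rwa [afterHop_tree_of_ne_none (by simp [hx]), hx] at h

theorem afterHop_tree_adopted (s : CoverState) (t p x : ℕ) :
    (s.afterHop t (some (p, x))).tree x ≠ none := by
  rcases hx : s.tree x with _ | y <;> simp [afterHop, hx]

end CoverState

open CoverState

/-- The trees stored at time `τ` are consistent. -/
structure TreeInv {V : Type} (N : Network V) (τ : ℕ) (c : V → CoverState) : Prop where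
  id_eq : ∀ v, (c v).id = N.id v
  deg_eq : ∀ v, (c v).deg = N.deg v
  root : ∀ v, (c v).tree (N.id v) = some (0, none)
  eq_root : ∀ v x b, (c v).tree x = some (b, none) → x = N.id v
  parent : ∀ v x b p, (c v).tree x = some (b, some p) →
    ∃ (hp : p < N.deg v) (t b' : ℕ) (q : Option ℕ), b = t + 1 ∧ t < τ ∧ (c v).got t = some x ∧
      (c (N.port v ⟨p, hp⟩)).sent t = some x ∧
      (c (N.port v ⟨p, hp⟩)).tree x = some (b', q) ∧ b' ≤ t
  label_mem : ∀ v x, (c v).label = some x → (c v).tree x ≠ none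

namespace TreeInv

variable {V : Type} {N : Network V} {τ : ℕ} {c : V → CoverState}

theorem root_time (h : TreeInv N τ c) {v : V} {x b : ℕ} (hv : (c v).tree x = some (b, none)) :
    x = N.id v ∧ b = 0 := by
  obtain rfl := h.eq_root v x b hv
  simpa [h.root v, eq_comm] using hv

theorem time_le (h : TreeInv N τ c) {v : V} {x b : ℕ} {q : Option ℕ}
    (hv : (c v).tree x = some (b, q)) : b ≤ τ := by
  rcases q with _ | p
  · exact (h.root_time hv).2 ▸ Nat.zero_le τ
  · obtain ⟨_, t, _, _, rfl, ht, -⟩ := h.parent v x b p hv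
    exact ht

theorem exists_root (h : TreeInv N τ c) {v : V} {x : ℕ} (hv : (c v).tree x ≠ none) :
    ∃ r, N.id r = x := by
  obtain ⟨⟨b, q⟩, hb⟩ := Option.ne_none_iff_exists'.1 hv
  induction b using Nat.strong_induction_on generalizing v q with
  | _ b ih =>
    rcases q with _ | p
    · exact ⟨v, (h.eq_root v x b hb).symm⟩
    · obtain ⟨hp, t, b', q, rfl, -, -, -, htree, hle⟩ := h.parent v x b p hb
      exact ih b' (Nat.lt_succ_of_le hle) (by simp [htree]) q htree

theorem congr (h : TreeInv N τ c) {c' : V → CoverState} (hid : ∀ v, (c' v).id = (c v).id)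
    (hdeg : ∀ v, (c' v).deg = (c v).deg) (htree : ∀ v, (c' v).tree = (c v).tree)
    (hgot : ∀ v, (c' v).got = (c v).got) (hsent : ∀ v, (c' v).sent = (c v).sent)
    (hlabel : ∀ v x, (c' v).label = some x → (c v).tree x ≠ none) : TreeInv N τ c' where
  id_eq v := (hid v).trans (h.id_eq v)
  deg_eq v := (hdeg v).trans (h.deg_eq v)
  root v := by rw [htree, h.root]
  eq_root v x b := by rw [htree]; exact h.eq_root v x b
  parent v x b p := by simp only [htree, hgot, hsent]; exact h.parent v x b p
  label_mem v x hx := by rw [htree]; exact hlabel v x hx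

theorem afterHop (h : TreeInv N τ c) {a : V → Option (ℕ × ℕ)}
    (hwave : ∀ v x, (c v).wave = some x → (c v).tree x ≠ none)
    (ha : ∀ v p x, a v = some (p, x) →
      ∃ hp : p < N.deg v, (c (N.port v ⟨p, hp⟩)).wave = some x) :
    TreeInv N (τ + 1) fun v => (c v).afterHop τ (a v) where
  id_eq := h.id_eq
  deg_eq := h.deg_eq
  root v := by rw [afterHop_tree_of_ne_none (by simp [h.root]), h.root]
  eq_root v x b hb := by
    rcases afterHop_tree_eq_some hb with hold | ⟨p, -, -, hq⟩
    · exact h.eq_root v x b hold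
    · cases hq
  parent v x b p hb := by
    rcases afterHop_tree_eq_some hb with hold | ⟨p', hav, hbt, hp'⟩
    · obtain ⟨hp, t, b', q, hbt, ht, hgot, hsent, htree, hle⟩ := h.parent v x b p hold
      refine ⟨hp, t, b', q, hbt, by omega, ?_, ?_, ?_, hle⟩
      · simpa [CoverState.afterHop, Function.update_of_ne ht.ne] using hgot
      · simpa [CoverState.afterHop, Function.update_of_ne ht.ne] using hsent
      · rwa [afterHop_tree_of_ne_none (by simp [htree])]
    · obtain rfl : p = p' := Option.some_injective _ hp'
      obtain ⟨hp, hw⟩ := ha v p x hav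
      obtain ⟨⟨b', q⟩, hb'⟩ := Option.ne_none_iff_exists'.1 (hwave _ _ hw)
      refine ⟨hp, τ, b', q, hbt, τ.lt_succ_self, ?_, ?_, ?_, h.time_le hb'⟩
      · simp [CoverState.afterHop, hav]
      · simp [CoverState.afterHop, hw]
      · rwa [afterHop_tree_of_ne_none (by simp [hb'])]
  label_mem v x hx := afterHop_tree_ne_none (h.label_mem v x hx)

end TreeInv

/-- The invariant after `j` hops of a wave started at time `τ` in the configuration `c₀`. -/
structure WaveInv {V : Type} (N : Network V) (src : ℕ → Bool) (c₀ : V → CoverState) (τ j : ℕ)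
    (c : V → CoverState) : Prop where
  tree : TreeInv N (τ + j) c
  label_eq : ∀ v, (c v).label = (c₀ v).label
  uncovered_eq : ∀ v, (c v).uncovered = (c₀ v).uncovered
  mono : ∀ v x, (c₀ v).tree x ≠ none → (c v).tree x ≠ none
  new : ∀ v x, (c v).tree x ≠ none → (c₀ v).tree x ≠ none ∨ (c v).wave = some x
  wave_mem : ∀ v x, (c v).wave = some x → (c v).tree x ≠ none
  spec : WaveSpec N.graph (fun u x => (c₀ u).label = some x ∧ src x = true) j fun v => (c v).wave

namespace WaveInv

variable {V : Type} {N : Network V} {src : ℕ → Bool} {c₀ c : V → CoverState} {τ j : ℕ}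

theorem zero (h : TreeInv N τ c₀) :
    WaveInv N src c₀ τ 0 fun v => (c₀ v).startWave src where
  tree := h.congr (fun _ => rfl) (fun _ => rfl) (fun _ => rfl) (fun _ => rfl) (fun _ => rfl)
    h.label_mem
  label_eq _ := rfl
  uncovered_eq _ := rfl
  mono _ _ := id
  new _ _ := Or.inl
  wave_mem v x hx := h.label_mem v x (Option.filter_eq_some_iff.1 hx).1
  spec :=
    { sound v x hx := ⟨v, Option.filter_eq_some_iff.1 hx, .refl v⟩
      nearest i hi u v x hu huv := by
        obtain rfl := Nat.le_zero.1 hi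
        obtain rfl := huv.eq
        exact ⟨u, x, Option.filter_eq_some_iff.2 hu, hu, .refl u⟩ }

theorem runInstr_hop (t : ℕ) :
    N.runInstr (CoverState.hop t) c = fun v => (c v).afterHop t
      (adopt (c v).wave (N.inbox (fun u _ => labelMsg (c u).wave) v)) := by
  funext v
  simp only [Network.runInstr, CoverState.hop, Network.map_inbox]

theorem hop (h : WaveInv N src c₀ τ j c) :
    WaveInv N src c₀ τ (j + 1) (N.runInstr (hop (τ + j)) c) := by
  let a (v : V) : Option (ℕ × ℕ) :=
    adopt (c v).wave (N.inbox (fun u _ => labelMsg (c u).wave) v)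
  have wave_of_adopt v p x (hv : a v = some (p, x)) :
      (c v).wave = none ∧ ∃ hp : p < N.deg v, (c (N.port v ⟨p, hp⟩)).wave = some x :=
    adopt_eq_some (w := fun v => (c v).wave) hv
  rw [show N.runInstr _ c = fun v => (c v).afterHop (τ + j) (a v) from runInstr_hop _]
  exact
    { tree := h.tree.afterHop h.wave_mem fun v p x hv => (wave_of_adopt v p x hv).2
      label_eq := h.label_eq
      uncovered_eq := h.uncovered_eq
      mono v x hx := afterHop_tree_ne_none (h.mono v x hx)
      new v x hx := by
        obtain ⟨⟨b, q⟩, hb⟩ := Option.ne_none_iff_exists'.1 hx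
        rcases afterHop_tree_eq_some hb with hold | ⟨p, hv, -, -⟩
        · exact (h.new v x (by simp [hold])).imp_right fun hw => by simp [afterHop, hw]
        · right
          simp [afterHop, (wave_of_adopt v p x hv).1, hv]
      wave_mem v x hx := by
        rcases hw : (c v).wave with _ | y
        · obtain ⟨⟨p, z⟩, hv, rfl⟩ : ∃ q : ℕ × ℕ, a v = some q ∧ q.2 = x := by
            simpa [afterHop, hw] using hx
          rw [hv]
          exact afterHop_tree_adopted _ _ _ _
        · obtain rfl : y = x := by simpa [afterHop, hw] using hx
          exact afterHop_tree_ne_none (h.wave_mem v y hw)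
      spec := h.spec.hop waveHop_adopt }

end WaveInv

/-! ### The growing algorithm: counting over the trees -/

/-- A configuration with other counters and decisions. -/
def withAux {V : Type} (c : V → CoverState) (a : V → ℕ → ℕ × ℕ) (d : V → ℕ → Bool) (v : V) :
    CoverState :=
  { c v with acc := a v, dec := d v }

/-- The node is in the tree of `x` since time `t`. -/
def BornBy (s : CoverState) (x t : ℕ) : Prop := ∃ b q, s.tree x = some (b, q) ∧ b ≤ t

/-- `v` is the parent of `u` in the tree of `x`, to which `u` was added at time `t + 1`. -/
def ParentAt {V : Type} (N : Network V) (c : V → CoverState) (t x : ℕ) (u v : V) : Prop :=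
  ∃ (q : ℕ) (hq : q < N.deg u), (c u).tree x = some (t + 1, some q) ∧ (N.port u ⟨q, hq⟩ : V) = v

/-- The messages: pairs of numbers below `m`. -/
def pairMsgs (m : ℕ) : Finset (ℕ × ℕ) := Finset.range m ×ˢ Finset.range m

theorem mem_pairMsgs {m : ℕ} {p : ℕ × ℕ} : p ∈ pairMsgs m ↔ p.1 < m ∧ p.2 < m := by
  simp [pairMsgs]

theorem mem_pairMsgs_of_le {m : ℕ} {p q : ℕ × ℕ} (h : q ≤ p) (hp : p ∈ pairMsgs m) :
    q ∈ pairMsgs m := by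
  rw [mem_pairMsgs] at hp ⊢
  exact ⟨h.1.trans_lt hp.1, h.2.trans_lt hp.2⟩

theorem zero_mem_pairMsgs {m : ℕ} (hm : 0 < m) : (0 : ℕ × ℕ) ∈ (pairMsgs m : Set (ℕ × ℕ)) :=
  mem_pairMsgs.2 ⟨hm, hm⟩

section Count

variable {V : Type} {N : Network V} {τ : ℕ} {c : V → CoverState}

theorem bornBy_succ {s : CoverState} {x t : ℕ} :
    BornBy s x (t + 1) ↔ BornBy s x t ∨ ∃ q, s.tree x = some (t + 1, q) := by
  constructor
  · rintro ⟨b, q, hb, hle⟩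
    rcases Nat.le_succ_iff.1 hle with hle | rfl
    · exact .inl ⟨b, q, hb, hle⟩
    · exact .inr ⟨q, hb⟩
  · rintro (⟨b, q, hb, hle⟩ | ⟨q, hq⟩)
    · exact ⟨b, q, hb, hle.trans t.le_succ⟩
    · exact ⟨t + 1, q, hq, le_rfl⟩

theorem not_bornBy_of_tree_eq {s : CoverState} {x t : ℕ} {q : Option ℕ}
    (h : s.tree x = some (t + 1, q)) : ¬ BornBy s x t := by
  rintro ⟨b, q', hb, hle⟩
  obtain ⟨rfl, -⟩ : t + 1 = b ∧ q = q' := by simpa [h] using hb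
  omega

namespace TreeInv

theorem parentAt (h : TreeInv N τ c) {t x : ℕ} {u v : V} (hp : ParentAt N c t x u v) :
    (c u).got t = some x ∧ (c v).sent t = some x ∧ BornBy (c v) x t := by
  obtain ⟨q, hq, htree, rfl⟩ := hp
  obtain ⟨_, t', b', q', ht, -, hgot, hsent, htree', hle⟩ := h.parent u x _ q htree
  obtain rfl : t = t' := Nat.succ_injective ht
  exact ⟨hgot, hsent, b', q', htree', hle⟩

theorem existsUnique_parentAt (h : TreeInv N τ c) {t x : ℕ} {u : V} {q : Option ℕ}
    (hu : (c u).tree x = some (t + 1, q)) : ∃ v, ∀ v', ParentAt N c t x u v' ↔ v' = v := by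
  rcases q with _ | q
  · exact absurd (h.root_time hu).2 t.succ_ne_zero
  · obtain ⟨hq, -⟩ := h.parent u x _ q hu
    refine ⟨N.port u ⟨q, hq⟩, fun v' => ⟨?_, ?_⟩⟩
    · rintro ⟨q', hq', hu', rfl⟩
      obtain rfl : q = q' := by simpa [hu] using hu'
      rfl
    · rintro rfl
      exact ⟨q, hq, hu, rfl⟩

theorem bornBy_iff (h : TreeInv N τ c) (v : V) (x : ℕ) :
    BornBy (c v) x τ ↔ (c v).tree x ≠ none := by
  constructor
  · rintro ⟨b, q, hb, -⟩
    simp [hb]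
  · intro hv
    obtain ⟨⟨b, q⟩, hb⟩ := Option.ne_none_iff_exists'.1 hv
    exact ⟨b, q, hb, h.time_le hb⟩

theorem bornBy_zero_iff (h : TreeInv N τ c) (v : V) (x : ℕ) :
    BornBy (c v) x 0 ↔ x = N.id v := by
  constructor
  · rintro ⟨b, _ | p, hb, hle⟩
    · exact h.eq_root v x b hb
    · obtain ⟨-, t, -, -, ht, -⟩ := h.parent v x b p hb
      omega
  · rintro rfl
    exact ⟨0, none, h.root v, le_rfl⟩

open Classical in
theorem report_eq (h : TreeInv N τ c) {a : V → ℕ → ℕ × ℕ} {d : V → ℕ → Bool} {t x : ℕ}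
    {u v : V} (hs : (c v).sent t = some x) (hadj : N.graph.Adj u v) :
    (withAux c a d u).report t (N.portTo hadj) = if ParentAt N c t x u v then a u x else 0 := by
  split_ifs with hp
  · have hgot := (h.parentAt hp).1
    obtain ⟨q, hq, htree, hport⟩ := hp
    simp [report, withAux, hgot, (N.portTo_eq_iff hadj (q := ⟨q, hq⟩)).2 hport, htree]
  · rcases hgot : (c u).got t with _ | y
    · simp [report, withAux, hgot]
    · simp only [report, withAux, hgot]
      refine if_neg fun htree => hp ?_
      have hp' : ParentAt N c t y u v := ⟨_, (N.portTo hadj).2, htree, N.port_portTo hadj⟩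
      obtain rfl : x = y := by simpa [hs] using (h.parentAt hp').2.1
      exact hp'

open Classical in
theorem runInstr_collect [Fintype V] (h : TreeInv N τ c) (a : V → ℕ → ℕ × ℕ) (d : V → ℕ → Bool)
    (t : ℕ) :
    N.runInstr (collect t) (withAux c a d) = withAux c
      (fun v x => a v x + ∑ u, if ParentAt N c t x u v then a u x else 0) d := by
  funext v
  simp only [Network.runInstr, collect, withAux, CoverState.mk.injEq, true_and, and_true]
  funext x
  split_ifs with hs
  · rw [h.deg_eq, N.sum_inbox]
    refine congrArg _ (Finset.sum_congr rfl fun u _ => ?_)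
    split_ifs with hadj hp hp
    · exact (h.report_eq hs hadj).trans (if_pos hp)
    · exact (h.report_eq hs hadj).trans (if_neg hp)
    · obtain ⟨q, hq, -, rfl⟩ := hp
      exact absurd (N.adj_port u ⟨q, hq⟩) hadj
    · rfl
  · rw [Finset.sum_eq_zero fun u _ => if_neg fun hp => hs (h.parentAt hp).2.1, add_zero]

open Classical in
theorem sum_parentAt [Fintype V] (h : TreeInv N τ c) {β : Type*} [AddCommMonoid β] (t x : ℕ)
    (u : V) (y : β) :
    (∑ v, if ParentAt N c t x u v then y else 0) =
      if ∃ q, (c u).tree x = some (t + 1, q) then y else 0 := by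
  split_ifs with hu
  · obtain ⟨q, hq⟩ := hu
    obtain ⟨v, hv⟩ := h.existsUnique_parentAt hq
    simp [hv]
  · exact Finset.sum_eq_zero fun v _ => if_neg fun ⟨q, _, hq, _⟩ => hu ⟨some q, hq⟩

open Classical in
theorem sum_collect [Fintype V] (h : TreeInv N τ c) {β : Type*} [AddCommMonoid β] (a : V → β)
    (t x : ℕ) :
    (∑ v, if BornBy (c v) x t then a v + ∑ u, if ParentAt N c t x u v then a u else 0 else 0) =
      ∑ v, if BornBy (c v) x (t + 1) then a v else 0 := by
  calc _ = ∑ v, ((if BornBy (c v) x t then a v else 0) +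
        ∑ u, if ParentAt N c t x u v then a u else 0) := by
        refine Finset.sum_congr rfl fun v _ => ?_
        split_ifs with hb
        · rfl
        · rw [Finset.sum_eq_zero fun u _ => if_neg fun hp => hb (h.parentAt hp).2.2, add_zero]
    _ = ∑ u, ((if BornBy (c u) x t then a u else 0) +
        if ∃ q, (c u).tree x = some (t + 1, q) then a u else 0) := by
        rw [Finset.sum_add_distrib, Finset.sum_comm, ← Finset.sum_add_distrib]
        simp only [h.sum_parentAt]
    _ = _ := by
        refine Finset.sum_congr rfl fun u _ => ?_
        by_cases hu : ∃ q, (c u).tree x = some (t + 1, q)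
        · obtain ⟨q, hq⟩ := hu
          simp [bornBy_succ, not_bornBy_of_tree_eq hq, hq]
        · simp [bornBy_succ, hu]

end TreeInv

open Classical in
/-- The counters of the nodes added up to time `t` have the sum `total`. -/
def CountInv [Fintype V] (c : V → CoverState) (d : V → ℕ → Bool) (total : ℕ → ℕ × ℕ) (t : ℕ)
    (c' : V → CoverState) : Prop :=
  ∃ a, c' = withAux c a d ∧ ∀ x, (∑ v, if BornBy (c v) x t then a v x else 0) = total x

/-- The decisions of the nodes added up to time `t` are `truth`. -/
def DecisionInv (c : V → CoverState) (a : V → ℕ → ℕ × ℕ) (truth : ℕ → Bool) (t : ℕ)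
    (c' : V → CoverState) : Prop :=
  ∃ d, c' = withAux c a d ∧ ∀ v x, BornBy (c v) x t → d v x = truth x

theorem triple_collect [Fintype V] (h : TreeInv N τ c) {m : ℕ} {total : ℕ → ℕ × ℕ}
    (hm : ∀ x, total x ∈ pairMsgs m) (d : V → ℕ → Bool) (t : ℕ) :
    N.Triple (pairMsgs m : Set (ℕ × ℕ)) (CountInv c d total (t + 1)) [collect t]
      (CountInv c d total t) := by
  classical
  refine .single ?_ ?_
  · rintro _ ⟨a, rfl, ha⟩ v q
    have zero_mem : 0 ∈ pairMsgs m := mem_pairMsgs_of_le zero_le (hm 0)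
    simp only [collect, report, withAux]
    split
    case h_1 x _ =>
      split_ifs with hq
      · refine mem_pairMsgs_of_le ?_ (hm x)
        have hborn : BornBy (c v) x (t + 1) := ⟨_, _, hq, le_rfl⟩
        calc a v x = if BornBy (c v) x (t + 1) then a v x else 0 := (if_pos hborn).symm
          _ ≤ ∑ v, if BornBy (c v) x (t + 1) then a v x else 0 :=
            Finset.single_le_sum (f := fun v => if BornBy (c v) x (t + 1) then a v x else 0)
              (fun _ _ => zero_le) (Finset.mem_univ v)
          _ = total x := ha x
      · exact zero_mem
    case h_2 => exact zero_mem
  · rintro _ ⟨a, rfl, ha⟩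
    refine ⟨_, h.runInstr_collect a d t, fun x => ?_⟩
    rw [← ha x]
    exact h.sum_collect (fun v => a v x) t x

theorem triple_collect_all [Fintype V] (h : TreeInv N τ c) {m : ℕ} {total : ℕ → ℕ × ℕ}
    (hm : ∀ x, total x ∈ pairMsgs m) (d : V → ℕ → Bool) :
    N.Triple (pairMsgs m : Set (ℕ × ℕ)) (CountInv c d total τ)
      ((List.range τ).flatMap fun i => [collect (τ - 1 - i)]) (CountInv c d total 0) := by
  have step (i : ℕ) (hi : i < τ) :
      N.Triple (pairMsgs m : Set (ℕ × ℕ)) (CountInv c d total (τ - i)) [collect (τ - 1 - i)]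
        (CountInv c d total (τ - (i + 1))) := by
    rw [show τ - i = τ - 1 - i + 1 by omega, show τ - (i + 1) = τ - 1 - i by omega]
    exact triple_collect h hm d _
  simpa using Network.Triple.range (Inv := fun i => CountInv c d total (τ - i)) τ step

theorem triple_spread (h : TreeInv N τ c) {m : ℕ} (hm : 1 < m) {truth : ℕ → Bool}
    (a : V → ℕ → ℕ × ℕ) (t : ℕ) :
    N.Triple (pairMsgs m : Set (ℕ × ℕ)) (DecisionInv c a truth t) [spread t]
      (DecisionInv c a truth (t + 1)) := by
  refine .single ?_ ?_
  · rintro _ - v q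
    refine mem_pairMsgs.2 ⟨?_, by simp only [spread]; omega⟩
    simp only [spread]
    split_ifs <;> omega
  · rintro _ ⟨d, rfl, hd⟩
    refine ⟨fun v => (N.runInstr (spread t) (withAux c a d) v).dec, rfl, fun v x hb => ?_⟩
    rcases bornBy_succ.1 hb with hold | ⟨_ | p, hnew⟩
    · obtain ⟨b, q, htree, hle⟩ := id hold
      rcases q with _ | p
      · simpa only [Network.runInstr, spread, withAux, htree] using hd v x hold
      · simpa only [Network.runInstr, spread, withAux, htree, (Nat.lt_succ_of_le hle).ne,
          if_false] using hd v x hold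
    · exact absurd (h.root_time hnew).2 t.succ_ne_zero
    · obtain ⟨hp, t', b', q', ht, -, -, hsent, htree, hle⟩ := h.parent v x _ p hnew
      obtain rfl : t = t' := Nat.succ_injective ht
      simp only [Network.runInstr, spread, withAux, hnew, if_true, Network.inbox, dif_pos hp,
        hsent, Option.any_some, hd _ x ⟨b', q', htree, hle⟩]
      cases truth x <;> simp

end Count

/-- The numbers of proposals and of members. -/
noncomputable def tally {V : Type} [Fintype V] (src : ℕ → Bool) (c : V → CoverState) (x : ℕ) :
    ℕ × ℕ :=
  ((proposers src (fun v => (c v).label) (fun v => (c v).wave) x).card,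
    (members (fun v => (c v).label) x).card)

/-- Whether the label `x` accepts the proposals to it. -/
noncomputable def accepts {V : Type} [Fintype V] (D : ℕ) (src : ℕ → Bool) (c : V → CoverState)
    (x : ℕ) : Bool :=
  decide ((tally src c x).2 ≤ D * (tally src c x).1)

/-- The result of one step of cluster growing from the configuration `c₀` at time `τ`. -/
structure GrowPost {V : Type} [Fintype V] (N : Network V) (D h : ℕ) (src : ℕ → Bool) (τ : ℕ)
    (c₀ c : V → CoverState) : Prop where
  tree : TreeInv N (τ + h) c
  uncovered_eq : ∀ v, (c v).uncovered = (c₀ v).uncovered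
  mono : ∀ v x, (c₀ v).tree x ≠ none → (c v).tree x ≠ none
  card_le : ∀ v, {x | (c v).tree x ≠ none}.encard ≤ {x | (c₀ v).tree x ≠ none}.encard + 1
  step : ∃ w acc, GrowStep (Near N.graph h) D src (fun v => (c₀ v).label) (fun v => (c v).label)
    w acc
  cover : ∀ i ≤ h, ∀ u v x, (c₀ u).label = some x → src x = true → Near N.graph i u v →
    ∃ u' y, (c₀ u').label = some y ∧ Near N.graph i u' v ∧ (c v).tree y ≠ none

section Grow

variable {V : Type} {N : Network V} {m D h : ℕ} {src : ℕ → Bool} {τ : ℕ}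
  {c₀ c₁ : V → CoverState}

theorem triple_wave (hm : ∀ v, N.id v + 1 < m) (h0 : TreeInv N τ c₀) (hpos : 0 < m) :
    N.Triple (pairMsgs m : Set (ℕ × ℕ)) (· = c₀)
      ([Instr.localStep (startWave src)] ++ ((List.range h).flatMap fun j => [hop (τ + j)]))
      (WaveInv N src c₀ τ h) := by
  refine .append (Q := WaveInv N src c₀ τ 0) ?_ ?_
  · refine .localStep (zero_mem_pairMsgs hpos) ?_
    rintro _ rfl
    exact .zero h0
  · refine .range h fun j _ => .single (fun c hc v p => mem_pairMsgs.2 ⟨?_, hpos⟩)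
      fun c hc => hc.hop
    rcases hw : (c v).wave with _ | x
    · simpa [hop, hw, labelMsg] using hpos
    · obtain ⟨r, rfl⟩ := hc.tree.exists_root (hc.wave_mem v x hw)
      simpa [hop, hw, labelMsg] using hm r

theorem WaveInv.countInv [Fintype V] (hc : WaveInv N src c₀ τ h c₁) :
    CountInv c₁ (fun v => (c₁ v).dec) (tally src c₁) (τ + h)
      (fun v => (c₁ v).startCount src) := by
  classical
  refine ⟨fun v => ((c₁ v).startCount src).acc, rfl, fun x => ?_⟩
  have hborn v : (if BornBy (c₁ v) x (τ + h) then ((c₁ v).startCount src).acc x else 0) =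
      ((c₁ v).startCount src).acc x := by
    rw [ite_eq_left_iff, hc.tree.bornBy_iff, not_not]
    intro hb
    have hwave : (c₁ v).wave ≠ some x := fun e => hc.wave_mem v x e hb
    have hlabel : (c₁ v).label ≠ some x := fun e => hc.tree.label_mem v x e hb
    simp [startCount, hwave, hlabel, Prod.ext_iff]
  rw [Finset.sum_congr rfl fun v _ => hborn v]
  simp only [startCount, tally, proposers, members, Finset.card_filter]
  ext
  · rw [Prod.fst_sum]
    simp [Option.any_eq_true]
  · rw [Prod.snd_sum]

theorem triple_decide [Fintype V] (hm : Fintype.card V < m) (hc : WaveInv N src c₀ τ h c₁) :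
    N.Triple (pairMsgs m : Set (ℕ × ℕ)) (· = c₁)
      ([Instr.localStep (startCount src)] ++
        ((List.range (τ + h)).flatMap fun i => [collect (τ + h - 1 - i)]) ++
        [Instr.localStep (judge D)])
      (fun c => ∃ a, DecisionInv c₁ a (accepts D src c₁) 0 c) := by
  have zero_mem := zero_mem_pairMsgs (m := m) (by omega)
  have htally x : tally src c₁ x ∈ pairMsgs m :=
    mem_pairMsgs.2 ⟨(Finset.card_le_univ _).trans_lt hm, (Finset.card_le_univ _).trans_lt hm⟩
  refine ((Network.Triple.localStep zero_mem ?_).append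
    (triple_collect_all hc.tree htally fun v => (c₁ v).dec)).append (.localStep zero_mem ?_)
  · rintro _ rfl
    exact hc.countInv
  · rintro _ ⟨a, rfl, ha⟩
    refine ⟨a, fun v x => decide ((a v x).2 ≤ D * (a v x).1), rfl, fun v x hb => ?_⟩
    obtain rfl := (hc.tree.bornBy_zero_iff v x).1 hb
    have hroot : a v (N.id v) = tally src c₁ (N.id v) := by
      classical
      simpa [hc.tree.bornBy_zero_iff, N.id_injective.eq_iff] using ha (N.id v)
    simp only [hroot, accepts]

theorem WaveInv.growStep [Fintype V] (hc : WaveInv N src c₀ τ h c₁) {a : V → ℕ → ℕ × ℕ}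
    {d : V → ℕ → Bool} (hd : ∀ v x, (c₁ v).tree x ≠ none → d v x = accepts D src c₁ x) :
    GrowStep (Near N.graph h) D src (fun v => (c₀ v).label)
      (fun v => ((withAux c₁ a d v).update src).label) (fun v => (c₁ v).wave)
      (accepts D src c₁) where
  sound v y hw := by
    obtain ⟨u, ⟨hu, hy⟩, huv⟩ := hc.spec.sound v y hw
    exact ⟨u, hu, hy, huv⟩
  complete u v x hu hx huv := by
    obtain ⟨-, y, hy, -⟩ := hc.spec.nearest h le_rfl u v x ⟨hu, hx⟩ huv
    simp [hy]
  acc_iff v y _ := by simp only [accepts, tally, hc.label_eq, decide_eq_true_eq]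
  relabel_eq v := by
    simp only [update, withAux, ← hc.label_eq]
    rcases hw : (c₁ v).wave with _ | y
    · simp only [relabel]
    · simp only [relabel, hd v y (hc.wave_mem v y hw)]

theorem WaveInv.encard_tree_le (hc : WaveInv N src c₀ τ h c₁) (v : V) :
    {x | (c₁ v).tree x ≠ none}.encard ≤ {x | (c₀ v).tree x ≠ none}.encard + 1 := by
  have hone : {x | (c₁ v).wave = some x}.encard ≤ 1 :=
    Set.encard_le_one_iff.2 fun x y hx hy => Option.some_injective _ (hx.symm.trans hy)
  calc _ ≤ ({x | (c₀ v).tree x ≠ none} ∪ {x | (c₁ v).wave = some x}).encard :=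
        Set.encard_le_encard fun x hx => hc.new v x hx
    _ ≤ _ := Set.encard_union_le _ _
    _ ≤ _ := by gcongr

theorem triple_update [Fintype V] (hm : 1 < m) (hc : WaveInv N src c₀ τ h c₁)
    (a : V → ℕ → ℕ × ℕ) :
    N.Triple (pairMsgs m : Set (ℕ × ℕ)) (DecisionInv c₁ a (accepts D src c₁) 0)
      (((List.range (τ + h)).flatMap fun t => [spread t]) ++ [Instr.localStep (update src)])
      (GrowPost N D h src τ c₀) := by
  refine (Network.Triple.range _ fun t _ => triple_spread hc.tree hm a t).append
    (.localStep (zero_mem_pairMsgs (by omega)) ?_)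
  rintro _ ⟨d, rfl, hd⟩
  have hstep := hc.growStep (a := a) fun v x hx => hd v x ((hc.tree.bornBy_iff v x).2 hx)
  exact
    { tree := by
        refine hc.tree.congr (fun _ => rfl) (fun _ => rfl) (fun _ => rfl) (fun _ => rfl)
          (fun _ => rfl) fun v x hx => ?_
        rcases hstep.kept_or_joined hx with ⟨hold, -⟩ | ⟨-, hprop⟩
        · exact hc.tree.label_mem v x (by rwa [hc.label_eq])
        · exact hc.wave_mem v x (mem_proposers.1 hprop).1
      uncovered_eq := hc.uncovered_eq
      mono := hc.mono
      card_le := hc.encard_tree_le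
      step := ⟨_, _, hstep⟩
      cover i hi u v x hu hx huv := by
        obtain ⟨u', y, hy, ⟨hu', -⟩, huv'⟩ := hc.spec.nearest i hi u v x ⟨hu, hx⟩ huv
        exact ⟨u', y, hu', huv', hc.wave_mem v y hy⟩ }

theorem triple_grow [Fintype V] (hid : ∀ v, N.id v + 1 < m) (hcard : Fintype.card V < m)
    (hm : 1 < m) (h0 : TreeInv N τ c₀) :
    N.Triple (pairMsgs m : Set (ℕ × ℕ)) (· = c₀) (grow D h src τ) (GrowPost N D h src τ c₀) := by
  have hsplit : grow D h src τ =
      ([Instr.localStep (startWave src)] ++ ((List.range h).flatMap fun j => [hop (τ + j)])) ++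
      (([Instr.localStep (startCount src)] ++
        ((List.range (τ + h)).flatMap fun i => [collect (τ + h - 1 - i)]) ++
        [Instr.localStep (judge D)]) ++
      (((List.range (τ + h)).flatMap fun t => [spread t]) ++
        [Instr.localStep (update src)])) := by
    simp only [grow, List.append_assoc]
  rw [hsplit]
  refine (triple_wave hid h0 (by omega)).append (.of_forall fun c₁ hc => ?_)
  refine (triple_decide hcard hc).append (.of_forall ?_)
  rintro c ⟨a, hdec⟩
  exact (triple_update hm hc a).mono (by rintro _ rfl; exact hdec) fun _ => id

end Grow

/-! ### The cover algorithm -/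

namespace CoverState

/-- Every node that is not covered yet becomes a cluster. -/
def startClass (s : CoverState) : CoverState :=
  { s with label := if s.uncovered then some s.id else none }

/-- The nodes that kept a label are covered. -/
def endClass (s : CoverState) : CoverState :=
  { s with uncovered := s.uncovered && s.label.isNone }

/-- The `R` growing steps for every one of the `B` bits of the labels. -/
noncomputable def growBits (B R h τ : ℕ) : List (Instr CoverState (ℕ × ℕ)) :=
  (List.range B).flatMap fun i => (List.range R).flatMap fun t =>
    grow (2 * B) h (·.testBit i) (τ + (i * R + t) * h)

/-- Build well separated clusters among the nodes that are not covered yet, and cover them. The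
final wave, which starts from all clusters, extends the trees by `h` hops and changes no label. -/
noncomputable def coverClass (B R h τ : ℕ) : List (Instr CoverState (ℕ × ℕ)) :=
  [Instr.localStep startClass] ++ growBits B R h τ ++
    grow (2 * B) h (fun _ => true) (τ + B * R * h) ++ [Instr.localStep endClass]

/-- Build `L` classes of clusters. -/
noncomputable def coverProgram (L B R h : ℕ) : List (Instr CoverState (ℕ × ℕ)) :=
  (List.range L).flatMap fun j => coverClass B R h (j * (B * R + 1) * h)

/-- The initial state: the node is the root of the tree of its identifier. -/
def initial (id deg : ℕ) : CoverState where
  id := id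
  deg := deg
  uncovered := true
  label := none
  wave := none
  tree x := if x = id then some (0, none) else none
  got _ := none
  sent _ := none
  acc _ := 0
  dec _ := false

/-- The pointers stored in a state. -/
def pointers (s : CoverState) : TreePointers := fun x => (s.tree x).map Prod.snd

theorem length_grow_le {T τ : ℕ} (hτ : τ ≤ T) (D h : ℕ) (src : ℕ → Bool) :
    (grow D h src τ).length ≤ 3 * h + 2 * T + 4 := by
  rw [length_grow]
  omega

theorem length_coverClass_le {B R h τ T : ℕ} (hT : τ + B * R * h ≤ T) :
    (coverClass B R h τ).length ≤ (B * R + 1) * (3 * h + 2 * T + 4) + 2 := by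
  have hbits : (growBits B R h τ).length ≤ B * (R * (3 * h + 2 * T + 4)) := by
    refine length_flatMap_range_le fun i hi => length_flatMap_range_le fun t ht =>
      length_grow_le (le_trans ?_ hT) _ _ _
    gcongr
    calc i * R + t ≤ (i + 1) * R := by linarith
      _ ≤ B * R := Nat.mul_le_mul_right _ hi
  have hlast := length_grow_le hT (2 * B) h fun _ => true
  simp only [coverClass, List.length_append, List.length_singleton]
  linarith

theorem length_coverProgram_le (L B R : ℕ) {k : ℕ} (hk : 1 ≤ k) :
    (coverProgram L B R (2 * k)).length ≤ k * (16 * (L * (B * R + 1)) ^ 2) := by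
  set Q := L * (B * R + 1) with hQ
  have hclass : ∀ j < L, (coverClass B R (2 * k) (j * (B * R + 1) * (2 * k))).length ≤
      (B * R + 1) * (3 * (2 * k) + 2 * (Q * (2 * k)) + 4) + 2 := by
    intro j hj
    refine length_coverClass_le ?_
    calc j * (B * R + 1) * (2 * k) + B * R * (2 * k)
        ≤ (j + 1) * (B * R + 1) * (2 * k) := by linarith
      _ ≤ Q * (2 * k) := Nat.mul_le_mul_right _ (Nat.mul_le_mul_right _ hj)
  have hLQ : L ≤ Q := Nat.le_mul_of_pos_right _ (by omega)
  calc (coverProgram L B R (2 * k)).length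
      ≤ L * ((B * R + 1) * (3 * (2 * k) + 2 * (Q * (2 * k)) + 4) + 2) :=
        length_flatMap_range_le hclass
    _ = Q * (6 * k + 4 * (Q * k) + 4) + 2 * L := by rw [hQ]; ring
    _ ≤ Q * (6 * k + 4 * (Q * k) + 4 * k) + 2 * (Q * k) := by nlinarith
    _ = k * (12 * Q + 4 * Q ^ 2) := by ring
    _ ≤ k * (12 * Q ^ 2 + 4 * Q ^ 2) := by gcongr; exact Nat.le_self_pow two_ne_zero Q
    _ = k * (16 * Q ^ 2) := by ring

end CoverState

/-- `c` is a later configuration than `c₀`, in the same class, at time `τ` and after `q` waves. -/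
structure Later {V : Type} (N : Network V) (c₀ : V → CoverState) (τ q : ℕ) (c : V → CoverState) :
    Prop where
  tree : TreeInv N τ c
  uncovered_eq : ∀ v, (c v).uncovered = (c₀ v).uncovered
  mono : ∀ v x, (c₀ v).tree x ≠ none → (c v).tree x ≠ none
  card_le : ∀ v, {x | (c v).tree x ≠ none}.encard ≤ {x | (c₀ v).tree x ≠ none}.encard + q

namespace TreeInv

variable {V : Type} {N : Network V} {τ : ℕ} {c : V → CoverState}

theorem pointersTo (h : TreeInv N τ c) :
    N.PointersTo (fun v => (c v).pointers) (Set.range N.id) (fun l => l.2.choose)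
      (fun l v => (((c v).tree l).map Prod.fst).getD 0) where
  root_eq l := by
    have pointers_id (r : V) : (c r).pointers (N.id r) = some none := by simp [pointers, h.root]
    simpa only [l.2.choose_spec] using pointers_id l.2.choose
  label_mem v l hv := h.exists_root (v := v) (x := l) fun hnone => hv (by simp [pointers, hnone])
  eq_root v l hv := by
    simp only [pointers, Option.map_eq_some_iff] at hv
    obtain ⟨⟨b, q⟩, hb, rfl⟩ := hv
    exact N.id_injective ((h.eq_root v l b hb).symm.trans l.2.choose_spec.symm)
  parent v l p hv := by
    simp only [pointers, Option.map_eq_some_iff] at hv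
    obtain ⟨⟨b, q⟩, hb, rfl⟩ := hv
    obtain ⟨hp, t, b', q, hbt, -, -, -, hb', hle⟩ := h.parent v l b p hb
    refine ⟨hp, by simp [pointers, hb'], ?_⟩
    simp only [hb', hb, Option.map_some, Option.getD_some]
    omega

theorem initial (N : Network V) :
    TreeInv N 0 fun v => CoverState.initial (N.id v) (N.deg v) where
  id_eq _ := rfl
  deg_eq _ := rfl
  root v := by simp [CoverState.initial]
  eq_root v x b hb := by
    simp only [CoverState.initial] at hb
    split_ifs at hb with hx
    exact hx
  parent v x b p hb := by
    simp only [CoverState.initial] at hb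
    split_ifs at hb
    simp at hb
  label_mem v x hx := by simp [CoverState.initial] at hx

theorem startClass (h : TreeInv N τ c) : TreeInv N τ fun v => (c v).startClass := by
  refine h.congr (fun _ => rfl) (fun _ => rfl) (fun _ => rfl) (fun _ => rfl) (fun _ => rfl)
    fun v x hx => ?_
  simp only [CoverState.startClass] at hx
  split_ifs at hx
  simp [← Option.some.inj hx, h.id_eq, h.root]

theorem lt_of_label_eq (h : TreeInv N τ c) {n : ℕ} (hid : ∀ v, N.id v < n) {v : V} {x : ℕ}
    (hx : (c v).label = some x) : x < n := by
  obtain ⟨r, rfl⟩ := h.exists_root (h.label_mem v x hx)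
  exact hid r

end TreeInv

section Class

variable {V : Type} [Fintype V] {N : Network V} {m B R h τ : ℕ} {c₀ c₁ c : V → CoverState}

theorem Later.grow {D q : ℕ} {src : ℕ → Bool} (hc : Later N c₀ τ q c₁)
    (hg : GrowPost N D h src τ c₁ c) : Later N c₀ (τ + h) (q + 1) c where
  tree := hg.tree
  uncovered_eq v := (hg.uncovered_eq v).trans (hc.uncovered_eq v)
  mono v x hx := hg.mono v x (hc.mono v x hx)
  card_le v := by
    calc _ ≤ _ := hg.card_le v
      _ ≤ {x | (c₀ v).tree x ≠ none}.encard + q + 1 := by gcongr; exact hc.card_le v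
      _ = _ := by push_cast; ring

theorem triple_phase (hid : ∀ v, N.id v + 1 < m) (hcard : Fintype.card V < m) (hm : 1 < m)
    {D i q : ℕ} (hc : Later N c₀ τ q c₁) (ha : AgreeBits (Near N.graph h) i fun v => (c₁ v).label) :
    N.Triple (pairMsgs m : Set (ℕ × ℕ)) (· = c₁)
      ((List.range R).flatMap fun t => CoverState.grow D h (·.testBit i) (τ + t * h))
      (fun c => Later N c₀ (τ + R * h) (q + R) c ∧
        GrowInv (Near N.graph h) D i (fun v => (c₁ v).label) R fun v => (c v).label) := by
  refine Network.Triple.mono (Network.Triple.range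
    (Inv := fun t c => Later N c₀ (τ + t * h) (q + t) c ∧
        GrowInv (Near N.graph h) D i (fun v => (c₁ v).label) t fun v => (c v).label) R
    fun t _ => .of_forall fun c ⟨hlater, hinv⟩ => ?_) ?_ fun _ => id
  · refine (triple_grow hid hcard hm hlater.tree).mono (fun _ => id) fun c' hg => ?_
    obtain ⟨w, acc, hstep⟩ := hg.step
    have hlater' := hlater.grow hg
    rw [add_assoc, ← Nat.succ_mul] at hlater'
    exact ⟨hlater', hinv.succ hstep⟩
  · rintro _ rfl
    exact ⟨by simpa using hc, .zero ha⟩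

theorem triple_growBits (hid : ∀ v, N.id v + 1 < m) (hcard : Fintype.card V < m) (hm : 1 < m)
    (hR : (2 * B) ^ R * Fintype.card V < (2 * B + 1) ^ R) (h0 : TreeInv N τ c₀) :
    N.Triple (pairMsgs m : Set (ℕ × ℕ)) (· = c₀) (growBits B R h τ)
      (fun c => Later N c₀ (τ + B * R * h) (B * R) c ∧
        PhaseInv (Near N.graph h) (2 * B) (fun v => (c₀ v).label) B fun v => (c v).label) := by
  refine Network.Triple.mono (Network.Triple.range
    (Inv := fun i c => Later N c₀ (τ + i * R * h) (i * R) c ∧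
        PhaseInv (Near N.graph h) (2 * B) (fun v => (c₀ v).label) i fun v => (c v).label) B
    fun i _ => .of_forall fun c ⟨hlater, hinv⟩ => ?_) ?_ fun _ => id
  · have hphase := triple_phase (R := R) (D := 2 * B) hid hcard hm hlater hinv.agree
    simp only [show ∀ t, τ + (i * R + t) * h = τ + i * R * h + t * h from fun t => by ring]
    refine hphase.mono (fun _ => id) fun c' ⟨hlater', hgrow⟩ =>
      ⟨?_, hinv.succ (fun _ _ => Near.symm) hgrow hR⟩
    rwa [show τ + i * R * h + R * h = τ + (i + 1) * R * h by ring,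
      show i * R + R = (i + 1) * R by ring] at hlater'
  · rintro _ rfl
    exact ⟨⟨by simpa using h0, fun _ => rfl, fun _ _ => id, fun v => by simp⟩, .zero _⟩

/-- The nodes that are not covered yet. -/
def uncoveredNodes (c : V → CoverState) : Finset V := {v | (c v).uncovered = true}

theorem labelled_startClass (c : V → CoverState) :
    labelled (fun v => (c v).startClass.label) = uncoveredNodes c := by
  ext v
  simp [mem_labelled, uncoveredNodes, startClass]

theorem uncoveredNodes_endClass [DecidableEq V]
    (hu : ∀ v, (c v).uncovered = (c₀ v).uncovered) :
    uncoveredNodes (fun v => (c v).endClass) =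
      uncoveredNodes c₀ \ labelled fun v => (c v).label := by
  ext v
  simp [mem_labelled, uncoveredNodes, endClass, hu v]

/-- The invariant of the cover algorithm after `j` classes with `q` waves of `h` hops each. -/
structure CoverInv (N : Network V) (k q h j : ℕ) (c : V → CoverState) : Prop where
  tree : TreeInv N (j * q * h) c
  card_le : ∀ v, {x | (c v).tree x ≠ none}.encard ≤ ((1 + j * q : ℕ) : ℕ∞)
  uncovered_le : 2 ^ j * (uncoveredNodes c).card ≤ Fintype.card V
  covered : ∀ v, (c v).uncovered = false →
    ∃ y, ∀ u, Near N.graph k v u → (c u).tree y ≠ none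

namespace CoverInv

variable {k j : ℕ}

theorem zero (N : Network V) (k q h : ℕ) :
    CoverInv N k q h 0 fun v => CoverState.initial (N.id v) (N.deg v) where
  tree := by simpa using TreeInv.initial N
  card_le v := by
    calc _ ≤ ({N.id v} : Set ℕ).encard := Set.encard_le_encard fun x hx => by
          by_contra hne
          exact hx (if_neg hne)
      _ ≤ _ := by simp
  uncovered_le := by simpa using Finset.card_le_univ _
  covered v hv := by simp [CoverState.initial] at hv

theorem uncovered_le_succ {q : ℕ} {near : V → V → Prop} (h₀ : CoverInv N k q h j c₀)
    (hB : 0 < B) (hu : ∀ v, (c v).uncovered = (c₀ v).uncovered)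
    (hp : PhaseInv near (2 * B) (fun v => (c₀ v).startClass.label) B fun v => (c v).label) :
    2 ^ (j + 1) * (uncoveredNodes fun v => (c v).endClass).card ≤ Fintype.card V := by
  classical
  have hsub := hp.subset
  have hhalf := hp.half_le hB
  rw [labelled_startClass] at hsub hhalf
  have hcard := Finset.card_sdiff_add_card_eq_card hsub
  rw [← uncoveredNodes_endClass hu] at hcard
  calc 2 ^ (j + 1) * (uncoveredNodes fun v => (c v).endClass).card
      = 2 ^ j * (2 * (uncoveredNodes fun v => (c v).endClass).card) := by ring
    _ ≤ 2 ^ j * (uncoveredNodes c₀).card := Nat.mul_le_mul_left _ (by omega)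
    _ ≤ Fintype.card V := h₀.uncovered_le

theorem succ (h₀ : CoverInv N k (B * R + 1) (2 * k) j c₀) (hB : 0 < B) (hid : ∀ v, N.id v < 2 ^ B)
    (hl : Later N (fun v => (c₀ v).startClass)
      (j * (B * R + 1) * (2 * k) + B * R * (2 * k)) (B * R) c₁)
    (hp : PhaseInv (Near N.graph (2 * k)) (2 * B) (fun v => (c₀ v).startClass.label) B
      fun v => (c₁ v).label)
    (hg : GrowPost N (2 * B) (2 * k) (fun _ => true)
      (j * (B * R + 1) * (2 * k) + B * R * (2 * k)) c₁ c) :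
    CoverInv N k (B * R + 1) (2 * k) (j + 1) fun v => (c v).endClass := by
  obtain ⟨w, acc, hstep⟩ := hg.step
  have heq : ∀ v, (c v).label = (c₁ v).label := congrFun (hstep.eq_of_forall_src fun _ => rfl)
  have hlater := hl.grow hg
  refine ⟨?_, fun v => ?_, h₀.uncovered_le_succ (near := Near N.graph (2 * k)) hB
    hlater.uncovered_eq ?_, fun v hv => ?_⟩
  · have ht := hlater.tree
    rw [show j * (B * R + 1) * (2 * k) + B * R * (2 * k) + 2 * k =
      (j + 1) * (B * R + 1) * (2 * k) by ring] at ht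
    exact ht.congr (fun _ => rfl) (fun _ => rfl) (fun _ => rfl) (fun _ => rfl) (fun _ => rfl)
      ht.label_mem
  · calc _ ≤ _ := hlater.card_le v
      _ ≤ ((1 + j * (B * R + 1) : ℕ) : ℕ∞) + (B * R + 1 : ℕ) := by gcongr; exact h₀.card_le v
      _ = _ := by push_cast; ring
  · simpa only [heq] using hp
  · simp only [endClass, Bool.and_eq_false_iff, Option.isNone_eq_false_iff,
      Option.isSome_iff_exists] at hv
    rcases hv with hold | ⟨x, hx⟩
    · obtain ⟨y, hy⟩ := h₀.covered v ((hlater.uncovered_eq v).symm.trans hold)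
      exact ⟨y, fun u hu => hlater.mono u y (hy u hu)⟩
    · rw [heq] at hx
      refine ⟨x, fun u hvu => ?_⟩
      obtain ⟨u', y, hu', hnear, ht⟩ := hg.cover k (by omega) v u x hx rfl hvu
      have hvu' : Near N.graph (2 * k) v u' := (hvu.trans hnear.symm).mono (by omega)
      obtain rfl : x = y := hp.eq_of_near
        (fun _ _ hx => h₀.tree.startClass.lt_of_label_eq hid hx) hx hu' hvu'
      exact ht

end CoverInv

theorem triple_coverClass {k j : ℕ} (hidm : ∀ v, N.id v + 1 < m) (hcard : Fintype.card V < m)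
    (hm : 1 < m) (hR : (2 * B) ^ R * Fintype.card V < (2 * B + 1) ^ R) (hB : 0 < B)
    (hid : ∀ v, N.id v < 2 ^ B) :
    N.Triple (pairMsgs m : Set (ℕ × ℕ)) (CoverInv N k (B * R + 1) (2 * k) j)
      (coverClass B R (2 * k) (j * (B * R + 1) * (2 * k)))
      (CoverInv N k (B * R + 1) (2 * k) (j + 1)) := by
  refine .of_forall fun c₀ h₀ => ?_
  have hzero := zero_mem_pairMsgs (m := m) (by omega)
  rw [coverClass, List.append_assoc, List.append_assoc]
  refine .append (Q := (· = fun v => (c₀ v).startClass)) (.localStep hzero ?_)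
    ((triple_growBits hidm hcard hm hR h₀.tree.startClass).append
      (.of_forall fun c₁ ⟨hlater, hphase⟩ => (triple_grow hidm hcard hm hlater.tree).append
        (.localStep hzero fun c hg => h₀.succ hB hid hlater hphase hg)))
  rintro _ rfl
  rfl

theorem triple_coverProgram {k : ℕ} (L : ℕ) (hidm : ∀ v, N.id v + 1 < m)
    (hcard : Fintype.card V < m) (hm : 1 < m)
    (hR : (2 * B) ^ R * Fintype.card V < (2 * B + 1) ^ R) (hB : 0 < B)
    (hid : ∀ v, N.id v < 2 ^ B) :
    N.Triple (pairMsgs m : Set (ℕ × ℕ)) (CoverInv N k (B * R + 1) (2 * k) 0)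
      (coverProgram L B R (2 * k)) (CoverInv N k (B * R + 1) (2 * k) L) :=
  .range L fun _ _ => triple_coverClass hidm hcard hm hR hB hid

theorem CoverInv.exists_cover {k q L : ℕ} (hc : CoverInv N k q h L c)
    (hcov : ∀ v, ∃ y, ∀ u, Near N.graph k v u → (c u).tree y ≠ none) :
    ∃ F : TreeFamily N.graph, Represents N (fun v => (c v).pointers) F ∧
      IsNeighborhoodCover N.graph (1 + L * q) k (2 * (L * q * h)) F := by
  have hp := hc.tree.pointersTo
  have pointers_ne_none (v : V) (l : ℕ) : (c v).pointers l ≠ none ↔ (c v).tree l ≠ none := by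
    simp [pointers]
  refine ⟨hp.family, hp.represents, fun l => ?_, fun v => ?_, fun v => ?_⟩
  · refine (hp.isParentMap l).diameter_le fun v hv => ?_
    obtain ⟨⟨b, p⟩, hb⟩ := Option.ne_none_iff_exists'.1 ((pointers_ne_none v l).1 hv)
    simpa [hb] using hc.tree.time_le hb
  · obtain ⟨y, hy⟩ := hcov v
    exact ⟨⟨y, hc.tree.exists_root (hy v (.refl v))⟩,
      fun u hu => (pointers_ne_none u y).2 (hy u hu)⟩
  · have hinj : Function.Injective (Subtype.val : hp.family.labels → ℕ) := Subtype.val_injective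
    rw [← hinj.encard_image]
    refine (Set.encard_le_encard ?_).trans (hc.card_le v)
    rintro _ ⟨l, hl, rfl⟩
    exact (pointers_ne_none v l).1 hl

end Class

/-! ### Covers from scratch -/

theorem IsNeighborhoodCover.mono {V : Type} {G : SimpleGraph V} {s s' k D D' : ℕ}
    {F : TreeFamily G} (h : IsNeighborhoodCover G s k D F) (hs : s ≤ s') (hD : D ≤ D') :
    IsNeighborhoodCover G s' k D' F where
  diameter_le l := (h.diameter_le l).trans (by exact_mod_cast hD)
  covers := h.covers
  sparse v := (h.sparse v).trans (by exact_mod_cast hs)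

theorem CoverInv.exists_near_subset {V : Type} [Fintype V] {N : Network V} {k q h L : ℕ}
    {c : V → CoverState} (hc : CoverInv N k q h L c)
    (hL : Fintype.card V ≤ 1 ∨ Fintype.card V < 2 ^ L) (v : V) :
    ∃ y, ∀ u, Near N.graph k v u → (c u).tree y ≠ none := by
  rcases hL with hone | hlt
  · have : Subsingleton V := Fintype.card_le_one_iff_subsingleton.1 hone
    refine ⟨N.id v, fun u _ => ?_⟩
    simp [Subsingleton.elim u v, hc.tree.root]
  · have hempty : uncoveredNodes c = ∅ := by
      rw [← Finset.card_eq_zero, ← Nat.lt_one_iff]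
      exact Nat.lt_of_mul_lt_mul_left (a := 2 ^ L)
        (by rw [mul_one]; exact hc.uncovered_le.trans_lt hlt)
    refine hc.covered v (Bool.eq_false_iff.2 fun hv => ?_)
    simpa [hempty] using show v ∈ uncoveredNodes c by simpa [uncoveredNodes] using hv

theorem lt_two_pow_logBits (n : ℕ) : n < 2 ^ logBits n :=
  Nat.lt_pow_succ_log_self one_lt_two n

theorem one_le_logBits (n : ℕ) : 1 ≤ logBits n := Nat.le_add_left 1 _

/-- The number of bits of the labels, which are identifiers of at most `a log n` bits. -/
def coverBits (a n : ℕ) : ℕ := a * logBits n + 1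

/-- The number of growing steps per bit, so large that a cluster that grows by the factor
`1 + 1 / (2 * coverBits a n)` in every step would outgrow the network. -/
def coverSteps (a n : ℕ) : ℕ := 2 * coverBits a n * logBits n

/-- The number of waves in `2 * Nat.log 2 n` classes. -/
def coverWaves (a n : ℕ) : ℕ := 2 * Nat.log 2 n * (coverBits a n * coverSteps a n + 1)

/-- The sparsity of the cover, and its diameter and the number of rounds in units of `k`. -/
def coverFactor (a n : ℕ) : ℕ := 1 + 16 * coverWaves a n ^ 2

/-- A strict upper bound on the numbers in the messages. -/
def coverMsgBound (a n : ℕ) : ℕ := 2 ^ coverBits a n + n + 2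

theorem coverSteps_spec (a : ℕ) {n s : ℕ} (hs : s ≤ n) :
    (2 * coverBits a n) ^ coverSteps a n * s < (2 * coverBits a n + 1) ^ coverSteps a n := by
  have hpos : 0 < 2 * coverBits a n := by simp [coverBits]
  refine lt_of_lt_of_le ?_ (pow_mul_two_pow_le hpos (logBits n))
  exact Nat.mul_lt_mul_of_pos_left (hs.trans_lt (lt_two_pow_logBits n)) (pow_pos hpos _)

theorem coverWaves_le (a n : ℕ) : coverWaves a n ≤ 10 * (2 * a + 1) ^ 2 * Nat.log 2 n ^ 4 := by
  rcases Nat.eq_zero_or_pos (Nat.log 2 n) with hzero | hpos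
  · simp [coverWaves, hzero]
  have hbits : coverBits a n ≤ (2 * a + 1) * Nat.log 2 n := by
    simp only [coverBits, logBits]
    nlinarith
  have hlog : logBits n ≤ 2 * Nat.log 2 n := by simp only [logBits]; omega
  have hone : 1 ≤ (2 * a + 1) ^ 2 * Nat.log 2 n ^ 3 := Nat.one_le_iff_ne_zero.2 (by positivity)
  calc coverWaves a n
      = 2 * Nat.log 2 n * (2 * coverBits a n ^ 2 * logBits n + 1) := by
        simp only [coverWaves, coverSteps]; ring
    _ ≤ 2 * Nat.log 2 n * (2 * ((2 * a + 1) * Nat.log 2 n) ^ 2 * (2 * Nat.log 2 n) +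
          (2 * a + 1) ^ 2 * Nat.log 2 n ^ 3) := by gcongr
    _ = 10 * (2 * a + 1) ^ 2 * Nat.log 2 n ^ 4 := by ring

theorem coverFactor_le (a n : ℕ) :
    (coverFactor a n : ℝ) ≤ 1 + 1600 * (2 * a + 1) ^ 4 * Real.logb 2 n ^ 8 := by
  have hwaves : (coverWaves a n : ℝ) ≤ 10 * (2 * a + 1) ^ 2 * Nat.log 2 n ^ 4 := by
    exact_mod_cast coverWaves_le a n
  have hlog : (Nat.log 2 n : ℝ) ≤ Real.logb 2 n := by exact_mod_cast Real.natLog_le_logb n 2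
  calc (coverFactor a n : ℝ) = 1 + 16 * (coverWaves a n : ℝ) ^ 2 := by
        simp only [coverFactor]; push_cast; ring
    _ ≤ 1 + 16 * (10 * (2 * a + 1) ^ 2 * Real.logb 2 n ^ 4) ^ 2 := by grw [hwaves, hlog]
    _ = 1 + 1600 * (2 * a + 1) ^ 4 * Real.logb 2 n ^ 8 := by ring

theorem coverMsgBound_le (a n : ℕ) : coverMsgBound a n ≤ 2 ^ ((a + 3) * logBits n) := by
  have hL := one_le_logBits n
  have hn := lt_two_pow_logBits n
  have hbits : 2 ^ coverBits a n ≤ 2 ^ ((a + 1) * logBits n) :=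
    Nat.pow_le_pow_right two_pos (by simp only [coverBits]; linarith)
  have hlog : 2 ^ logBits n ≤ 2 ^ ((a + 1) * logBits n) :=
    Nat.pow_le_pow_right two_pos (Nat.le_mul_of_pos_left _ a.succ_pos)
  have htwo : 2 ^ 1 ≤ 2 ^ logBits n := Nat.pow_le_pow_right two_pos hL
  calc coverMsgBound a n ≤ 2 ^ ((a + 1) * logBits n) * 2 ^ 2 := by
        simp only [coverMsgBound]
        omega
    _ ≤ 2 ^ ((a + 1) * logBits n) * 2 ^ (2 * logBits n) :=
        Nat.mul_le_mul_left _ (Nat.pow_le_pow_right two_pos (by omega))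
    _ = 2 ^ ((a + 3) * logBits n) := by rw [← pow_add]; ring_nf

theorem card_pairMsgs_coverMsgBound_le (a n : ℕ) :
    (pairMsgs (coverMsgBound a n)).card ≤ 2 ^ (2 * (a + 3) * logBits n) := by
  calc (pairMsgs (coverMsgBound a n)).card = coverMsgBound a n * coverMsgBound a n := by
        simp [pairMsgs]
    _ ≤ 2 ^ ((a + 3) * logBits n) * 2 ^ ((a + 3) * logBits n) :=
        Nat.mul_le_mul (coverMsgBound_le a n) (coverMsgBound_le a n)
    _ = 2 ^ (2 * (a + 3) * logBits n) := by rw [← pow_add]; ring_nf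

/-- The cover algorithm for identifiers of `a log n` bits. -/
noncomputable def coverAlgorithm (a n k : ℕ) : DistAlgorithm Unit TreePointers :=
  Instr.toAlgorithm (pairMsgs (coverMsgBound a n))
    ⟨0, zero_mem_pairMsgs (by simp [coverMsgBound])⟩ (fun id deg _ => initial id deg)
    (coverProgram (2 * Nat.log 2 n) (coverBits a n) (coverSteps a n) (2 * k)) pointers

theorem coverAlgorithm_rounds_le (a n : ℕ) {k : ℕ} (hk : 1 ≤ k) :
    (coverAlgorithm a n k).rounds ≤ k * coverFactor a n :=
  (length_coverProgram_le _ _ _ hk).trans (Nat.mul_le_mul_left _ (Nat.le_add_left _ _))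

theorem coverAlgorithm_exists_cover (a n k : ℕ) {V : Type} [Fintype V] (hV : Fintype.card V ≤ n)
    (N : Network V) (hid : ∀ v, N.id v < 2 ^ (a * logBits n)) :
    ∃ F : TreeFamily N.graph, Represents N ((coverAlgorithm a n k).result N fun _ => ()) F ∧
      IsNeighborhoodCover N.graph (coverFactor a n) k (k * coverFactor a n) F := by
  have hidB (v : V) : N.id v < 2 ^ coverBits a n :=
    (hid v).trans (Nat.pow_lt_pow_right one_lt_two (Nat.lt_succ_self _))
  have hclasses : Fintype.card V ≤ 1 ∨ Fintype.card V < 2 ^ (2 * Nat.log 2 n) := by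
    rcases Nat.eq_zero_or_pos (Nat.log 2 n) with hzero | hpos
    · left
      have : n < 2 := (Nat.log_eq_zero_iff.1 hzero).resolve_right (by norm_num)
      omega
    · exact .inr (hV.trans_lt ((lt_two_pow_logBits n).trans_le
        (Nat.pow_le_pow_right two_pos (by simp only [logBits]; omega))))
  have hpow := Nat.two_pow_pos (coverBits a n)
  obtain ⟨hsafe, hinv⟩ := triple_coverProgram (k := k) (m := coverMsgBound a n)
    (2 * Nat.log 2 n) (fun v => by have := hidB v; simp only [coverMsgBound]; omega)
    (by simp only [coverMsgBound]; omega) (by simp only [coverMsgBound]; omega)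
    (coverSteps_spec a hV) (Nat.succ_pos _) hidB _ (.zero N k _ _)
  obtain ⟨F, hF, hcover⟩ := hinv.exists_cover (hinv.exists_near_subset hclasses)
  have hwaves : coverWaves a n ≤ coverWaves a n ^ 2 := Nat.le_self_pow two_ne_zero _
  refine ⟨F, ?_, hcover.mono ?_ ?_⟩
  · rwa [show (coverAlgorithm a n k).result N (fun _ => ()) = _ from
      Instr.toAlgorithm_result (N := N) (fun _ => ()) hsafe]
  · change 1 + coverWaves a n ≤ _
    simp only [coverFactor]
    omega
  · calc 2 * (2 * Nat.log 2 n * (coverBits a n * coverSteps a n + 1) * (2 * k))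
        = k * (4 * coverWaves a n) := by simp only [coverWaves]; ring
      _ ≤ k * coverFactor a n := by gcongr; simp only [coverFactor]; omega

theorem exists_one_add_mul_pow_le_two_rpow_mul_sqrt (C : ℝ) {p : ℕ} (hp : p ≠ 0) :
    ∃ C' : ℝ, ∀ x : ℝ, 0 ≤ x → 1 + C * x ^ p ≤ 2 ^ (C' * √x) := by
  have hp2 : 2 * p ≠ 0 := by positivity
  have hlog : Real.log 2 ≠ 0 := (Real.log_pos one_lt_two).ne'
  set M := max 1 C
  have hM : C ≤ M ^ (2 * p) := (le_max_right 1 C).trans (le_self_pow₀ (le_max_left 1 C) hp2)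
  refine ⟨(2 * p : ℕ) * M / Real.log 2, fun x hx => ?_⟩
  calc 1 + C * x ^ p = 1 + C * √x ^ (2 * p) := by rw [pow_mul, Real.sq_sqrt hx]
    _ ≤ 1 ^ (2 * p) + (M * √x) ^ (2 * p) := by rw [one_pow, mul_pow]; gcongr
    _ ≤ (1 + M * √x) ^ (2 * p) := pow_add_pow_le zero_le_one (by positivity) hp2
    _ ≤ Real.exp (M * √x) ^ (2 * p) := by
        gcongr
        rw [add_comm]
        exact Real.add_one_le_exp _
    _ = 2 ^ ((2 * p : ℕ) * M / Real.log 2 * √x) := by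
        rw [← Real.exp_nat_mul, Real.rpow_def_of_pos two_pos]
        congr 1
        field_simp

/-! ### The parent function of a rooted tree -/

theorem Near.map {V W : Type*} {G : SimpleGraph V} {H : SimpleGraph W} {j : ℕ} {u v : V}
    (f : G →g H) (h : Near G j u v) : Near H j (f u) (f v) := by
  obtain ⟨p, hp⟩ := h.exists_walk
  exact .of_walk (p.map f) (by rwa [SimpleGraph.Walk.length_map])

namespace RootedSubtree

variable {V : Type} {G : SimpleGraph V} {T : RootedSubtree G} {u v w : T.tree.verts}

/-- The distance to the root in the tree. -/
noncomputable def level (T : RootedSubtree G) (v : T.tree.verts) : ℕ :=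
  T.tree.coe.dist v T.root

theorem level_eq_zero : T.level v = 0 ↔ v = T.root :=
  T.isTree.connected.dist_eq_zero_iff

theorem level_le {r : ℕ} (h : T.depth ≤ r) (v : T.tree.verts) : T.level v ≤ r := by
  have hedist : T.tree.coe.edist T.root v ≤ r := SimpleGraph.edist_le_eccent.trans h
  rw [← (T.isTree.connected T.root v).coe_dist_eq_edist, SimpleGraph.dist_comm] at hedist
  exact_mod_cast hedist

theorem isParent_or_isParent_of_adj (h : T.tree.coe.Adj u v) : T.IsParent u v ∨ T.IsParent v u := by
  have hne := T.isTree.dist_ne_of_adj T.root h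
  simp only [SimpleGraph.dist_comm (u := T.root)] at hne
  exact hne.lt_or_gt.symm.imp (⟨h, ·⟩) (⟨h.symm, ·⟩)

theorem IsParent.level_eq (h : T.IsParent v w) : T.level v = T.level w + 1 := by
  obtain ⟨hadj, hlt⟩ := h
  have htri := T.isTree.connected.dist_triangle (u := v) (v := w) (w := T.root)
  rw [SimpleGraph.dist_eq_one_iff_adj.2 hadj] at htri
  simp only [level]
  omega

theorem IsParent.exists_isPath (h : T.IsParent v w) :
    ∃ p : T.tree.coe.Walk v T.root, p.IsPath ∧ p.snd = w := by
  obtain ⟨q, hq⟩ := T.isTree.connected.exists_walk_length_eq_dist w T.root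
  refine ⟨.cons h.1 q, SimpleGraph.Walk.isPath_of_length_eq_dist _ ?_, by simp⟩
  rw [SimpleGraph.Walk.length_cons, hq]
  exact h.level_eq.symm

theorem IsParent.unique (h : T.IsParent v u) (h' : T.IsParent v w) : u = w := by
  obtain ⟨p, hp, rfl⟩ := h.exists_isPath
  obtain ⟨q, hq, rfl⟩ := h'.exists_isPath
  have hpq := (T.isTree.isAcyclic.subsingleton_path v T.root).elim ⟨p, hp⟩ ⟨q, hq⟩
  rw [Subtype.mk.inj hpq]

theorem exists_isParent (hv : v ≠ T.root) : ∃ w, T.IsParent v w := by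
  obtain ⟨p, hp⟩ := T.isTree.connected.exists_walk_length_eq_dist v T.root
  cases p with
  | nil => exact absurd rfl hv
  | cons h q =>
    rw [SimpleGraph.Walk.length_cons] at hp
    exact ⟨_, h, (SimpleGraph.dist_le q).trans_lt (by omega)⟩

open Classical in
/-- The parent of a vertex of the tree, where the root is its own parent. -/
noncomputable def parent (T : RootedSubtree G) (v : T.tree.verts) : T.tree.verts :=
  if h : v = T.root then v else (exists_isParent h).choose

theorem parent_root : T.parent T.root = T.root := dif_pos rfl

theorem isParent_parent (hv : v ≠ T.root) : T.IsParent v (T.parent v) := by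
  rw [parent, dif_neg hv]
  exact (exists_isParent hv).choose_spec

theorem IsParent.parent_eq (h : T.IsParent v w) : T.parent v = w := by
  refine (isParent_parent ?_).unique h
  rintro rfl
  exact absurd h.level_eq (by simp [level_eq_zero.2 rfl])

theorem parent_eq_or_parent_eq_of_adj (h : T.tree.coe.Adj u v) :
    T.parent u = v ∨ T.parent v = u :=
  (isParent_or_isParent_of_adj h).imp IsParent.parent_eq IsParent.parent_eq

theorem level_parent (v : T.tree.verts) : T.level (T.parent v) = T.level v - 1 := by
  by_cases hv : v = T.root
  · rw [hv, parent_root, level_eq_zero.2 rfl]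
  · rw [(isParent_parent hv).level_eq, Nat.add_sub_cancel]

theorem level_iterate_parent (v : T.tree.verts) (n : ℕ) :
    T.level (T.parent^[n] v) = T.level v - n := by
  induction n with
  | zero => rfl
  | succ n ih => rw [Function.iterate_succ_apply', level_parent, ih, Nat.sub_sub]

theorem iterate_parent_eq_root {n : ℕ} (h : T.level v ≤ n) : T.parent^[n] v = T.root := by
  rw [← level_eq_zero, level_iterate_parent, Nat.sub_eq_zero_of_le h]

theorem near_iterate_parent (v : T.tree.verts) (n : ℕ) :
    Near T.tree.coe n v (T.parent^[n] v) := by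
  induction n generalizing v with
  | zero => exact .refl v
  | succ n ih =>
    by_cases hv : v = T.root
    · rw [hv, Function.iterate_fixed parent_root]
      exact .refl _
    · rw [Function.iterate_succ_apply, add_comm]
      exact (Near.of_adj (isParent_parent hv).1).trans (ih _)

theorem exists_isPath_iterate_parent {n : ℕ} (hn : n ≤ T.level v) :
    ∃ p : T.tree.coe.Walk v (T.parent^[n] v), p.IsPath ∧ p.length = n ∧
      ∀ w ∈ p.support, ∃ i ≤ n, w = T.parent^[i] v := by
  induction n generalizing v with
  | zero =>
    exact ⟨.nil, .nil, rfl, fun w hw => ⟨0, le_rfl, by simpa using hw⟩⟩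
  | succ n ih =>
    have hv : v ≠ T.root := fun h => by rw [level_eq_zero.2 h] at hn; omega
    have hlevel := (isParent_parent hv).level_eq
    obtain ⟨p, hp, hlen, hsupp⟩ := ih (v := T.parent v) (by omega)
    refine ⟨.cons (isParent_parent hv).1 p, hp.cons fun hmem => ?_, by simp [hlen], fun w hw => ?_⟩
    · obtain ⟨i, -, hi⟩ := hsupp v hmem
      have := level_iterate_parent (T.parent v) i
      rw [← hi] at this
      omega
    · rcases List.mem_cons.1 hw with rfl | hw
      · exact ⟨0, Nat.zero_le _, rfl⟩
      · obtain ⟨i, hi, rfl⟩ := hsupp w hw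
        exact ⟨i + 1, Nat.succ_le_succ hi, rfl⟩

theorem exists_iterate_parent_eq {n : ℕ} (h : Near T.tree.coe n u v) :
    ∃ i j, i + j ≤ n ∧ T.parent^[i] u = T.parent^[j] v := by
  obtain ⟨p, hp⟩ := h.exists_walk
  suffices ∃ i j, i + j ≤ p.length ∧ T.parent^[i] u = T.parent^[j] v by
    obtain ⟨i, j, hij, heq⟩ := this
    exact ⟨i, j, hij.trans hp, heq⟩
  clear hp h
  induction p with
  | nil => exact ⟨0, 0, le_rfl, rfl⟩
  | @cons u w v hadj q ih =>
    obtain ⟨i, j, hij, heq⟩ := ih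
    rw [SimpleGraph.Walk.length_cons]
    rcases parent_eq_or_parent_eq_of_adj hadj with rfl | rfl
    · exact ⟨i + 1, j, by omega, heq⟩
    · cases i with
      | zero => exact ⟨0, j + 1, by omega, by rw [Function.iterate_succ_apply', ← heq]; rfl⟩
      | succ i => exact ⟨i, j, by omega, heq⟩

theorem diameter_le_of_exists_iterate_parent_eq {D : ℕ}
    (h : ∀ u v, ∃ i j, i + j ≤ D ∧ T.parent^[i] u = T.parent^[j] v) : T.diameter ≤ D := by
  refine SimpleGraph.ediam_le_of_edist_le fun u v => ?_
  obtain ⟨i, j, hij, heq⟩ := h u v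
  exact ((heq ▸ near_iterate_parent u i).trans (near_iterate_parent v j).symm).mono hij

end RootedSubtree

theorem Represents.parentOf_eq_parent {V : Type} {N : Network V} {ptr : V → TreePointers}
    {F : TreeFamily N.graph} (hR : Represents N ptr F) (l : F.labels) (v : (F.tree l).tree.verts) :
    N.parentOf ptr l v = (F.tree l).parent v := by
  by_cases hv : v = (F.tree l).root
  · simp [hv, RootedSubtree.parent_root, Network.parentOf, hR.root l]
  · obtain ⟨w, p, hw, hport, hp⟩ := hR.parent l v hv
    rw [hw.parent_eq, N.parentOf_eq hp p.2, ← hport]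

theorem Represents.iterate_parentOf_eq {V : Type} {N : Network V} {ptr : V → TreePointers}
    {F : TreeFamily N.graph} (hR : Represents N ptr F) (l : F.labels) (v : (F.tree l).tree.verts)
    (n : ℕ) : (N.parentOf ptr l)^[n] v = ((F.tree l).parent^[n] v : (F.tree l).tree.verts) := by
  induction n generalizing v with
  | zero => rfl
  | succ n ih =>
    rw [Function.iterate_succ_apply, hR.parentOf_eq_parent, ih, Function.iterate_succ_apply]

/-! ### Weak-diameter decompositions -/

/-- The vertices at distance at most `i` from the cluster `x`. -/
def NearCluster {V : Type} (G : SimpleGraph V) (cluster : V → ℕ) (i x : ℕ) (v : V) : Prop :=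
  ∃ u, cluster u = x ∧ Near G i u v

/-- The vertices of the cluster `x` and their ancestors along the pointers for `x`: the vertices of
the tree of `x` that are left when the branches without vertices of the cluster are pruned. -/
def Marked {V : Type} (N : Network V) (cluster : V → ℕ) (ptr : V → TreePointers) (x : ℕ) (v : V) :
    Prop :=
  ∃ u i, cluster u = x ∧ (N.parentOf ptr x)^[i] u = v

theorem NearCluster.mono {V : Type} {G : SimpleGraph V} {cluster : V → ℕ} {i j x : ℕ} {v : V}
    (h : NearCluster G cluster i x v) (hij : i ≤ j) : NearCluster G cluster j x v := by
  obtain ⟨u, hu, hn⟩ := h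
  exact ⟨u, hu, hn.mono hij⟩

namespace IsWeakDecomposition

variable {V : Type} {G : SimpleGraph V} {c d r : ℕ} {color cluster : V → ℕ} {F : TreeFamily G}

theorem label_mem (hW : IsWeakDecomposition G c d r color cluster F) (v : V) :
    cluster v ∈ F.labels :=
  hW.labels_eq ▸ ⟨v, rfl⟩

theorem exists_cluster_eq (hW : IsWeakDecomposition G c d r color cluster F) (l : F.labels) :
    ∃ v, cluster v = l :=
  ⟨_, hW.root_mem l⟩

theorem depth_le (hW : IsWeakDecomposition G c d r color cluster F) (l : F.labels) :
    (F.tree l).depth ≤ d :=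
  SimpleGraph.eccent_le_ediam.trans (hW.diameter_le l)

theorem eq_of_nearCluster {k : ℕ} (hW : IsWeakDecomposition G c d (2 * k) color cluster F)
    {u u' v : V} (hcolor : color u = color u') (h : NearCluster G cluster k (cluster u) v)
    (h' : NearCluster G cluster k (cluster u') v) : cluster u = cluster u' := by
  by_contra hne
  obtain ⟨s, hs, hn⟩ := h
  obtain ⟨s', hs', hn'⟩ := h'
  have hss : color s = color s' := by rw [hW.color_eq s u hs, hW.color_eq s' u' hs', hcolor]
  exact (hW.separated s s' hss (by rwa [hs, hs'])).not_ge
    ((hn.trans hn'.symm).mono (two_mul k).ge)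

theorem le_of_cluster_iterate_parent (hW : IsWeakDecomposition G c d r color cluster F)
    {l : F.labels} {u : (F.tree l).tree.verts} {n : ℕ} (hn : n ≤ (F.tree l).level u)
    (hu : cluster u = l) (hnu : cluster ((F.tree l).parent^[n] u) = l)
    (hmin : ∀ i, 0 < i → i < n → cluster ((F.tree l).parent^[i] u) ≠ l) : n ≤ r := by
  obtain ⟨p, hp, hlen, hsupp⟩ := RootedSubtree.exists_isPath_iterate_parent hn
  refine hlen.symm.trans_le (hW.hop l _ _ hu hnu p hp fun w hw hwl => ?_)
  obtain ⟨i, hi, rfl⟩ := hsupp w hw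
  rcases Nat.eq_zero_or_pos i with rfl | hpos
  · exact .inl rfl
  · exact .inr (by rw [hi.eq_of_not_lt fun hlt => hmin i hpos hlt hwl])

/-- Between two consecutive cluster vertices on the way to the root there are at most `2 * k`
edges, so every vertex on the way is within `k` of one of them. -/
theorem nearCluster_iterate_parent {k : ℕ}
    (hW : IsWeakDecomposition G c d (2 * k) color cluster F) {l : F.labels}
    {u : (F.tree l).tree.verts} (hu : cluster u = l) (i : ℕ) :
    NearCluster G cluster k l ((F.tree l).parent^[i] u : (F.tree l).tree.verts) := by
  classical
  induction i using Nat.strong_induction_on generalizing u with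
  | _ i ih =>
    have hnear (w : (F.tree l).tree.verts) (n : ℕ) :
        Near G n w ((F.tree l).parent^[n] w : (F.tree l).tree.verts) :=
      (RootedSubtree.near_iterate_parent w n).map (F.tree l).tree.hom
    rcases le_or_gt i k with hik | hki
    · exact ⟨u, hu, (hnear u i).mono hik⟩
    have hroot : cluster ((F.tree l).parent^[(F.tree l).level u] u) = l := by
      rw [RootedSubtree.iterate_parent_eq_root le_rfl]
      exact hW.root_mem l
    rcases Nat.eq_zero_or_pos ((F.tree l).level u) with hzero | hpos
    · rw [RootedSubtree.iterate_parent_eq_root (hzero.trans_le (Nat.zero_le i))]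
      exact ⟨_, hW.root_mem l, .refl _⟩
    have hex : ∃ n, 0 < n ∧ cluster ((F.tree l).parent^[n] u) = l := ⟨_, hpos, hroot⟩
    obtain ⟨n, ⟨hn, hnu⟩, hmin⟩ := Nat.findX hex
    have hle : n ≤ 2 * k := hW.le_of_cluster_iterate_parent
      (not_lt.1 fun hlt => hmin _ hlt ⟨hpos, hroot⟩)
      hu hnu fun j hj hjn h => hmin j hjn ⟨hj, h⟩
    rcases le_or_gt n i with hni | hin
    · rw [← Nat.sub_add_cancel hni, Function.iterate_add_apply]
      exact ih (i - n) (by omega) hnu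
    · refine ⟨_, hnu, ?_⟩
      rw [← Nat.sub_add_cancel hin.le, Function.iterate_add_apply]
      exact (hnear _ _).symm.mono (by omega)

end IsWeakDecomposition

namespace Marked

variable {V : Type} {N : Network V} {c d k r x : ℕ} {color cluster : V → ℕ}
  {F : TreeFamily N.graph} {ptr : V → TreePointers} {v : V}

theorem self (v : V) : Marked N cluster ptr (cluster v) v := ⟨v, 0, rfl, rfl⟩

theorem parentOf (h : Marked N cluster ptr x v) :
    Marked N cluster ptr x (N.parentOf ptr x v) := by
  obtain ⟨u, i, hu, rfl⟩ := h
  exact ⟨u, i + 1, hu, Function.iterate_succ_apply' ..⟩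

theorem root (hW : IsWeakDecomposition N.graph c d r color cluster F) (l : F.labels) :
    Marked N cluster ptr l (F.tree l).root :=
  ⟨_, 0, hW.root_mem l, rfl⟩

theorem exists_iterate_parent_eq (hW : IsWeakDecomposition N.graph c d r color cluster F)
    (hR : Represents N ptr F) {l : F.labels} (h : Marked N cluster ptr l v) :
    ∃ (u : (F.tree l).tree.verts) (i : ℕ), cluster u = l ∧ i ≤ d ∧
      ((F.tree l).parent^[i] u : (F.tree l).tree.verts) = v := by
  obtain ⟨u, i, hu, rfl⟩ := h
  lift u to (F.tree l).tree.verts using hW.spans l u hu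
  refine ⟨u, min i d, hu, min_le_right i d, ?_⟩
  rw [hR.iterate_parentOf_eq l u]
  rcases le_total i d with hi | hi
  · rw [min_eq_left hi]
  · have hlevel : (F.tree l).level u ≤ d := RootedSubtree.level_le (hW.depth_le l) u
    rw [min_eq_right hi, RootedSubtree.iterate_parent_eq_root hlevel,
      RootedSubtree.iterate_parent_eq_root (hlevel.trans hi)]

theorem mem (hW : IsWeakDecomposition N.graph c d r color cluster F) (hR : Represents N ptr F)
    {l : F.labels} (h : Marked N cluster ptr l v) : v ∈ (F.tree l).tree.verts := by
  obtain ⟨u, i, -, -, rfl⟩ := h.exists_iterate_parent_eq hW hR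
  exact Subtype.prop _

theorem ptr_ne_none (hW : IsWeakDecomposition N.graph c d r color cluster F)
    (hR : Represents N ptr F) {l : F.labels} (h : Marked N cluster ptr l v) : ptr v l ≠ none :=
  (hR.mem v l).2 ⟨l.2, h.mem hW hR⟩

theorem nearCluster (hW : IsWeakDecomposition N.graph c d (2 * k) color cluster F)
    (hR : Represents N ptr F) {l : F.labels} (h : Marked N cluster ptr l v) :
    NearCluster N.graph cluster k l v := by
  obtain ⟨u, i, hu, -, rfl⟩ := h.exists_iterate_parent_eq hW hR
  exact hW.nearCluster_iterate_parent hu i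

end Marked

/-! ### The cover obtained from a decomposition -/

section Expansion

variable {V : Type} {N : Network V} {c d k r x : ℕ} {color cluster : V → ℕ}
  {F : TreeFamily N.graph} {ptr out : V → TreePointers} {v : V}

/-- The pointer of `v` for the label `x` leads to a vertex closer to the cluster `x`. -/
def PointsCloser (N : Network V) (cluster : V → ℕ) (out : V → TreePointers) (x : ℕ) (v : V) :
    Prop :=
  ∃ (p : Fin (N.deg v)) (i : ℕ), out v x = some (some (p : ℕ)) ∧
    NearCluster N.graph cluster i x (N.port v p) ∧ ¬ NearCluster N.graph cluster i x v

/-- The pointers `out` for the label `x` describe the tree of the cluster `x`, pruned to the marked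
vertices, together with shortest paths to the cluster from the other vertices at distance at most
`k`. -/
structure ExpandSpec (N : Network V) (k : ℕ) (cluster : V → ℕ) (ptr : V → TreePointers) (x : ℕ)
    (out : V → TreePointers) : Prop where
  marked : ∀ v, Marked N cluster ptr x v → out v x = ptr v x
  closer : ∀ v, ¬ Marked N cluster ptr x v → NearCluster N.graph cluster k x v →
    PointsCloser N cluster out x v
  eq_none : ∀ v, ¬ NearCluster N.graph cluster k x v → out v x = none

/-- The distance to the cluster `x`, and `0` if there is no path to it. -/
noncomputable def clusterDist {V : Type} (G : SimpleGraph V) (cluster : V → ℕ) (x : ℕ) (v : V) :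
    ℕ :=
  sInf {i | NearCluster G cluster i x v}

theorem clusterDist_le {G : SimpleGraph V} {i : ℕ} (h : NearCluster G cluster i x v) :
    clusterDist G cluster x v ≤ i :=
  Nat.sInf_le h

theorem NearCluster.clusterDist {G : SimpleGraph V} {i : ℕ} (h : NearCluster G cluster i x v) :
    NearCluster G cluster (clusterDist G cluster x v) x v :=
  Nat.sInf_mem (s := {i | NearCluster G cluster i x v}) ⟨i, h⟩

theorem PointsCloser.exists_port (h : PointsCloser N cluster out x v)
    (hk : NearCluster N.graph cluster k x v) :
    ∃ p : Fin (N.deg v), out v x = some (some (p : ℕ)) ∧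
      NearCluster N.graph cluster k x (N.port v p) ∧
      clusterDist N.graph cluster x (N.port v p) < clusterDist N.graph cluster x v := by
  obtain ⟨p, i, hp, hi, hv⟩ := h
  have lt_of_near {j : ℕ} (hj : NearCluster N.graph cluster j x v) : i < j :=
    lt_of_not_ge fun hle => hv (hj.mono hle)
  exact ⟨p, hp, hi.mono (lt_of_near hk).le,
    (clusterDist_le hi).trans_lt (lt_of_near hk.clusterDist)⟩

open Classical in
/-- A bound for the depth of `v` in the cluster `l` of the cover, if the trees of the decomposition
have depth at most `r`. -/
noncomputable def expandRank (N : Network V) (cluster : V → ℕ) (ptr : V → TreePointers)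
    (F : TreeFamily N.graph) (r : ℕ) (l : F.labels) (v : V) : ℕ :=
  if h : Marked N cluster ptr l v ∧ v ∈ (F.tree l).tree.verts then (F.tree l).level ⟨v, h.2⟩
  else r + clusterDist N.graph cluster l v

theorem expandRank_of_marked (hW : IsWeakDecomposition N.graph c d r color cluster F)
    (hR : Represents N ptr F) {l : F.labels} {m : ℕ} (h : Marked N cluster ptr l v) :
    expandRank N cluster ptr F m l v = (F.tree l).level ⟨v, h.mem hW hR⟩ :=
  dif_pos ⟨h, h.mem hW hR⟩

theorem expandRank_of_not_marked {l : F.labels} (h : ¬ Marked N cluster ptr l v) :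
    expandRank N cluster ptr F r l v = r + clusterDist N.graph cluster l v :=
  dif_neg fun h' => h h'.1

theorem expandRank_le (hr : ∀ l, (F.tree l).depth ≤ r) (l : F.labels) (v : V) :
    expandRank N cluster ptr F r l v ≤ r + clusterDist N.graph cluster l v := by
  unfold expandRank
  split_ifs
  · exact (RootedSubtree.level_le (hr l) _).trans (Nat.le_add_right _ _)
  · exact le_rfl

namespace ExpandSpec

theorem ne_none_iff {l : F.labels} (hE : ExpandSpec N k cluster ptr l out)
    (hW : IsWeakDecomposition N.graph c d (2 * k) color cluster F) (hR : Represents N ptr F)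
    (v : V) : out v l ≠ none ↔ NearCluster N.graph cluster k l v := by
  refine ⟨fun h => not_not.1 fun hfar => h (hE.eq_none v hfar), fun h => ?_⟩
  by_cases hm : Marked N cluster ptr l v
  · rw [hE.marked v hm]
    exact hm.ptr_ne_none hW hR
  · obtain ⟨p, _, hp, -⟩ := hE.closer v hm h
    simp [hp]

theorem eq_root {l : F.labels} (hE : ExpandSpec N k cluster ptr l out)
    (hW : IsWeakDecomposition N.graph c d (2 * k) color cluster F) (hR : Represents N ptr F)
    (hv : out v l = some none) : v = (F.tree l).root := by
  by_cases hm : Marked N cluster ptr l v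
  · rw [hE.marked v hm] at hv
    by_contra hne
    obtain ⟨_, p, -, -, hp⟩ :=
      hR.parent l ⟨v, hm.mem hW hR⟩ fun h => hne (congrArg Subtype.val h)
    simp [hp] at hv
  · obtain ⟨p, _, hp, -⟩ := hE.closer v hm ((hE.ne_none_iff hW hR v).1 (by simp [hv]))
    simp [hp] at hv

theorem exists_port_of_marked {l : F.labels}
    (hW : IsWeakDecomposition N.graph c d r color cluster F) (hR : Represents N ptr F)
    (hm : Marked N cluster ptr l v) {p : ℕ} (hv : ptr v l = some (some p)) (m : ℕ) :
    ∃ hp : p < N.deg v, Marked N cluster ptr l (N.port v ⟨p, hp⟩) ∧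
      expandRank N cluster ptr F m l (N.port v ⟨p, hp⟩) < expandRank N cluster ptr F m l v := by
  have hne : (⟨v, hm.mem hW hR⟩ : (F.tree l).tree.verts) ≠ (F.tree l).root := fun h => by
    have hroot := hR.root l
    simp [← h, hv] at hroot
  obtain ⟨w, q, hw, hq, hptr⟩ := hR.parent l ⟨v, hm.mem hW hR⟩ hne
  obtain rfl : p = q := by simpa [hv] using hptr
  have hmw : Marked N cluster ptr l w := by
    have := hm.parentOf
    rwa [N.parentOf_eq hv q.2, Fin.eta, hq] at this
  refine ⟨q.2, hq ▸ hmw, ?_⟩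
  rw [Fin.eta, hq, expandRank_of_marked hW hR hmw, expandRank_of_marked hW hR hm, hw.level_eq]
  exact Nat.lt_succ_self _

theorem pointersTo (hE : ∀ x, ExpandSpec N k cluster ptr x out)
    (hW : IsWeakDecomposition N.graph c d (2 * k) color cluster F) (hR : Represents N ptr F)
    (hr : ∀ l, (F.tree l).depth ≤ r) :
    N.PointersTo out F.labels (fun l => (F.tree l).root) (expandRank N cluster ptr F r) where
  root_eq l := by rw [(hE l).marked _ (.root hW l), hR.root l]
  label_mem v x hv := by
    by_contra hx
    refine hv ((hE x).eq_none v ?_)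
    rintro ⟨u, rfl, -⟩
    exact hx (hW.label_mem u)
  eq_root v l hv := (hE l).eq_root hW hR hv
  parent v l p hv := by
    by_cases hm : Marked N cluster ptr l v
    · rw [(hE l).marked v hm] at hv
      obtain ⟨hp, hmp, hlt⟩ := exists_port_of_marked hW hR hm hv r
      exact ⟨hp, by rw [(hE l).marked _ hmp]; exact hmp.ptr_ne_none hW hR, hlt⟩
    · have hk := ((hE l).ne_none_iff hW hR v).1 (by simp [hv])
      obtain ⟨q, hq, hnear, hlt⟩ := ((hE l).closer v hm hk).exists_port hk
      obtain rfl : p = q := by simpa [hv] using hq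
      refine ⟨q.2, ((hE l).ne_none_iff hW hR _).2 hnear, ?_⟩
      rw [expandRank_of_not_marked hm]
      exact (expandRank_le hr l _).trans_lt (Nat.add_lt_add_left hlt r)

theorem iterate_parentOf_eq (hE : ExpandSpec N k cluster ptr x out)
    (h : Marked N cluster ptr x v) (i : ℕ) :
    (N.parentOf out x)^[i] v = (N.parentOf ptr x)^[i] v := by
  induction i generalizing v with
  | zero => rfl
  | succ i ih =>
    have hpar : N.parentOf out x v = N.parentOf ptr x v := by
      simp only [Network.parentOf, hE.marked v h]
    rw [Function.iterate_succ_apply, Function.iterate_succ_apply, hpar, ih h.parentOf]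

theorem exists_marked_iterate (hE : ExpandSpec N k cluster ptr x out) {n : ℕ} (hn : n ≤ k)
    (h : NearCluster N.graph cluster n x v) :
    ∃ i ≤ n, Marked N cluster ptr x ((N.parentOf out x)^[i] v) := by
  induction n generalizing v with
  | zero =>
    obtain ⟨u, rfl, huv⟩ := h
    exact ⟨0, le_rfl, huv.eq ▸ .self u⟩
  | succ n ih =>
    by_cases hm : Marked N cluster ptr x v
    · exact ⟨0, Nat.zero_le _, hm⟩
    · obtain ⟨p, i, hp, hi, hv⟩ := hE.closer v hm (h.mono hn)
      have hin : i ≤ n := Nat.lt_succ_iff.1 (lt_of_not_ge fun hle => hv (h.mono hle))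
      obtain ⟨j, hj, hmj⟩ := ih (Nat.le_of_succ_le hn) (hi.mono hin)
      refine ⟨j + 1, Nat.succ_le_succ hj, ?_⟩
      rwa [Function.iterate_succ_apply, N.parentOf_eq hp p.2]

theorem exists_iterate_parentOf_eq {l : F.labels} (hE : ExpandSpec N k cluster ptr l out)
    (hW : IsWeakDecomposition N.graph c d (2 * k) color cluster F) (hR : Represents N ptr F)
    {u v : V} (hu : NearCluster N.graph cluster k l u) (hv : NearCluster N.graph cluster k l v) :
    ∃ i j, i + j ≤ d + 2 * k ∧ (N.parentOf out l)^[i] u = (N.parentOf out l)^[j] v := by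
  obtain ⟨i, hi, hmi⟩ := hE.exists_marked_iterate le_rfl hu
  obtain ⟨j, hj, hmj⟩ := hE.exists_marked_iterate le_rfl hv
  obtain ⟨i', j', hij, heq⟩ := RootedSubtree.exists_iterate_parent_eq
    (show Near (F.tree l).tree.coe d ⟨_, hmi.mem hW hR⟩ ⟨_, hmj.mem hW hR⟩ from
      SimpleGraph.edist_le_ediam.trans (hW.diameter_le l))
  refine ⟨i' + i, j' + j, by omega, ?_⟩
  rw [Function.iterate_add_apply, Function.iterate_add_apply, hE.iterate_parentOf_eq hmi,
    hE.iterate_parentOf_eq hmj]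
  have hval := congrArg Subtype.val heq
  rwa [← hR.iterate_parentOf_eq, ← hR.iterate_parentOf_eq] at hval

theorem exists_cover (hE : ∀ x, ExpandSpec N k cluster ptr x out)
    (hW : IsWeakDecomposition N.graph c d (2 * k) color cluster F) (hR : Represents N ptr F) :
    ∃ F' : TreeFamily N.graph, Represents N out F' ∧
      IsNeighborhoodCover N.graph c k (d + 2 * k) F' ∧
      (∀ l : F'.labels, (F'.tree l).depth ≤ ((d + k : ℕ) : ℕ∞)) ∧
      ∀ r : ℕ, (∀ l : F.labels, (F.tree l).depth ≤ r) →
        ∀ l : F'.labels, (F'.tree l).depth ≤ ((r + k : ℕ) : ℕ∞) := by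
  have hP := pointersTo hE hW hR hW.depth_le
  have hmem (l : F.labels) (v : V) : v ∈ (hP.family.tree l).tree.verts ↔
      NearCluster N.graph cluster k l v := (hE l).ne_none_iff hW hR v
  have hdepth (r : ℕ) (hr : ∀ l : F.labels, (F.tree l).depth ≤ r) (l : F.labels) :
      (hP.isParentMap l).toTree.depth ≤ ((r + k : ℕ) : ℕ∞) :=
    (hP.isParentMap l).depth_le ((pointersTo hE hW hR hr).isParentMap l) fun v hv =>
      (expandRank_le hr l v).trans (Nat.add_le_add_left (clusterDist_le ((hmem l v).1 hv)) r)
  refine ⟨hP.family, hP.represents, ⟨fun l => ?diameter, fun v => ?covers, fun v => ?sparse⟩,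
    hdepth d hW.depth_le, hdepth⟩
  case diameter =>
    refine RootedSubtree.diameter_le_of_exists_iterate_parent_eq fun u v => ?_
    obtain ⟨i, j, hij, heq⟩ :=
      (hE l).exists_iterate_parentOf_eq (F := F) (l := l) hW hR ((hmem l u).1 u.2)
        ((hmem l v).1 v.2)
    rw [hP.represents.iterate_parentOf_eq l u, hP.represents.iterate_parentOf_eq l v] at heq
    exact ⟨i, j, hij, Subtype.ext heq⟩
  case covers =>
    exact ⟨⟨cluster v, hW.label_mem v⟩, fun u hu => (hmem _ u).2 ⟨v, rfl, hu⟩⟩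
  case sparse =>
    choose rep hrep using hW.exists_cluster_eq
    have hinj : Set.InjOn (color ∘ rep) {l | v ∈ (hP.family.tree l).tree.verts} :=
      fun l hl l' hl' hcolor => Subtype.ext (by
        rw [← hrep l, ← hrep l']
        exact hW.eq_of_nearCluster hcolor (by rw [hrep]; exact (hmem l v).1 hl)
          (by rw [hrep]; exact (hmem l' v).1 hl'))
    have hmaps : Set.MapsTo (color ∘ rep) {l | v ∈ (hP.family.tree l).tree.verts}
        (Finset.range c : Set ℕ) := fun l _ => by simpa using hW.color_lt (rep l)
    refine (Set.encard_le_encard_of_injOn hmaps hinj).trans ?_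
    rw [Set.encard_coe_eq_coe_finsetCard, Finset.card_range]

end ExpandSpec

end Expansion

/-! ### The algorithm that expands the clusters of a decomposition -/

/-- The local state of the algorithm that expands the clusters of a decomposition. For the current
color, `wave` is the label of the cluster that reached the node, and `mark` is the label of the
cluster for which the node is known to be `Marked`. -/
structure ExpandState where
  input : DecompositionInput
  wave : Option ℕ
  mark : Option ℕ
  out : TreePointers

namespace ExpandState

/-- The beginning of the phase of color `j`: the nodes of the clusters of this color are reached
and marked. -/
def start (j : ℕ) (s : ExpandState) : ExpandState :=
  { s with
    wave := if s.input.color = j then some s.input.cluster else none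
    mark := if s.input.color = j then some s.input.cluster else none }

/-- One hop of the wave from the clusters of the current color. A newly reached node stores the
port through which the wave came as its pointer. -/
noncomputable def hop : Instr ExpandState ℕ where
  send s _ := labelMsg s.wave
  step s r :=
    { s with
      wave := s.wave.or ((adopt s.wave r).map Prod.snd)
      out := fun x => (((adopt s.wave r).filter fun q => q.2 == x).map fun q => some q.1).or
        (s.out x) }

/-- The message through port `q` of a node that marks its parent. -/
def climbMsg (s : ExpandState) (q : ℕ) : ℕ :=
  labelMsg (s.mark.filter fun x => s.input.pointers x = some (some q))

/-- One round in which the marked nodes mark their parents in the decomposition. -/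
noncomputable def climb : Instr ExpandState ℕ where
  send s q := s.climbMsg q
  step s r := { s with mark := s.mark.or ((adopt s.mark r).map Prod.snd) }

/-- The end of the phase of a color: the marked nodes take over their pointers from the
decomposition. -/
def finish (s : ExpandState) : ExpandState :=
  { s with out := fun x => if s.mark = some x then s.input.pointers x else s.out x }

/-- The phase of color `j`. -/
noncomputable def expandColor (k d j : ℕ) : List (Instr ExpandState ℕ) :=
  [Instr.localStep (start j)] ++ ((List.range k).flatMap fun _ => [hop]) ++
    (((List.range d).flatMap fun _ => [climb]) ++ [Instr.localStep finish])

/-- The program that expands the clusters color by color. -/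
noncomputable def expandProgram (k c d : ℕ) : List (Instr ExpandState ℕ) :=
  (List.range c).flatMap fun j => expandColor k d j

theorem length_expandProgram_le (c d : ℕ) {k : ℕ} (hk : 1 ≤ k) :
    (expandProgram k c d).length ≤ 3 * (c * (d + k)) := by
  refine (length_flatMap_range_le (b := 3 * (d + k)) fun j _ => ?_).trans_eq (by ring)
  simp only [expandColor, List.length_append, List.length_singleton, List.length_flatMap,
    List.map_const', List.length_range, List.sum_replicate, smul_eq_mul, mul_one]
  omega

section Instr

variable {V : Type} {N : Network V} {s : V → ExpandState} {v : V} {x : ℕ}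

theorem wave_hop_of_eq_some (h : (s v).wave = some x) :
    (N.runInstr hop s v).wave = some x := by
  simp [Network.runInstr, hop, h]

theorem hop_eq_of_reached_or_unchanged (s : V → ExpandState) (v : V) (x : ℕ) :
    ((s v).wave = none ∧ (N.runInstr hop s v).wave = some x ∧ ∃ p : Fin (N.deg v),
      (s (N.port v p)).wave = some x ∧ (N.runInstr hop s v).out x = some (some (p : ℕ))) ∨
    ((N.runInstr hop s v).out x = (s v).out x ∧
      ((N.runInstr hop s v).wave = some x → (s v).wave = some x)) := by
  have hwave : (N.runInstr hop s v).wave = (s v).wave.or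
    ((adopt (s v).wave (N.inbox (fun u _ => labelMsg (s u).wave) v)).map Prod.snd) := rfl
  have hout : (N.runInstr hop s v).out x =
    (((adopt (s v).wave (N.inbox (fun u _ => labelMsg (s u).wave) v)).filter
      fun q => q.2 == x).map fun q => some q.1).or ((s v).out x) := rfl
  rw [hwave, hout]
  rcases ha : adopt (s v).wave (N.inbox (fun u _ => labelMsg (s u).wave) v) with _ | ⟨p, y⟩
  · exact .inr ⟨by simp, by simp⟩
  obtain ⟨hnone, hp, hy⟩ := adopt_eq_some (w := fun v => (s v).wave) ha
  by_cases hyx : y = x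
  · subst hyx
    exact .inl ⟨hnone, by simp [hnone], ⟨p, hp⟩, hy, by simp⟩
  · exact .inr ⟨by simp [Option.filter_some, hyx], by simp [hnone, hyx]⟩

theorem climbMsg_eq_succ {s : ExpandState} {q x : ℕ} :
    s.climbMsg q = x + 1 ↔ s.mark = some x ∧ s.input.pointers x = some (some q) := by
  rw [climbMsg, labelMsg_eq_succ, Option.filter_eq_some_iff, decide_eq_true_eq]

theorem mark_climb_of_eq_some (h : (s v).mark = some x) :
    (N.runInstr climb s v).mark = some x := by
  simp [Network.runInstr, climb, h]

theorem exists_of_mark_climb_eq_some (h : (N.runInstr climb s v).mark = some x) :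
    (s v).mark = some x ∨
      ∃ u, (s u).mark = some x ∧ N.parentOf (fun u => (s u).input.pointers) x u = v := by
  rcases hv : (s v).mark with _ | y
  · right
    have hmark : (N.runInstr climb s v).mark = (s v).mark.or
      ((adopt (s v).mark (N.inbox (fun u => (s u).climbMsg) v)).map Prod.snd) := rfl
    simp only [hmark, hv, adopt, if_true, Option.none_or, Option.map_eq_some_iff] at h
    obtain ⟨⟨p, y⟩, hp, rfl⟩ := h
    obtain ⟨hp, hmsg⟩ := N.inbox_eq_some (eq_some_of_arrivingLabel_eq_some hp)
    obtain ⟨hu, hptr⟩ := climbMsg_eq_succ.1 hmsg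
    exact ⟨_, hu, by rw [N.parentOf_eq hptr (Fin.is_lt _), Fin.eta, N.port_portTo]⟩
  · exact .inl (mark_climb_of_eq_some hv ▸ h)

theorem mark_climb_parentOf_ne_none (h : (s v).mark = some x) :
    (N.runInstr climb s (N.parentOf (fun u => (s u).input.pointers) x v)).mark ≠ none := by
  by_cases hptr : ∃ p : Fin (N.deg v), (s v).input.pointers x = some (some (p : ℕ))
  · obtain ⟨p, hp⟩ := hptr
    rw [N.parentOf_eq (out := fun u => (s u).input.pointers) hp p.2, Fin.eta]
    rcases hm : (s (N.port v p)).mark with _ | y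
    · have hin := N.inbox_portTo (fun u => (s u).climbMsg) (N.adj_port v p).symm
      rw [(N.portTo_eq_iff (N.adj_port v p)).2 rfl, climbMsg_eq_succ.2 ⟨h, hp⟩] at hin
      simpa [Network.runInstr, climb, adopt, hm] using arrivingLabel_ne_none hin
    · simp [mark_climb_of_eq_some hm]
  · have hself : N.parentOf (fun u => (s u).input.pointers) x v = v := by
      unfold Network.parentOf
      split
      · rename_i p hp
        exact dif_neg fun hlt => hptr ⟨⟨p, hlt⟩, hp⟩
      · rfl
    simp [hself, mark_climb_of_eq_some h]

end Instr

end ExpandState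

open ExpandState

section ExpandProgram

variable {V : Type} {N : Network V} {c d i j k t x y : ℕ} {color cluster : V → ℕ}
  {F : TreeFamily N.graph} {ptr : V → TreePointers} {s₀ s₁ s : V → ExpandState} {u v : V}

/-- `x` is the label of a cluster of color `j`. -/
def HasColor (color cluster : V → ℕ) (j x : ℕ) : Prop := ∃ u, cluster u = x ∧ color u = j

/-- The invariant after the phases of the colors below `j`. -/
structure ExpandInv (N : Network V) (k : ℕ) (color cluster : V → ℕ) (ptr : V → TreePointers)
    (j : ℕ) (s : V → ExpandState) : Prop where
  input_eq : ∀ v, (s v).input = ⟨color v, cluster v, ptr v⟩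
  done : ∀ u, color u < j → ExpandSpec N k cluster ptr (cluster u) fun v => (s v).out
  todo : ∀ x, (∀ u, cluster u = x → j ≤ color u) → ∀ v, (s v).out x = none

/-- The invariant after `i` hops in the phase of color `j`, where `s₀` is the configuration before
the phase. -/
structure HopInv (N : Network V) (color cluster : V → ℕ) (ptr : V → TreePointers) (j : ℕ)
    (s₀ : V → ExpandState) (i : ℕ) (s : V → ExpandState) : Prop where
  input_eq : ∀ v, (s v).input = ⟨color v, cluster v, ptr v⟩
  mark_eq : ∀ v, (s v).mark = if color v = j then some (cluster v) else none
  wave : WaveSpec N.graph (fun u x => cluster u = x ∧ color u = j) i fun v => (s v).wave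
  other : ∀ x, ¬ HasColor color cluster j x → ∀ v, (s v).out x = (s₀ v).out x
  closer : ∀ v x, (s v).wave = some x →
    cluster v = x ∨ PointsCloser N cluster (fun v => (s v).out) x v
  eq_none : ∀ v x, HasColor color cluster j x → (s v).wave ≠ some x → (s v).out x = none

/-- The invariant after `t` rounds of marking in the phase of color `j`, where `s₁` is the
configuration before these rounds. -/
structure ClimbInv (N : Network V) (color cluster : V → ℕ) (ptr : V → TreePointers) (j : ℕ)
    (s₁ : V → ExpandState) (t : ℕ) (s : V → ExpandState) : Prop where
  input_eq : ∀ v, (s v).input = ⟨color v, cluster v, ptr v⟩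
  out_eq : ∀ v, (s v).out = (s₁ v).out
  sound : ∀ v x, (s v).mark = some x → HasColor color cluster j x ∧ Marked N cluster ptr x v
  complete : ∀ i ≤ t, ∀ u, color u = j → (s ((N.parentOf ptr (cluster u))^[i] u)).mark ≠ none

theorem ExpandInv.hopInv_zero (h : ExpandInv N k color cluster ptr j s)
    (hc : ∀ u v, cluster u = cluster v → color u = color v) :
    HopInv N color cluster ptr j s 0 fun v => (s v).start j where
  input_eq := h.input_eq
  mark_eq v := by simp only [start, h.input_eq]
  wave := by
    refine ⟨fun v x hx => ?_, fun i hi u v x hu huv => ?_⟩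
    · simp only [start, h.input_eq] at hx
      split_ifs at hx with hj
      exact ⟨v, ⟨Option.some_injective _ hx, hj⟩, .refl v⟩
    · obtain rfl := Nat.le_zero.1 hi
      obtain rfl := huv.eq
      exact ⟨u, x, by simp [start, h.input_eq, hu.1, hu.2], hu, .refl u⟩
  other _ _ _ := rfl
  closer v x hx := by
    simp only [start, h.input_eq] at hx
    split_ifs at hx
    exact .inl (Option.some_injective _ hx)
  eq_none v x hx _ := by
    obtain ⟨u, rfl, rfl⟩ := hx
    exact h.todo (cluster u) (fun u' hu' => (hc u' u hu').ge) v

theorem HopInv.hop (h : HopInv N color cluster ptr j s₀ i s)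
    (hc : ∀ u v, cluster u = cluster v → color u = color v) :
    HopInv N color cluster ptr j s₀ (i + 1) (N.runInstr hop s) where
  input_eq := h.input_eq
  mark_eq := h.mark_eq
  wave := h.wave.hop waveHop_adopt
  other x hx v := by
    rw [← h.other x hx v]
    rcases hop_eq_of_reached_or_unchanged s v x with ⟨-, -, p, hp, -⟩ | ⟨hout, -⟩
    · obtain ⟨u, hu, -⟩ := h.wave.sound _ x hp
      exact absurd ⟨u, hu⟩ hx
    · exact hout
  closer v x hx := by
    rcases hop_eq_of_reached_or_unchanged s v x with ⟨hnone, -, p, hp, hout⟩ | ⟨hout, hwave⟩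
    · obtain ⟨u, ⟨hu, hcu⟩, hnear⟩ := h.wave.sound _ x hp
      refine .inr ⟨p, i, hout, ⟨u, hu, hnear⟩, ?_⟩
      rintro ⟨u', hu', hnear'⟩
      have hcu' : color u' = j := (hc u' u (hu'.trans hu.symm)).trans hcu
      obtain ⟨_, y, hy, -⟩ := h.wave.nearest i le_rfl u' v x ⟨hu', hcu'⟩ hnear'
      simp [hnone] at hy
    · simpa only [PointsCloser, hout] using h.closer v x (hwave hx)
  eq_none v x hx hne := by
    rcases hop_eq_of_reached_or_unchanged s v x with ⟨-, hwave, -⟩ | ⟨hout, -⟩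
    · exact absurd hwave hne
    · exact hout.trans (h.eq_none v x hx fun hwave => hne (wave_hop_of_eq_some hwave))

theorem HopInv.climbInv_zero (h : HopInv N color cluster ptr j s₀ i s) :
    ClimbInv N color cluster ptr j s 0 s where
  input_eq := h.input_eq
  out_eq _ := rfl
  sound v x hx := by
    rw [h.mark_eq] at hx
    split_ifs at hx with hj
    obtain rfl := Option.some_injective _ hx
    exact ⟨⟨v, rfl, hj⟩, .self v⟩
  complete i hi u hu := by
    obtain rfl := Nat.le_zero.1 hi
    simp [h.mark_eq, hu]

theorem Marked.eq_of_hasColor (hW : IsWeakDecomposition N.graph c d (2 * k) color cluster F)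
    (hR : Represents N ptr F) (hx : HasColor color cluster j x) (hy : HasColor color cluster j y)
    (h : Marked N cluster ptr x v) (h' : Marked N cluster ptr y v) : x = y := by
  obtain ⟨u, rfl, hu⟩ := hx
  obtain ⟨u', rfl, hu'⟩ := hy
  exact hW.eq_of_nearCluster (hu.trans hu'.symm)
    (h.nearCluster (l := ⟨_, hW.label_mem u⟩) hW hR)
    (h'.nearCluster (l := ⟨_, hW.label_mem u'⟩) hW hR)

theorem ClimbInv.mark_iterate_parentOf
    (hW : IsWeakDecomposition N.graph c d (2 * k) color cluster F) (hR : Represents N ptr F)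
    (h : ClimbInv N color cluster ptr j s₁ t s) (hit : i ≤ t) (hu : color u = j) :
    (s ((N.parentOf ptr (cluster u))^[i] u)).mark = some (cluster u) := by
  obtain ⟨y, hy⟩ := Option.ne_none_iff_exists'.1 (h.complete i hit u hu)
  obtain ⟨hcolor, hmarked⟩ := h.sound _ y hy
  rw [hy, Marked.eq_of_hasColor hW hR hcolor ⟨u, rfl, hu⟩ hmarked ⟨u, i, rfl, rfl⟩]

theorem ClimbInv.climb (hW : IsWeakDecomposition N.graph c d (2 * k) color cluster F)
    (hR : Represents N ptr F) (h : ClimbInv N color cluster ptr j s₁ t s) :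
    ClimbInv N color cluster ptr j s₁ (t + 1) (N.runInstr climb s) := by
  have hptr : (fun u => (s u).input.pointers) = ptr := funext fun u => by rw [h.input_eq]
  refine ⟨h.input_eq, h.out_eq, fun v x hx => ?_, fun i hi u hu => ?_⟩
  · rcases exists_of_mark_climb_eq_some hx with hv | ⟨u, hu, rfl⟩
    · exact h.sound v x hv
    · obtain ⟨hcolor, hmarked⟩ := h.sound u x hu
      exact ⟨hcolor, hptr ▸ hmarked.parentOf⟩
  · rcases Nat.le_succ_iff.1 hi with hit | rfl
    · simp [mark_climb_of_eq_some (h.mark_iterate_parentOf hW hR hit hu)]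
    · rw [Function.iterate_succ_apply']
      have hmark :=
        mark_climb_parentOf_ne_none (N := N) (h.mark_iterate_parentOf hW hR le_rfl hu)
      rwa [hptr] at hmark

theorem ExpandSpec.congr {out out' : V → TreePointers} (h : ExpandSpec N k cluster ptr x out)
    (heq : ∀ v, out' v x = out v x) : ExpandSpec N k cluster ptr x out' where
  marked v hv := (heq v).trans (h.marked v hv)
  closer v hv hv' := by simpa only [PointsCloser, heq] using h.closer v hv hv'
  eq_none v hv := (heq v).trans (h.eq_none v hv)

theorem ClimbInv.finish_out (h : ClimbInv N color cluster ptr j s₁ t s) (v : V) (x : ℕ) :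
    (s v).finish.out x = if (s v).mark = some x then ptr v x else (s₁ v).out x := by
  simp only [finish, h.input_eq, h.out_eq]

theorem ClimbInv.expandSpec_finish
    (hW : IsWeakDecomposition N.graph c d (2 * k) color cluster F) (hR : Represents N ptr F)
    (h₁ : HopInv N color cluster ptr j s₀ k s₁) (h : ClimbInv N color cluster ptr j s₁ d s)
    (hu : color u = j) :
    ExpandSpec N k cluster ptr (cluster u) fun v => (s v).finish.out where
  marked v hv := by
    obtain ⟨w, i, hw, hi, rfl⟩ :=
      hv.exists_iterate_parent_eq (l := ⟨cluster u, hW.label_mem u⟩) hW hR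
    have hmark := h.mark_iterate_parentOf hW hR hi ((hW.color_eq w u hw).trans hu)
    rw [hw, hR.iterate_parentOf_eq ⟨cluster u, hW.label_mem u⟩] at hmark
    rw [h.finish_out, if_pos hmark]
  closer v hv hnear := by
    have hout : (s v).finish.out (cluster u) = (s₁ v).out (cluster u) := by
      rw [h.finish_out, if_neg fun hmark => hv (h.sound v _ hmark).2]
    obtain ⟨w, hw, hwv⟩ := hnear
    obtain ⟨w', y, hy, ⟨hw'y, hw'⟩, hw'v⟩ := h₁.wave.nearest k le_rfl w v (cluster u)
      ⟨hw, (hW.color_eq w u hw).trans hu⟩ hwv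
    obtain rfl : y = cluster u := hw'y.symm.trans
      (hW.eq_of_nearCluster (hw'.trans hu.symm) ⟨w', rfl, hw'v⟩ ⟨w, hw, hwv⟩)
    rcases h₁.closer v _ hy with hcluster | hcloser
    · exact absurd (hcluster ▸ .self v) hv
    · simpa only [PointsCloser, hout] using hcloser
  eq_none v hv := by
    have hmark : (s v).mark ≠ some (cluster u) := fun hmark =>
      hv ((h.sound v _ hmark).2.nearCluster (l := ⟨cluster u, hW.label_mem u⟩) hW hR)
    have hwave : (s₁ v).wave ≠ some (cluster u) := fun hwave => by
      obtain ⟨w, ⟨hw, -⟩, hwv⟩ := h₁.wave.sound v _ hwave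
      exact hv ⟨w, hw, hwv⟩
    rw [h.finish_out, if_neg hmark, h₁.eq_none v _ ⟨u, rfl, hu⟩ hwave]

theorem ExpandInv.succ (hW : IsWeakDecomposition N.graph c d (2 * k) color cluster F)
    (hR : Represents N ptr F) (h₀ : ExpandInv N k color cluster ptr j s₀)
    (h₁ : HopInv N color cluster ptr j s₀ k s₁) (h : ClimbInv N color cluster ptr j s₁ d s) :
    ExpandInv N k color cluster ptr (j + 1) fun v => (s v).finish := by
  have hother (x : ℕ) (hx : ¬ HasColor color cluster j x) (v : V) :
      (s v).finish.out x = (s₀ v).out x := by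
    rw [h.finish_out, if_neg fun hmark => hx (h.sound v x hmark).1, h₁.other x hx]
  refine ⟨h.input_eq, fun u hu => ?_, fun x hx v => ?_⟩
  · rcases Nat.lt_succ_iff_lt_or_eq.1 hu with hlt | heq
    · refine (h₀.done u hlt).congr (hother _ ?_)
      rintro ⟨w, hw, hwj⟩
      exact hlt.ne ((hW.color_eq w u hw).symm.trans hwj)
    · exact h.expandSpec_finish hW hR h₁ heq
  · rw [hother x]
    · exact h₀.todo x (fun u hu => (Nat.le_succ j).trans (hx u hu)) v
    · rintro ⟨u, hu, huj⟩
      exact (Nat.lt_of_succ_le (hx u hu)).ne' huj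

section Triple

variable {M : Set ℕ}

theorem labelMsg_mem (h0 : 0 ∈ M) {o : Option ℕ} (h : ∀ x, o = some x → x + 1 ∈ M) :
    labelMsg o ∈ M := by
  cases o with
  | none => exact h0
  | some x => exact h x rfl

theorem triple_hops (hW : IsWeakDecomposition N.graph c d (2 * k) color cluster F)
    (h0 : 0 ∈ M) (hM : ∀ v, cluster v + 1 ∈ M) (h : ExpandInv N k color cluster ptr j s₀) :
    N.Triple M (· = s₀) ([Instr.localStep (start j)] ++ (List.range k).flatMap fun _ =>
      [ExpandState.hop]) (HopInv N color cluster ptr j s₀ k) := by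
  refine .append (Q := HopInv N color cluster ptr j s₀ 0) (.localStep h0 ?_)
    (.range k fun i _ => .single (fun s hs v _ => labelMsg_mem h0 fun x hx => ?_)
      fun s hs => hs.hop hW.color_eq)
  · rintro _ rfl
    exact h.hopInv_zero hW.color_eq
  · obtain ⟨u, ⟨rfl, -⟩, -⟩ := hs.wave.sound v x hx
    exact hM u

theorem triple_climbs (hW : IsWeakDecomposition N.graph c d (2 * k) color cluster F)
    (hR : Represents N ptr F) (h0 : 0 ∈ M) (hM : ∀ v, cluster v + 1 ∈ M)
    (h₁ : HopInv N color cluster ptr j s₀ i s₁) :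
    N.Triple M (· = s₁) ((List.range d).flatMap fun _ => [climb])
      (ClimbInv N color cluster ptr j s₁ d) := by
  refine (Network.Triple.range (Inv := ClimbInv N color cluster ptr j s₁) d fun t _ =>
    .single (fun s hs v _ => labelMsg_mem h0 fun x hx => ?_) fun s hs => hs.climb hW hR).mono
      (fun s hs => hs ▸ h₁.climbInv_zero) fun _ => id
  obtain ⟨⟨u, rfl, -⟩, -⟩ := hs.sound v x (Option.filter_eq_some_iff.1 hx).1
  exact hM u

theorem triple_expandColor (hW : IsWeakDecomposition N.graph c d (2 * k) color cluster F)
    (hR : Represents N ptr F) (h0 : 0 ∈ M) (hM : ∀ v, cluster v + 1 ∈ M) (j : ℕ) :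
    N.Triple M (ExpandInv N k color cluster ptr j) (expandColor k d j)
      (ExpandInv N k color cluster ptr (j + 1)) :=
  .of_forall fun _ h₀ => .append (triple_hops hW h0 hM h₀) <|
    .of_forall fun _ h₁ => .append (triple_climbs hW hR h0 hM h₁) <|
      .localStep h0 fun _ h => h₀.succ hW hR h₁ h

end Triple

theorem ExpandInv.expandSpec (h : ExpandInv N k color cluster ptr c s) (hc : ∀ v, color v < c)
    (x : ℕ) : ExpandSpec N k cluster ptr x fun v => (s v).out := by
  by_cases hx : ∃ u, cluster u = x
  · obtain ⟨u, rfl⟩ := hx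
    exact h.done u (hc u)
  · exact ⟨fun v ⟨u, _, hu, _⟩ => absurd ⟨u, hu⟩ hx, fun v _ ⟨u, hu, _⟩ => absurd ⟨u, hu⟩ hx,
      fun v _ => h.todo x (fun u hu => absurd ⟨u, hu⟩ hx) v⟩

end ExpandProgram

/-- The algorithm that turns a decomposition into a cover, for labels of `m` bits. -/
noncomputable def expandAlgorithm (m k c d : ℕ) : DistAlgorithm DecompositionInput TreePointers :=
  Instr.toAlgorithm (Finset.range (2 ^ m + 1)) ⟨0, by simp⟩
    (fun _ _ x => ⟨x, none, none, fun _ => none⟩) (expandProgram k c d) ExpandState.out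

theorem expandAlgorithm_usesBits (m k c d : ℕ) :
    (expandAlgorithm m k c d).UsesBits (m + 1) := by
  refine Instr.toAlgorithm_usesBits ?_
  have hpow := Nat.two_pow_pos m
  rw [Finset.card_range, pow_succ]
  omega

theorem expandAlgorithm_rounds_le (m c d : ℕ) {k : ℕ} (hk : 1 ≤ k) :
    (expandAlgorithm m k c d).rounds ≤ 3 * (c * (d + k)) :=
  length_expandProgram_le c d hk

theorem expandAlgorithm_spec {V : Type} (N : Network V) {m k c d : ℕ} {color cluster : V → ℕ}
    {F : TreeFamily N.graph} {ptr : V → TreePointers}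
    (hW : IsWeakDecomposition N.graph c d (2 * k) color cluster F) (hR : Represents N ptr F)
    (hcluster : ∀ v, cluster v < 2 ^ m) (x : ℕ) :
    ExpandSpec N k cluster ptr x
      ((expandAlgorithm m k c d).result N fun v => ⟨color v, cluster v, ptr v⟩) := by
  have hM (v : V) : cluster v + 1 ∈ (Finset.range (2 ^ m + 1) : Set ℕ) := by
    simpa using hcluster v
  obtain ⟨hsafe, hinv⟩ := Network.Triple.range (Inv := ExpandInv N k color cluster ptr) c
    (fun j _ => triple_expandColor hW hR (by simp) hM j)
    (fun v => ⟨⟨color v, cluster v, ptr v⟩, none, none, fun _ => none⟩)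
    ⟨fun _ => rfl, fun _ h => absurd h (Nat.not_lt_zero _), fun _ _ _ => rfl⟩
  rw [show (expandAlgorithm m k c d).result N (fun v => ⟨color v, cluster v, ptr v⟩) = _ from
    Instr.toAlgorithm_result (N := N) _ hsafe]
  exact hinv.expandSpec hW.color_lt x

theorem DistAlgorithm.UsesBits.mono {I O : Type} {A : DistAlgorithm I O} {b b' : ℕ}
    (h : A.UsesBits b) (hb : b ≤ b') : A.UsesBits b' :=
  ⟨h.1, h.2.trans (Nat.pow_le_pow_right two_pos hb)⟩

theorem mainTheorem4_general :
    (∃ A : (m k c d : ℕ) → DistAlgorithm DecompositionInput TreePointers,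
      ∀ m k c d : ℕ, 1 ≤ k →
        (A m k c d).UsesBits (m + 1) ∧
        (A m k c d).rounds ≤ 3 * (c * (d + k)) ∧
        ∀ (V : Type) (N : Network V) (color cluster : V → ℕ) (F : TreeFamily N.graph)
          (ptr : V → TreePointers),
          IsWeakDecomposition N.graph c d (2 * k) color cluster F →
          (∀ v, cluster v < 2 ^ m) →
          Represents N ptr F →
          ∃ F' : TreeFamily N.graph,
            Represents N ((A m k c d).result N fun v => ⟨color v, cluster v, ptr v⟩) F' ∧
            IsNeighborhoodCover N.graph c k (d + 2 * k) F' ∧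
            (∀ l : F'.labels, (F'.tree l).depth ≤ ((d + k : ℕ) : ℕ∞)) ∧
            ∀ r : ℕ, (∀ l : F.labels, (F.tree l).depth ≤ r) →
              ∀ l : F'.labels, (F'.tree l).depth ≤ ((r + k : ℕ) : ℕ∞)) ∧
    (∀ a : ℕ, ∃ (b : ℕ) (f : ℕ → ℕ) (C : ℝ) (A : (n k : ℕ) → DistAlgorithm Unit TreePointers),
      (∀ n : ℕ, 1 ≤ n → (f n : ℝ) ≤ 1 + C * Real.logb 2 n ^ 8) ∧
      ∀ n k : ℕ, 1 ≤ k →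
        (A n k).UsesBits (b * logBits n) ∧
        (A n k).rounds ≤ k * f n ∧
        ∀ (V : Type) [Fintype V], Fintype.card V ≤ n →
          ∀ N : Network V, (∀ v, N.id v < 2 ^ (a * logBits n)) →
            ∃ F' : TreeFamily N.graph,
              Represents N ((A n k).result N fun _ => ()) F' ∧
              IsNeighborhoodCover N.graph (f n) k (k * f n) F') :=
  ⟨⟨expandAlgorithm, fun m k c d hk => ⟨expandAlgorithm_usesBits m k c d,
      expandAlgorithm_rounds_le m c d hk, fun _ N _ _ _ _ hW hcluster hR =>
        ExpandSpec.exists_cover (expandAlgorithm_spec N hW hR hcluster) hW hR⟩⟩,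
    fun a => ⟨_, coverFactor a, _, coverAlgorithm a, fun n _ => coverFactor_le a n,
      fun n k hk => ⟨Instr.toAlgorithm_usesBits (card_pairMsgs_coverMsgBound_le a n),
        coverAlgorithm_rounds_le a n hk, fun _ _ hV N hid =>
          coverAlgorithm_exists_cover a n k hV N hid⟩⟩⟩

theorem mainTheorem4 :
    -- From a decomposition of `G^(2k)` to a cover. Identifiers have at most `a log n` bits,
    -- messages at most `b log n` bits.
    (∃ K : ℕ, ∀ a : ℕ, ∃ (b : ℕ)
      (A : (n k c d : ℕ) → DistAlgorithm DecompositionInput TreePointers),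
      ∀ n k c d : ℕ, 1 ≤ k →
        (A n k c d).UsesBits (b * logBits n) ∧
        (A n k c d).rounds ≤ K * (c * (d + k)) ∧
        ∀ (V : Type) [Fintype V], Fintype.card V = n →
          ∀ N : Network V, (∀ v, N.id v < 2 ^ (a * logBits n)) →
          ∀ (color cluster : V → ℕ) (F : TreeFamily N.graph) (ptr : V → TreePointers),
            IsWeakDecomposition N.graph c d (2 * k) color cluster F →
            (∀ v, cluster v < 2 ^ (a * logBits n)) →
            Represents N ptr F →
            ∃ F' : TreeFamily N.graph,
              Represents N
                ((A n k c d).result N fun v => ⟨color v, cluster v, ptr v⟩) F' ∧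
              IsNeighborhoodCover N.graph c k (d + 2 * k) F' ∧
              (∀ l : F'.labels, (F'.tree l).depth ≤ ((d + k : ℕ) : ℕ∞)) ∧
              ∀ r : ℕ, (∀ l : F.labels, (F.tree l).depth ≤ r) →
                ∀ l : F'.labels, (F'.tree l).depth ≤ ((r + k : ℕ) : ℕ∞)) ∧
    -- Covers from scratch, with `f n = 2 ^ O(√(log n))`.
    (∀ a : ℕ, ∃ (b : ℕ) (f : ℕ → ℕ) (C : ℝ)
      (A : (n k : ℕ) → DistAlgorithm Unit TreePointers),
      (∀ n : ℕ, 1 ≤ n → (f n : ℝ) ≤ (2 : ℝ) ^ (C * √(Real.logb 2 n))) ∧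
      ∀ n k : ℕ, 1 ≤ k →
        (A n k).UsesBits (b * logBits n) ∧
        (A n k).rounds ≤ k * f n ∧
        ∀ (V : Type) [Fintype V], Fintype.card V = n →
          ∀ N : Network V, (∀ v, N.id v < 2 ^ (a * logBits n)) →
            ∃ F' : TreeFamily N.graph,
              Represents N ((A n k).result N fun _ => ()) F' ∧
              IsNeighborhoodCover N.graph (f n) k (k * f n) F') := by
  obtain ⟨⟨A, hA⟩, hscratch⟩ := mainTheorem4_general
  refine ⟨⟨3, fun a => ⟨a + 1, fun n => A (a * logBits n), fun n k c d hk => ?_⟩⟩, fun a => ?_⟩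
  · obtain ⟨hbits, hrounds, hcover⟩ := hA (a * logBits n) k c d hk
    exact ⟨hbits.mono (by linarith [one_le_logBits n]), hrounds,
      fun V _ _ N _ color cluster F ptr => hcover V N color cluster F ptr⟩
  · obtain ⟨b, f, C, A, hf, hA⟩ := hscratch a
    obtain ⟨C', hC'⟩ := exists_one_add_mul_pow_le_two_rpow_mul_sqrt C (p := 8) (by norm_num)
    refine ⟨b, f, C', A, fun n hn => (hf n hn).trans (hC' _ ?_), fun n k hk => ?_⟩
    · exact Real.logb_nonneg one_lt_two (by exact_mod_cast hn)
    · obtain ⟨hbits, hrounds, hcover⟩ := hA n k hk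
      exact ⟨hbits, hrounds, fun V _ hV => hcover V hV.le⟩
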